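/- **Setting.** Let $n\ge 1$ and let $\Omega\subset\mathbb R^n$ be a bounded domain. For a test function $u$ let $D^su$ be its fractional gradient, $$D^su(x)=c_{s,n}\int_{\mathbb R^n}\frac{(u(y)-u(x))\,(y-x)}{|x-y|^{n+s+1}}\,dy\quad(0<s<1),\qquad c_{s,n}=\frac{2^s\pi^{-n/2}\,\Gamma(\frac{n+s+1}{2})}{\Gamma(\frac{1-s}{2})},$$ and $D^1u=Du$. Repeated indices are summed. Let $\mu\neq0$ be a $\sigma$-finite nonnegative measure on $[0,1]$ whose support is bounded away from $0$, and let $\mathcal A(s,x)=[a^{ij}(s,x)]$, $a^i(s,x)$, $b^i(s,x)$ (on $[0,1]\times\mathbb R^n$) and $a(x)$ be real and measurable. Assume that $\mathcal A(s,x)$ is positive definite (not necessarily symmetric) for all $s\in(0,1]$, $x\in\mathbb R^n$, and that: * there are $\lambda,\Lambda:\mathbb R^n\to[0,\infty)$ with $\lambda(x)|\xi|^2\le\xi^T\mathcal A(s,x)\xi\le\Lambda(x)|\xi|^2$ for all $s\in(0,1]$ and $x,\xi\in\mathbb R^n$, and $R,C,\delta>0$, $p<n$ with $\Lambda\in L^1(B_R)$,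 $\Lambda(x)\le C|x|^p$ for $|x|\ge R$, and $\lambda^{-1}\in L^{1+\delta}_{\rm loc}(\mathbb R^n)$; * there is $K>0$ with $|\xi^T\mathcal A(s,x)\psi|^2\le K\,(\xi^T\mathcal A(s,x)\xi)(\psi^T\mathcal A(s,x)\psi)$ for all $s\in(0,1]$ and $x,\xi,\psi\in\mathbb R^n$; * with $[b^{ij}(s,x)]=\mathcal A(s,x)^{-1}$, there are finite functions $b^{ij}(x),a^i(x),b^i(x)$ with $|b^{ij}(s,x)|\le b^{ij}(x)$, $|a^i(s,x)|\le a^i(x)$, $|b^i(s,x)|\le b^i(x)$ for all $s\in(0,1]$, $x\in\mathbb R^n$. Let $a_S^{ij}$ be the entries of the symmetric part of $\mathcal A$ and $$\|\phi\|^2=\int_{\mathbb R^n}\int_{(0,1]}a_S^{ij}(s,x)\,D^s_i\phi\,D^s_j\phi\,d\mu(s)\,dx ,\qquad \phi\in C_c^\infty(\Omega).$$ Let $H^0(\mathcal A,\Omega)$ be the completion in this norm of $\{\phi\in C_c^\infty(\Omega):\|\phi\|<\infty\}$ (which is all of $C_c^\infty(\Omega)$ when $\mu$ is finite). It is realized as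 a space of integrable functions $u$ with fractional gradients $D^su$: these are the limits of $\phi_k$ in $L^1(\mathbb R^n)$ and of $D^s\phi_k$ in the norm above, for sequences of such $\phi_k$. Put $f(x)=b^{ij}(x)\big(a^i(x)a^j(x)+b^i(x)b^j(x)\big)+|a(x)|$. Suppose that $f$ is *compactly bounded* on $H^0(\mathcal A,\Omega)$: $f$ is measurable on $\Omega$ and for each $\varepsilon>0$ there is $K_\varepsilon\ge0$ with $$\int_\Omega f\phi^2\,dx\le\varepsilon\|\phi\|^2+K_\varepsilon\Big(\int_\Omega|\phi|\,dx\Big)^2\qquad\text{for all }\phi\in C_c^\infty(\Omega).$$ For $\sigma\in\mathbb R$ and $u,v\in H^0(\mathcal A,\Omega)$ let $$(\mathcal L_\sigma(f)u,v)=\int_{\mathbb R^n}\int_{(0,1]}\big(a^{ij}D^s_ju\,D^s_iv+a^iu\,D^s_iv+b^iv\,D^s_iu\big)d\mu(s)\,dx+\int_\Omega a\,uv\,dx+\sigma\int_\Omega f\,uv\,dx .$$ Call $\sigma$ an *eigenvalue* if $\mathcal L_\sigma(f)u=0$ in $(H^0(\mathcal A,\Omega))'$ for some $u\ne0$ in $H^0(\mathcal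 A,\Omega)$. **Theorem.** There is a countable set $\Sigma\subset\mathbb R$ of eigenvalues, without accumulation points in $\mathbb R$ (in particular, every point of $\Sigma$ is isolated), such that for every $T\in(H^0(\mathcal A,\Omega))'$ the following holds. * If $\sigma\notin\Sigma$, the problem $\mathcal L_\sigma(f)u=T$ in $(H^0(\mathcal A,\Omega))'$ has exactly one solution $u\in H^0(\mathcal A,\Omega)$. * If $\sigma\in\Sigma$, this problem has either no solution or infinitely many solutions. -/

import Mathlib

open MeasureTheory Filter Topology
open scoped ENNReal Distributions Matrix

noncomputable section

/-- Euclidean space `ℝⁿ`. -/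
abbrev Euc (n : ℕ) : Type := EuclideanSpace ℝ (Fin n)

/-! ### The fractional gradient of a test function -/

/-- The normalizing constant
`c_{s,n} = 2^s π^{-n/2} Γ((n+s+1)/2) / Γ((1-s)/2)` for `s < 1`. -/
def fracConst (n : ℕ) (s : ℝ) : ℝ :=
  2 ^ s * Real.pi ^ (-(n : ℝ) / 2) * Real.Gamma (((n : ℝ) + s + 1) / 2) / Real.Gamma ((1 - s) / 2)

/-- The integrand `(u(y) - u(x)) (y - x) / |x - y|^{n+s+1}` of the fractional gradient. -/
def fracKernel {n : ℕ} (s : ℝ) (u : Euc n → ℝ) (x y : Euc n) : Euc n :=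
  ((u y - u x) / ‖x - y‖ ^ ((n : ℝ) + s + 1)) • (y - x)

/-- The fractional gradient `D^s u` of a smooth compactly supported `u`: for `s ∈ (0,1)` it is
`D^s u(x) = c_{s,n} ∫ (u(y) - u(x)) (y - x) / |x - y|^{n+s+1} dy` (an absolutely convergent
integral), and for `s = 1` it is the classical gradient. -/
def fracGrad {n : ℕ} (s : ℝ) (u : Euc n → ℝ) (x : Euc n) : Euc n :=
  if s < 1 then fracConst n s • ∫ y, fracKernel s u x y else gradient u x

/-! ### Coefficients -/

/-- The bilinear expression `∑ m^{ij} ξ_i ψ_j = ξᵀ M ψ`. -/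
def matForm {n : ℕ} (M : Matrix (Fin n) (Fin n) ℝ) (ξ ψ : Euc n) : ℝ :=
  ∑ i, ∑ j, M i j * ξ i * ψ j

/-- The symmetric part of a matrix. -/
def symPart {n : ℕ} (M : Matrix (Fin n) (Fin n) ℝ) : Matrix (Fin n) (Fin n) ℝ :=
  (1 / 2 : ℝ) • (M + Mᵀ)

/-- The data of the operator
`𝓛u = ∫_{(0,1]} (-D^s_i (a^{ij}(s,x) D^s_j u + a^i(s,x) u) + b^i(s,x) D^s_i u) dμ(s) + a(x) u`,
with the standing assumptions on the measure `μ` on `[0,1]` and on the coefficients. -/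
structure MixedOperator (n : ℕ) where
  /-- the measure weighing the orders `s ∈ [0,1]` -/
  μ : Measure unitInterval
  /-- the matrix `𝓐(s,x) = [a^{ij}(s,x)]` -/
  A : unitInterval → Euc n → Matrix (Fin n) (Fin n) ℝ
  /-- the coefficients `a^i(s,x)` -/
  a : unitInterval → Euc n → Fin n → ℝ
  /-- the coefficients `b^i(s,x)` -/
  b : unitInterval → Euc n → Fin n → ℝ
  /-- the zero order coefficient `a(x)` -/
  a₀ : Euc n → ℝ
  /-- the bounds `b^{ij}(x)` for the entries of the inverse `𝓑(s,x)` of `𝓐(s,x)` -/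
  bdB : Euc n → Matrix (Fin n) (Fin n) ℝ
  /-- the bounds `a^i(x)` for `a^i(s,x)` -/
  bdA : Euc n → Fin n → ℝ
  /-- the bounds `b^i(x)` for `b^i(s,x)` -/
  bdb : Euc n → Fin n → ℝ
  sigmaFinite : SigmaFinite μ
  μ_ne_zero : μ ≠ 0
  /-- the support of `μ` is bounded away from `0` -/
  support_away : ∃ s₀ : ℝ, 0 < s₀ ∧ μ {s | (s : ℝ) < s₀} = 0
  measurable_A : ∀ i j, Measurable fun q : unitInterval × Euc n => A q.1 q.2 i j
  measurable_a : ∀ i, Measurable fun q : unitInterval × Euc n => a q.1 q.2 i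
  measurable_b : ∀ i, Measurable fun q : unitInterval × Euc n => b q.1 q.2 i
  measurable_a₀ : Measurable a₀
  posDef : ∀ s : unitInterval, 0 < s → ∀ x ξ, ξ ≠ 0 → 0 < matForm (A s x) ξ ξ
  /-- (possibly degenerate and unbounded) ellipticity -/
  elliptic : ∃ lam Lam : Euc n → ℝ,
    (∀ x, 0 ≤ lam x) ∧ (∀ x, 0 ≤ Lam x) ∧
    (∀ s : unitInterval, 0 < s → ∀ x ξ,
      lam x * ‖ξ‖ ^ 2 ≤ matForm (A s x) ξ ξ ∧ matForm (A s x) ξ ξ ≤ Lam x * ‖ξ‖ ^ 2) ∧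
    ∃ R C δ p : ℝ, 0 < R ∧ 0 < C ∧ 0 < δ ∧ p < n ∧
      IntegrableOn Lam (Metric.ball 0 R) ∧
      (∀ x, x ∉ Metric.ball (0 : Euc n) R → Lam x ≤ C * ‖x‖ ^ p) ∧
      AEMeasurable lam ∧
      ∀ K : Set (Euc n), IsCompact K →
        ∫⁻ x in K, (ENNReal.ofReal (lam x))⁻¹ ^ (1 + δ) < ∞
  cauchySchwarz : ∃ K : ℝ, 0 < K ∧ ∀ s : unitInterval, 0 < s → ∀ x ξ ψ,
    |matForm (A s x) ξ ψ| ^ 2 ≤ K * (matForm (A s x) ξ ξ * matForm (A s x) ψ ψ)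
  abs_inv_le : ∀ s : unitInterval, 0 < s → ∀ x i j, |(A s x)⁻¹ i j| ≤ bdB x i j
  abs_a_le : ∀ s : unitInterval, 0 < s → ∀ x i, |a s x i| ≤ bdA x i
  abs_b_le : ∀ s : unitInterval, 0 < s → ∀ x i, |b s x i| ≤ bdb x i

/-! ### Elementary facts on test functions and matrices -/

lemma symPart_comm {n : ℕ} (M : Matrix (Fin n) (Fin n) ℝ) (ξ ψ : Euc n) :
    matForm (symPart M) ξ ψ = matForm (symPart M) ψ ξ := by
  unfold matForm
  rw [Finset.sum_comm]
  refine Finset.sum_congr rfl fun i _ => Finset.sum_congr rfl fun j _ => ?_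
  simp only [symPart, Matrix.smul_apply, Matrix.add_apply, Matrix.transpose_apply, smul_eq_mul]
  ring

lemma matForm_symPart_self {n : ℕ} (M : Matrix (Fin n) (Fin n) ℝ) (ξ : Euc n) :
    matForm (symPart M) ξ ξ = matForm M ξ ξ := by
  have h : matForm Mᵀ ξ ξ = matForm M ξ ξ := by
    unfold matForm
    rw [Finset.sum_comm]
    refine Finset.sum_congr rfl fun i _ => Finset.sum_congr rfl fun j _ => ?_
    simp only [Matrix.transpose_apply]
    ring
  have h2 : matForm (symPart M) ξ ξ = (1 / 2) * (matForm M ξ ξ + matForm Mᵀ ξ ξ) := by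
    unfold matForm symPart
    simp only [← Finset.sum_add_distrib, Finset.mul_sum]
    refine Finset.sum_congr rfl fun i _ => Finset.sum_congr rfl fun j _ => ?_
    simp only [Matrix.smul_apply, Matrix.add_apply, smul_eq_mul]
    ring
  rw [h2, h]; ring

lemma matForm_add_left {n : ℕ} (M : Matrix (Fin n) (Fin n) ℝ) (ξ η ψ : Euc n) :
    matForm M (ξ + η) ψ = matForm M ξ ψ + matForm M η ψ := by
  simp only [matForm, PiLp.add_apply, ← Finset.sum_add_distrib]
  refine Finset.sum_congr rfl fun i _ => Finset.sum_congr rfl fun j _ => ?_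
  ring

lemma matForm_smul_left {n : ℕ} (M : Matrix (Fin n) (Fin n) ℝ) (r : ℝ) (ξ ψ : Euc n) :
    matForm M (r • ξ) ψ = r * matForm M ξ ψ := by
  simp only [matForm, PiLp.smul_apply, smul_eq_mul, Finset.mul_sum]
  refine Finset.sum_congr rfl fun i _ => Finset.sum_congr rfl fun j _ => ?_
  ring

lemma matForm_symPart_add_self {n : ℕ} (M : Matrix (Fin n) (Fin n) ℝ) (ξ η : Euc n) :
    matForm (symPart M) (ξ + η) (ξ + η) = matForm (symPart M) ξ ξ
      + 2 * matForm (symPart M) ξ η + matForm (symPart M) η η := by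
  rw [matForm_add_left, symPart_comm _ ξ (ξ + η), symPart_comm _ η (ξ + η), matForm_add_left,
    matForm_add_left, symPart_comm _ η ξ]
  ring

lemma two_abs_matForm_le {n : ℕ} (M : Matrix (Fin n) (Fin n) ℝ)
    (hM : ∀ ξ : Euc n, 0 ≤ matForm (symPart M) ξ ξ) (ξ η : Euc n) :
    2 * |matForm (symPart M) ξ η| ≤ matForm (symPart M) ξ ξ + matForm (symPart M) η η := by
  have h1 := hM (ξ + η)
  have h2 := hM (ξ + (-1 : ℝ) • η)
  rw [matForm_symPart_add_self] at h1 h2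
  rw [matForm_smul_left, symPart_comm _ ξ ((-1 : ℝ) • η), matForm_smul_left,
    symPart_comm _ η ((-1 : ℝ) • η), matForm_smul_left, symPart_comm _ η ξ] at h2
  rcases abs_cases (matForm (symPart M) ξ η) with h | h <;> rw [h.1] <;> linarith

/-- The integral defining the fractional gradient of a test function converges absolutely. -/
lemma integrable_fracKernel {n : ℕ} {Ω : TopologicalSpace.Opens (Euc n)} (φ : 𝓓(Ω, ℝ))
    {s : ℝ} (h0 : 0 < s) (h1 : s < 1) (x : Euc n) : Integrable (fracKernel s φ x) := by
  rcases Nat.eq_zero_or_pos n with rfl | hn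
  · have : fracKernel s φ x = fun _ => 0 := by
      funext y; exact Subsingleton.elim _ _
    rw [this]; exact integrable_zero _ _ _
  have : Nonempty (Fin n) := ⟨⟨0, hn⟩⟩
  obtain ⟨C, hC⟩ := φ.contDiff.lipschitzWith_of_hasCompactSupport φ.hasCompactSupport (by simp)
  obtain ⟨M, hM⟩ := φ.hasCompactSupport.exists_bound_of_continuous φ.contDiff.continuous
  have hM0 : 0 ≤ M := (norm_nonneg _).trans (hM 0)
  set g : ℝ → ℝ := fun r => min (C * r) (2 * M) * r ^ (-((n : ℝ) + s)) with hg
  have hgm : Measurable g := by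
    rw [hg]; fun_prop
  have hgi : Integrable (fun z : Euc n => g ‖z‖) := by
    rw [integrable_fun_norm_addHaar]
    have hdim : Module.finrank ℝ (Euc n) = n := by simp
    rw [hdim, ← Set.Ioc_union_Ioi_eq_Ioi (zero_le_one' ℝ)]
    have key : ∀ y : ℝ, 0 < y → y ^ (n - 1) * y ^ (-((n : ℝ) + s)) = y ^ (-1 - s) := by
      intro y hy
      rw [← Real.rpow_natCast, ← Real.rpow_add hy, Nat.cast_sub hn]
      congr 1; push_cast; ring
    refine IntegrableOn.union ?_ ?_
    · have hi : IntegrableOn (fun y : ℝ => (C : ℝ) * y ^ (-s)) (Set.Ioc 0 1) := by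
        refine Integrable.const_mul ?_ _
        rw [← IntegrableOn, ← intervalIntegrable_iff_integrableOn_Ioc_of_le zero_le_one]
        exact intervalIntegral.intervalIntegrable_rpow' (by linarith)
      refine Integrable.mono' hi (by fun_prop) ?_
      filter_upwards [ae_restrict_mem measurableSet_Ioc] with y hy
      have h3 : y ^ (-s) = y * y ^ (-1 - s) := by
        nth_rewrite 2 [← Real.rpow_one y]
        rw [← Real.rpow_add hy.1]; congr 1; ring
      have h4 : 0 ≤ y ^ (-1 - s) := Real.rpow_nonneg hy.1.le _
      have h5 : 0 ≤ min (C * y) (2 * M) :=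
        le_min (mul_nonneg C.2 hy.1.le) (by positivity)
      rw [hg, smul_eq_mul, mul_left_comm, key y hy.1, norm_mul, Real.norm_of_nonneg h5,
        Real.norm_of_nonneg h4, h3, ← mul_assoc]
      exact mul_le_mul_of_nonneg_right (min_le_left _ _) h4
    · have hi : IntegrableOn (fun y : ℝ => 2 * M * y ^ (-1 - s)) (Set.Ioi 1) :=
        Integrable.const_mul (integrableOn_Ioi_rpow_of_lt (by linarith) one_pos) _
      refine Integrable.mono' hi (by fun_prop) ?_
      filter_upwards [ae_restrict_mem measurableSet_Ioi] with y hy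
      have hy0 : 0 < y := one_pos.trans hy
      have h4 : 0 ≤ y ^ (-1 - s) := Real.rpow_nonneg hy0.le _
      have h5 : 0 ≤ min (C * y) (2 * M) :=
        le_min (mul_nonneg C.2 hy0.le) (by positivity)
      rw [hg, smul_eq_mul, mul_left_comm, key y hy0, norm_mul, Real.norm_of_nonneg h5,
        Real.norm_of_nonneg h4]
      exact mul_le_mul_of_nonneg_right (min_le_right _ _) h4
  have hgi' := hgi.comp_sub_left x
  refine hgi'.mono' ?_ (Eventually.of_forall fun y => ?_)
  · have := φ.contDiff.continuous
    refine Measurable.aestronglyMeasurable ?_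
    unfold fracKernel
    have h2 : Measurable (φ : Euc n → ℝ) := this.measurable
    fun_prop
  · rcases eq_or_ne y x with rfl | hne
    · simp only [fracKernel, sub_self, smul_zero, norm_zero]
      simp [hg, hM0]
    have hp : 0 < ‖x - y‖ := norm_pos_iff.2 (sub_ne_zero.2 hne.symm)
    have e1 : ‖x - y‖ ^ ((n : ℝ) + s + 1) = ‖x - y‖ ^ ((n : ℝ) + s) * ‖x - y‖ :=
      Real.rpow_add_one hp.ne' _
    have e2 : ‖fracKernel s φ x y‖ = ‖φ y - φ x‖ * ‖x - y‖ ^ (-((n : ℝ) + s)) := by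
      rw [fracKernel, norm_smul, norm_div, Real.norm_of_nonneg (Real.rpow_nonneg hp.le _), e1,
        norm_sub_rev y x, Real.rpow_neg hp.le]
      field_simp
    rw [e2, hg]
    refine mul_le_mul_of_nonneg_right (le_min ?_ ?_) (Real.rpow_nonneg hp.le _)
    · have := hC.norm_sub_le y x
      rwa [norm_sub_rev y x] at this
    · linarith [norm_sub_le (φ y) (φ x), hM y, hM x]

lemma fracGrad_add {n : ℕ} {Ω : TopologicalSpace.Opens (Euc n)} (φ ψ : 𝓓(Ω, ℝ))
    {s : ℝ} (h0 : 0 < s) (x : Euc n) :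
    fracGrad s (φ + ψ : 𝓓(Ω, ℝ)) x = fracGrad s φ x + fracGrad s ψ x := by
  unfold fracGrad
  split_ifs with h1
  · rw [← smul_add, ← integral_add (integrable_fracKernel φ h0 h1 x)
      (integrable_fracKernel ψ h0 h1 x)]
    congr 2
    funext y
    simp only [fracKernel, ← add_smul]
    congr 1
    have e : ∀ z, (φ + ψ : 𝓓(Ω, ℝ)) z = φ z + ψ z := fun z => rfl
    rw [e, e]
    ring
  · have hφ := (φ.contDiff.differentiable (by simp)) x
    have hψ := (ψ.contDiff.differentiable (by simp)) x
    have : ((φ + ψ : 𝓓(Ω, ℝ)) : Euc n → ℝ) = fun y => φ y + ψ y := rfl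
    rw [this]
    simp only [gradient]
    rw [fderiv_fun_add hφ hψ, map_add]

lemma fracGrad_smul {n : ℕ} {Ω : TopologicalSpace.Opens (Euc n)} (r : ℝ) (φ : 𝓓(Ω, ℝ))
    (s : ℝ) (x : Euc n) :
    fracGrad s (r • φ : 𝓓(Ω, ℝ)) x = r • fracGrad s φ x := by
  unfold fracGrad
  split_ifs with h1
  · rw [smul_comm]
    congr 1
    rw [← integral_smul]
    congr 1
    funext y
    have e : ∀ z, (r • φ : 𝓓(Ω, ℝ)) z = r * φ z := fun z => rfl
    simp only [fracKernel, smul_smul, e]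
    congr 1
    ring
  · have hφ := (φ.contDiff.differentiable (by simp)) x
    have : ((r • φ : 𝓓(Ω, ℝ)) : Euc n → ℝ) = fun y => r • φ y := rfl
    rw [this]
    simp only [gradient]
    rw [fderiv_fun_const_smul hφ, map_smul]

namespace MixedOperator

variable {n : ℕ} (L : MixedOperator n)

instance : SigmaFinite L.μ := L.sigmaFinite

/-- The measure `dμ(s) dx` on `[0,1] × ℝⁿ`. -/
def ν : Measure (unitInterval × Euc n) := L.μ.prod volume

/-- The energy `∫_{ℝⁿ} ∫_{(0,1]} a_S^{ij}(s,x) U_i(s,x) U_j(s,x) dμ(s) dx ∈ [0,∞]`. -/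
def energy (U : unitInterval × Euc n → Euc n) : ℝ≥0∞ :=
  ∫⁻ q, ENNReal.ofReal (matForm (symPart (L.A q.1 q.2)) (U q) (U q)) ∂L.ν

lemma ae_pos : ∀ᵐ q ∂L.ν, 0 < q.1 := by
  obtain ⟨s₀, h0, h⟩ := L.support_away
  have : ∀ᵐ s ∂L.μ, 0 < s := by
    rw [ae_iff]
    refine measure_mono_null (fun s hs => ?_) h
    simp only [Set.mem_ofPred_eq, not_lt] at hs ⊢
    exact lt_of_le_of_lt (by exact_mod_cast hs) h0
  exact Measure.quasiMeasurePreserving_fst.ae this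

lemma ae_nonneg : ∀ᵐ q ∂L.ν, ∀ ξ, 0 ≤ matForm (symPart (L.A q.1 q.2)) ξ ξ := by
  filter_upwards [L.ae_pos] with q hq ξ
  rw [matForm_symPart_self]
  rcases eq_or_ne ξ 0 with rfl | h
  · simp [matForm]
  · exact (L.posDef q.1 hq q.2 ξ h).le

lemma aemeasurable_matForm (U V : unitInterval × Euc n →ₘ[L.ν] Euc n) :
    AEStronglyMeasurable
      (fun q => matForm (symPart (L.A q.1 q.2)) (U q) (V q)) L.ν := by
  have hc : ∀ (W : unitInterval × Euc n →ₘ[L.ν] Euc n) (i : Fin n),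
      AEMeasurable (fun q => W q i) L.ν := fun W i =>
    (by fun_prop : Measurable fun ξ : Euc n => ξ i).comp_aemeasurable
      W.aestronglyMeasurable.aemeasurable
  have hA := L.measurable_A
  refine AEMeasurable.aestronglyMeasurable ?_
  unfold matForm symPart
  simp only [Matrix.smul_apply, Matrix.add_apply, Matrix.transpose_apply, smul_eq_mul]
  refine Finset.aemeasurable_fun_sum _ fun i _ => Finset.aemeasurable_fun_sum _ fun j _ => ?_
  exact ((((hA i j).add (hA j i)).const_mul _).aemeasurable.mul (hc U i)).mul (hc V j)

lemma energy_congr {U V : unitInterval × Euc n → Euc n} (h : U =ᵐ[L.ν] V) :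
    L.energy U = L.energy V :=
  lintegral_congr_ae (h.mono fun q hq => by simp only [hq])

lemma energy_lt_top_iff (U : unitInterval × Euc n →ₘ[L.ν] Euc n) :
    L.energy U < ∞ ↔
      Integrable (fun q => matForm (symPart (L.A q.1 q.2)) (U q) (U q)) L.ν := by
  rw [Integrable, and_iff_right (L.aemeasurable_matForm U U), hasFiniteIntegral_iff_ofReal]
  · rfl
  · filter_upwards [L.ae_nonneg] with q hq using hq _

lemma integrable_matForm {U V : unitInterval × Euc n →ₘ[L.ν] Euc n}
    (hU : L.energy U < ∞) (hV : L.energy V < ∞) :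
    Integrable (fun q => matForm (symPart (L.A q.1 q.2)) (U q) (V q)) L.ν := by
  rw [energy_lt_top_iff] at hU hV
  refine (hU.add hV).mono' (L.aemeasurable_matForm U V) ?_
  filter_upwards [L.ae_nonneg] with q hq
  have := two_abs_matForm_le _ hq (U q) (V q)
  have := abs_nonneg (matForm (symPart (L.A q.1 q.2)) (U q) (V q))
  simp only [Real.norm_eq_abs, Pi.add_apply]
  linarith

/-- Pairs `(u, U)` of (classes of) an integrable function `u` on `ℝⁿ` and a measurable field
`U(s,x)` with finite energy. -/
def energySubmodule :
    Submodule ℝ (Lp ℝ 1 (volume : Measure (Euc n)) × (unitInterval × Euc n →ₘ[L.ν] Euc n)) where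
  carrier := {w | L.energy w.2 < ∞}
  zero_mem' := by
    have h : L.energy (0 : unitInterval × Euc n →ₘ[L.ν] Euc n) = 0 := by
      rw [L.energy_congr (AEEqFun.coeFn_zero)]
      simp [energy, matForm]
    simp [h]
  add_mem' := by
    intro w w' hw hw'
    change L.energy (w.2 + w'.2 : unitInterval × Euc n →ₘ[L.ν] Euc n) < ∞
    change L.energy w.2 < ∞ at hw
    change L.energy w'.2 < ∞ at hw'
    have h3 := L.integrable_matForm hw hw'
    rw [L.energy_lt_top_iff] at *
    refine ((hw.add (h3.const_mul 2)).add hw').congr ?_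
    filter_upwards [AEEqFun.coeFn_add w.2 w'.2] with q hq
    rw [hq]
    simp [matForm_symPart_add_self]
  smul_mem' := by
    intro r w hw
    change L.energy (r • w.2 : unitInterval × Euc n →ₘ[L.ν] Euc n) < ∞
    change L.energy w.2 < ∞ at hw
    rw [L.energy_lt_top_iff] at *
    refine (hw.const_mul (r * r)).congr ?_
    filter_upwards [AEEqFun.coeFn_smul r w.2] with q hq
    rw [hq]
    simp only [Pi.smul_apply]
    rw [matForm_smul_left, symPart_comm _ (w.2 q) (r • w.2 q), matForm_smul_left]
    ring

/-- The space of pairs `(u, U)` with finite energy; it carries the (semi-)inner product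
`∫∫ a_S^{ij} U_i V_j dμ(s) dx`. -/
def EnergySpace : Type := L.energySubmodule

namespace EnergySpace

instance : AddCommGroup L.EnergySpace := inferInstanceAs (AddCommGroup L.energySubmodule)

instance : Module ℝ L.EnergySpace := inferInstanceAs (Module ℝ L.energySubmodule)

variable {L}

/-- The function `u` of the pair `(u, U)`. -/
def fn (w : L.EnergySpace) : Lp ℝ 1 (volume : Measure (Euc n)) := w.1.1

/-- The field `U` of the pair `(u, U)`. -/
def fld (w : L.EnergySpace) : unitInterval × Euc n →ₘ[L.ν] Euc n := w.1.2

lemma fn_add (w w' : L.EnergySpace) : fn (w + w') = fn w + fn w' := rfl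
lemma fn_smul (r : ℝ) (w : L.EnergySpace) : fn (r • w) = r • fn w := rfl
lemma fn_sub (w w' : L.EnergySpace) : fn (w - w') = fn w - fn w' := rfl
lemma fld_add (w w' : L.EnergySpace) : fld (w + w') = fld w + fld w' := rfl
lemma fld_smul (r : ℝ) (w : L.EnergySpace) : fld (r • w) = r • fld w := rfl

lemma integrable (w w' : L.EnergySpace) :
    Integrable (fun q => matForm (symPart (L.A q.1 q.2)) (w.fld q) (w'.fld q)) L.ν :=
  L.integrable_matForm w.2 w'.2

variable (L) in
/-- The semi-inner product `⟨(u,U), (v,V)⟩ = ∫_{ℝⁿ} ∫_{(0,1]} a_S^{ij} U_i V_j dμ(s) dx`. -/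
@[reducible] def core : PreInnerProductSpace.Core ℝ L.EnergySpace where
  inner w w' := ∫ q, matForm (symPart (L.A q.1 q.2)) (w.fld q) (w'.fld q) ∂L.ν
  conj_inner_symm w w' := by
    simp only [conj_trivial]
    exact integral_congr_ae (Eventually.of_forall fun q => symPart_comm _ _ _)
  re_inner_nonneg w := by
    simp only [RCLike.re_to_real]
    refine integral_nonneg_of_ae ?_
    filter_upwards [L.ae_nonneg] with q hq using hq _
  add_left w₁ w₂ w₃ := by
    rw [← integral_add (integrable w₁ w₃) (integrable w₂ w₃)]
    refine integral_congr_ae ?_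
    filter_upwards [AEEqFun.coeFn_add w₁.fld w₂.fld] with q hq
    rw [fld_add, hq, Pi.add_apply, matForm_add_left]
  smul_left w w' r := by
    simp only [conj_trivial]
    rw [← integral_const_mul]
    refine integral_congr_ae ?_
    filter_upwards [AEEqFun.coeFn_smul r w.fld] with q hq
    rw [fld_smul, hq, Pi.smul_apply, matForm_smul_left]

instance : SeminormedAddCommGroup L.EnergySpace :=
  @InnerProductSpace.Core.toSeminormedAddCommGroup ℝ _ _ _ _ (core L)

instance : InnerProductSpace ℝ L.EnergySpace := InnerProductSpace.ofCore (core L)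

end EnergySpace

/-- `w = (φ, D^• φ)`, where `D^• φ (s,x) = D^s φ(x)`. -/
def IsTestPair {Ω : TopologicalSpace.Opens (Euc n)} (φ : 𝓓(Ω, ℝ)) (w : L.EnergySpace) : Prop :=
  (w.fn =ᵐ[volume] φ) ∧ (w.fld =ᵐ[L.ν] fun q => fracGrad (q.1 : ℝ) φ q.2)

/-- The Hilbert space `H⁰(𝓐, Ω)`, the completion of `𝓓(Ω)` for the norm
`‖φ‖² = ∫_{ℝⁿ} ∫_{(0,1]} a_S^{ij} D^s_i φ D^s_j φ dμ(s) dx`, realized as a space of functions: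
an element is an integrable function `u` together with its fractional gradients
`(s,x) ↦ D^s u(x)`, which are the limits of test functions `φ_k` (in `L¹`) and of `D^s φ_k`
(in the norm of `H⁰(𝓐, Ω)`). The norm is the one inherited from `EnergySpace`, that is
`‖u‖² = ∫_{ℝⁿ} ∫_{(0,1]} a_S^{ij} D^s_i u D^s_j u dμ(s) dx`. -/
def H0 (Ω : TopologicalSpace.Opens (Euc n)) : Submodule ℝ L.EnergySpace where
  carrier := {w | ∃ (φ : ℕ → 𝓓(Ω, ℝ)) (v : ℕ → L.EnergySpace), (∀ k, L.IsTestPair (φ k) (v k)) ∧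
    Tendsto (fun k => ‖(v k).fn - w.fn‖) atTop (𝓝 0) ∧
    Tendsto (fun k => ‖v k - w‖) atTop (𝓝 0)}
  zero_mem' := by
    refine ⟨fun _ => 0, fun _ => 0, fun k => ⟨?_, ?_⟩, by simp, by simp⟩
    · exact Lp.coeFn_zero _ _ _
    · refine (AEEqFun.coeFn_zero (μ := L.ν) (β := Euc n)).trans (Eventually.of_forall fun q => ?_)
      have := fracGrad_smul (0 : ℝ) (0 : 𝓓(Ω, ℝ)) q.1 q.2
      simpa using this.symm
  add_mem' := by
    rintro w w' ⟨φ, v, h1, h2, h3⟩ ⟨φ', v', h1', h2', h3'⟩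
    refine ⟨fun k => φ k + φ' k, fun k => v k + v' k, fun k => ⟨?_, ?_⟩, ?_, ?_⟩
    · rw [EnergySpace.fn_add]
      filter_upwards [Lp.coeFn_add (v k).fn (v' k).fn, (h1 k).1, (h1' k).1] with x e1 e2 e3
      rw [e1, Pi.add_apply, e2, e3]; rfl
    · rw [EnergySpace.fld_add]
      filter_upwards [AEEqFun.coeFn_add (v k).fld (v' k).fld, (h1 k).2, (h1' k).2, L.ae_pos]
        with q e1 e2 e3 e4
      rw [e1, Pi.add_apply, e2, e3, fracGrad_add _ _ (by exact_mod_cast e4)]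
    · refine squeeze_zero (fun _ => norm_nonneg _) (fun k => ?_) (by simpa using h2.add h2')
      rw [EnergySpace.fn_add, EnergySpace.fn_add, add_sub_add_comm]
      exact norm_add_le _ _
    · refine squeeze_zero (fun _ => norm_nonneg _) (fun k => ?_) (by simpa using h3.add h3')
      rw [add_sub_add_comm]
      exact norm_add_le _ _
  smul_mem' := by
    rintro r w ⟨φ, v, h1, h2, h3⟩
    refine ⟨fun k => r • φ k, fun k => r • v k, fun k => ⟨?_, ?_⟩, ?_, ?_⟩
    · rw [EnergySpace.fn_smul]
      filter_upwards [Lp.coeFn_smul r (v k).fn, (h1 k).1] with x e1 e2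
      rw [e1, Pi.smul_apply, e2]; rfl
    · rw [EnergySpace.fld_smul]
      filter_upwards [AEEqFun.coeFn_smul r (v k).fld, (h1 k).2] with q e1 e2
      rw [e1, Pi.smul_apply, e2, fracGrad_smul]
    · simp only [EnergySpace.fn_smul, ← smul_sub, norm_smul]
      simpa using h2.const_mul ‖r‖
    · simp only [← smul_sub, norm_smul]
      simpa using h3.const_mul ‖r‖

/-! ### Compact boundedness and the eigenvalue problem -/

/-- `f(x) = b^{ij}(x) (a^i(x) a^j(x) + b^i(x) b^j(x)) + |a(x)|`. -/
def f (x : Euc n) : ℝ :=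
  ∑ i, ∑ j, L.bdB x i j * (L.bdA x i * L.bdA x j + L.bdb x i * L.bdb x j) + |L.a₀ x|

/-- A nonnegative measurable function `h` on `Ω` is compactly bounded on `H⁰(𝓐, Ω)` if for every
`ε > 0` there is `K ≥ 0` with `‖φ‖²_{L²(h,Ω)} ≤ ε ‖φ‖²_{H⁰(𝓐,Ω)} + K ‖φ‖²_{L¹(Ω)}` for all
`φ ∈ 𝓓(Ω)`. -/
def CompactlyBounded (Ω : TopologicalSpace.Opens (Euc n)) (h : Euc n → ℝ) : Prop :=
  (∀ x ∈ Ω, 0 ≤ h x) ∧ AEMeasurable h (volume.restrict Ω) ∧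
  ∀ ε : ℝ, 0 < ε → ∃ K : ℝ, 0 ≤ K ∧ ∀ φ : 𝓓(Ω, ℝ),
    ∫⁻ x in Ω, ENNReal.ofReal (h x * φ x ^ 2) ≤
      ENNReal.ofReal ε * L.energy (fun q => fracGrad (q.1 : ℝ) φ q.2) +
        ENNReal.ofReal K * (∫⁻ x in Ω, ENNReal.ofReal |φ x|) ^ 2

variable {Ω : TopologicalSpace.Opens (Euc n)}

/-- The bilinear form
`(𝓛u, v) = ∫_{ℝⁿ} ∫_{(0,1]} (a^{ij} D^s_j u D^s_i v + a^i u D^s_i v + b^i v D^s_i u) dμ(s) dx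
  + ∫_Ω a u v dx` on `H⁰(𝓐, Ω)`. -/
def form (u v : L.H0 Ω) : ℝ :=
  (∫ q, (matForm (L.A q.1 q.2) (v.1.fld q) (u.1.fld q)
      + ∑ i, L.a q.1 q.2 i * u.1.fn q.2 * v.1.fld q i
      + ∑ i, L.b q.1 q.2 i * v.1.fn q.2 * u.1.fld q i) ∂L.ν)
    + ∫ x in Ω, L.a₀ x * u.1.fn x * v.1.fn x

/-- The bilinear form of `𝓛_σ(f) = 𝓛 + σ 𝓘(f)`, where
`(𝓘(f)u, v) = ⟨u, v⟩_{L²(f,Ω)} = ∫_Ω f u v dx`. -/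
def formShift (σ : ℝ) (u v : L.H0 Ω) : ℝ :=
  L.form u v + σ * ∫ x in Ω, L.f x * u.1.fn x * v.1.fn x

/-- `u` solves `𝓛_σ(f) u = T` in the dual of `H⁰(𝓐, Ω)`. -/
def Solves (σ : ℝ) (T : StrongDual ℝ (L.H0 Ω)) (u : L.H0 Ω) : Prop :=
  ∀ v : L.H0 Ω, L.formShift σ u v = T v

variable (Ω) in
/-- `σ` is an eigenvalue: the homogeneous problem `𝓛_σ(f) u = 0` has a nonzero solution. -/
def IsEigenvalue (σ : ℝ) : Prop := ∃ u : L.H0 Ω, u ≠ 0 ∧ L.Solves σ 0 u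

end MixedOperator

end

/-!
If `μ` is finite, the theorem is the Fredholm alternative for a coercive form plus a multiple of a
compact form (`fredholm_alternative_of_forms`). On `H⁰(𝓐, Ω)` let `I(u,v) = ∫_Ω f u v`, a symmetric
nonnegative form. Since `|c · ξ|² ≤ K (c · 𝓐⁻¹ c) (ξᵀ 𝓐 ξ)` by the Cauchy–Schwarz hypothesis on `𝓐`
(`sq_sum_mul_le`), the lower order terms of the form of `𝓛` are bounded by `√I(u,u) ‖v‖` and
`√I(u,u) √I(v,v)`; hence the form of `𝓛` is bounded, and coercive after adding a large multiple of
`I` (`exists_clm_form`). It remains to see that `I` is compact: for every `ε` one has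
`I(u,u) ≤ ε ‖u‖²` on the common kernel of finitely many bounded functionals
(`CompactlyBounded.exists_functionals`). By compact boundedness this reduces to the corresponding
statement for the `L¹` norm of `u`.

The `L¹` estimates rest on an identity for test functions. Let `p_ε` be the Gaussian kernel. Then
`φ - p_ε * φ = ∑_j W_j * D^s_j φ` with explicit kernels `W_j`, superpositions of moments of
Gaussians, whose `L¹` norms are `O(ε^{s/2})` uniformly for `s` away from `0`; both sides have the
same Fourier transform, because the Fourier transform of `D^s φ` is
`i (2π)^s ξ |ξ|^{s-1}` times that of `φ` (`fourier_fracGrad`). Therefore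
`‖φ - p_ε * φ‖₁ ≤ C ε^{s/2} ‖D^s φ‖₁` (`exists_integral_abs_sub_heatConv_le`). For large `ε` this is
a Poincaré inequality, since `p_ε * φ` is then small on the bounded set `Ω`. For small `ε` it is
compactness, since `p_ε * φ` is controlled on `Ω` by finitely many averages of `φ`. The decay of
`D^s φ` at infinity allows one to replace `‖D^s φ‖₁` by the integral over a fixed large ball
(`exists_poincare_and_compactness`), and there the integrability of `λ⁻¹` bounds it by the energy
(`exists_le_norm_of_le_setIntegral`). The Poincaré inequality also makes `H⁰(𝓐, Ω)` a Hilbert space: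
the seminorm separates points (`eq_zero_of_norm_eq_zero`) and the space is complete
(`completeSpace_H0`).

If `μ` is infinite, the Poincaré inequality holds uniformly in the order `s`, and integrating it
over `s` shows that only the zero test function has finite energy. Then `H⁰(𝓐, Ω)` is trivial and
there are no eigenvalues (`subsingleton_H0`).
-/

noncomputable section

/-! ### Compact operators and coercive forms on a Hilbert space -/

section Abstract

variable {H : Type*} [NormedAddCommGroup H] [InnerProductSpace ℝ H]

open scoped InnerProductSpace

/-- Orthonormalizing eigenvectors `u k` for eigenvalues `c k` triangularizes the operator: the
diagonal entries are the eigenvalues. -/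
lemma inner_gramSchmidtNormed_eigenvector {T : H →L[ℝ] H} {c : ℕ → ℝ} {u : ℕ → H}
    (hu : ∀ k, T (u k) = c k • u k) (hli : LinearIndependent ℝ u) (k : ℕ) :
    ⟪InnerProductSpace.gramSchmidtNormed ℝ u k,
      T (InnerProductSpace.gramSchmidtNormed ℝ u k)⟫_ℝ = c k := by
  set e := InnerProductSpace.gramSchmidtNormed ℝ u with he
  have hon : Orthonormal ℝ e := InnerProductSpace.gramSchmidtNormed_orthonormal hli
  have h1 : e k ∈ Submodule.span ℝ (u '' Set.Iic k) := by
    rw [← InnerProductSpace.span_gramSchmidt_Iic,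
      ← InnerProductSpace.span_gramSchmidtNormed]
    exact Submodule.subset_span ⟨k, Set.self_mem_Iic, rfl⟩
  have h2 : ∀ w ∈ Submodule.span ℝ (u '' Set.Iic k),
      T w - c k • w ∈ Submodule.span ℝ (u '' Set.Iio k) := by
    intro w hw
    induction hw using Submodule.span_induction with
    | mem x hx =>
      obtain ⟨i, hi, rfl⟩ := hx
      rw [hu, ← sub_smul]
      rcases (Set.mem_Iic.1 hi).lt_or_eq with h | rfl
      · exact Submodule.smul_mem _ _ (Submodule.subset_span ⟨i, h, rfl⟩)
      · simp
    | zero => simp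
    | add x y _ _ hx hy =>
      rw [map_add, smul_add, add_sub_add_comm]
      exact Submodule.add_mem _ hx hy
    | smul r x _ hx =>
      rw [map_smul, smul_comm, ← smul_sub]
      exact Submodule.smul_mem _ _ hx
  have h3 : ∀ w ∈ Submodule.span ℝ (u '' Set.Iio k), ⟪e k, w⟫_ℝ = 0 := by
    intro w hw
    rw [← InnerProductSpace.span_gramSchmidt_Iio,
      ← InnerProductSpace.span_gramSchmidtNormed] at hw
    induction hw using Submodule.span_induction with
    | mem x hx =>
      obtain ⟨i, hi, rfl⟩ := hx
      exact hon.inner_eq_zero (Set.mem_Iio.1 hi).ne'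
    | zero => simp
    | add x y _ _ hx hy => rw [inner_add_right, hx, hy, add_zero]
    | smul r x _ hx => rw [inner_smul_right, hx, mul_zero]
  have h4 := h3 _ (h2 _ h1)
  rw [inner_sub_right, inner_smul_right, real_inner_self_eq_norm_sq, hon.norm_eq_one] at h4
  linarith

/-- The eigenvalues of a compact operator on a Hilbert space do not accumulate away from `0`. -/
lemma finite_eigenvalues_of_isCompactOperator {T : H →L[ℝ] H} (hT : IsCompactOperator T)
    {r : ℝ} (hr : 0 < r) :
    {c : ℝ | Module.End.HasEigenvalue (T : Module.End ℝ H) c ∧ r ≤ |c|}.Finite := by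
  by_contra hinf
  set c : ℕ → ℝ := fun k => (Set.Infinite.natEmbedding _ hinf k : ℝ) with hc
  have hcinj : Function.Injective c :=
    Subtype.val_injective.comp (Set.Infinite.natEmbedding _ hinf).injective
  have hcm : ∀ k, Module.End.HasEigenvalue (T : Module.End ℝ H) (c k) ∧ r ≤ |c k| := fun k =>
    (Set.Infinite.natEmbedding _ hinf k).2
  choose u hu using fun k => (hcm k).1.exists_hasEigenvector
  have hli : LinearIndependent ℝ u :=
    Module.End.eigenvectors_linearIndependent' (T : Module.End ℝ H) c hcinj u hu
  set e := InnerProductSpace.gramSchmidtNormed ℝ u with he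
  have hon : Orthonormal ℝ e := InnerProductSpace.gramSchmidtNormed_orthonormal hli
  have hdiag : ∀ k, ⟪e k, T (e k)⟫_ℝ = c k :=
    inner_gramSchmidtNormed_eigenvector (fun k => (hu k).apply_eq_smul) hli
  obtain ⟨K, hK, hK'⟩ := hT.image_closedBall_subset_compact 1
  obtain ⟨y, -, ψ, hψ, hψy⟩ := hK.tendsto_subseq
    (fun k => hK' ⟨e k, by simp [hon.norm_eq_one], rfl⟩)
  -- An orthonormal sequence converges weakly to zero.
  have hweak : Tendsto (fun k => ⟪e k, y⟫_ℝ) atTop (𝓝 0) := by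
    have h := (hon.inner_products_summable (x := y)).tendsto_atTop_zero
    have h' := (h.sqrt)
    simp only [Real.sqrt_sq (norm_nonneg _), Real.sqrt_zero] at h'
    exact tendsto_zero_iff_norm_tendsto_zero.2 h'
  have hlim : Tendsto (fun k => ⟪e (ψ k), T (e (ψ k))⟫_ℝ) atTop (𝓝 0) := by
    have h1 : Tendsto (fun k => ⟪e (ψ k), T (e (ψ k)) - y⟫_ℝ) atTop (𝓝 0) := by
      refine squeeze_zero_norm (fun k => ?_) (tendsto_iff_norm_sub_tendsto_zero.1 hψy)
      have := norm_inner_le_norm (𝕜 := ℝ) (e (ψ k)) (T (e (ψ k)) - y)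
      rw [hon.norm_eq_one, one_mul] at this
      exact this
    have h2 := h1.add (hweak.comp hψ.tendsto_atTop)
    rw [add_zero] at h2
    refine h2.congr fun k => ?_
    simp only [Function.comp, inner_sub_right]
    ring
  have : Tendsto (fun k => |c (ψ k)|) atTop (𝓝 |0|) :=
    (hlim.congr fun k => hdiag (ψ k)).abs
  have h5 := ge_of_tendsto' this (fun k => (hcm (ψ k)).2)
  simp at h5
  linarith

variable [CompleteSpace H]

/-- A bounded symmetric nonnegative form that is small on subspaces of finite codimension is
represented by a compact operator. -/
lemma isCompactOperator_of_form_small {I : H →L[ℝ] H →L[ℝ] ℝ}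
    (hsymm : ∀ u v, I u v = I v u) (hnn : ∀ u, 0 ≤ I u u)
    (hcomp : ∀ ε : ℝ, 0 < ε → ∃ (m : ℕ) (ℓ : Fin m → StrongDual ℝ H),
      ∀ u, (∀ i, ℓ i u = 0) → I u u ≤ ε * ‖u‖ ^ 2) :
    IsCompactOperator (InnerProductSpace.continuousLinearMapOfBilin I) := by
  set J := InnerProductSpace.continuousLinearMapOfBilin I with hJ
  have hJI : ∀ u v, ⟪J u, v⟫_ℝ = I u v := fun u v =>
    InnerProductSpace.continuousLinearMapOfBilin_apply I u v
  have hCS : ∀ u v, I u v ^ 2 ≤ I u u * I v v := by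
    intro u v
    have h : ∀ t : ℝ, 0 ≤ I v v * (t * t) + (2 * I u v) * t + I u u := by
      intro t
      have := hnn (u + t • v)
      simp only [map_add, map_smul, add_apply, smul_apply,
        smul_eq_mul, hsymm v u] at this
      linarith
    have := discrim_le_zero h
    rw [discrim] at this
    nlinarith
  have hJsq : ∀ u, ‖J u‖ ^ 2 ≤ ‖I‖ * I u u := by
    intro u
    rcases eq_or_ne (J u) 0 with h0 | h0
    · rw [h0]; simpa using mul_nonneg (norm_nonneg I) (hnn u)
    have h1 : ‖J u‖ ^ 2 = I u (J u) := by
      rw [← hJI, real_inner_self_eq_norm_sq]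
    have h2 := hCS u (J u)
    have h3 : I (J u) (J u) ≤ ‖I‖ * ‖J u‖ * ‖J u‖ :=
      (le_abs_self _).trans (I.le_opNorm₂ _ _)
    have hp : 0 < ‖J u‖ ^ 2 := by positivity
    rw [← h1] at h2
    have h4 : ‖J u‖ ^ 2 * ‖J u‖ ^ 2 ≤ (‖I‖ * I u u) * ‖J u‖ ^ 2 := by
      have := mul_le_mul_of_nonneg_left h3 (hnn u)
      nlinarith
    exact le_of_mul_le_mul_right h4 hp
  have hcl : IsClosed {f : H →L[ℝ] H | IsCompactOperator f} :=
    isClosed_setOfPred_isCompactOperator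
  refine hcl.closure_subset (Metric.mem_closure_iff.2 fun δ hδ => ?_)
  obtain ⟨m, ℓ, hℓ⟩ := hcomp (δ ^ 2 / (4 * (‖I‖ + 1))) (by positivity)
  set V : Submodule ℝ H :=
    Submodule.span ℝ (Set.range fun i => (InnerProductSpace.toDual ℝ H).symm (ℓ i)) with hV
  have : FiniteDimensional ℝ V := FiniteDimensional.span_of_finite ℝ (Set.finite_range _)
  refine ⟨J ∘L V.starProjection, ?_, ?_⟩
  · have : ProperSpace V := FiniteDimensional.proper ℝ V
    have h1 : IsCompactOperator (J ∘L V.subtypeL) :=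
      isCompactOperator_of_locallyCompactSpace_rng (J ∘L V.subtypeL)
    exact h1.comp_clm V.orthogonalProjectionOnto
  · rw [dist_eq_norm]
    refine lt_of_le_of_lt (ContinuousLinearMap.opNorm_le_bound _ (by positivity : 0 ≤ δ / 2)
      fun u => ?_) (half_lt_self hδ)
    set w := u - V.starProjection u with hw
    have hwV : w ∈ Vᗮ := V.sub_starProjection_mem_orthogonal u
    have hw0 : ∀ i, ℓ i w = 0 := fun i => by
      have h := Submodule.inner_right_of_mem_orthogonal
        (Submodule.subset_span (Set.mem_range_self i)) hwV
      simpa using h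
    have hwn : ‖w‖ ≤ ‖u‖ := by
      have h := V.norm_sq_eq_add_norm_sq_projection u
      have e : w = Vᗮ.starProjection u := by
        rw [hw, Submodule.starProjection_orthogonal_val]
      rw [e]
      exact Submodule.norm_starProjection_apply_le _ _
    have e1 : (J - J ∘L V.starProjection) u = J w := by simp [hw]
    rw [e1]
    refine abs_le_of_sq_le_sq' ?_ (by positivity) |>.2
    have hb : ‖I‖ * (δ ^ 2 / (4 * (‖I‖ + 1))) ≤ δ ^ 2 / 4 := by
      rw [mul_div_assoc', div_le_div_iff₀ (by positivity) (by positivity)]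
      nlinarith [sq_nonneg δ, norm_nonneg I]
    calc ‖J w‖ ^ 2 ≤ ‖I‖ * I w w := hJsq w
      _ ≤ ‖I‖ * (δ ^ 2 / (4 * (‖I‖ + 1)) * ‖w‖ ^ 2) :=
          mul_le_mul_of_nonneg_left (hℓ w hw0) (norm_nonneg I)
      _ = ‖I‖ * (δ ^ 2 / (4 * (‖I‖ + 1))) * ‖w‖ ^ 2 := by ring
      _ ≤ δ ^ 2 / 4 * ‖u‖ ^ 2 := by gcongr
      _ = (δ / 2 * ‖u‖) ^ 2 := by ring

/-- The Fredholm alternative for the pencil `B + σ I` of a form `B` that is coercive up to a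
multiple of the compact form `I`. -/
theorem fredholm_alternative_of_forms {B I : H →L[ℝ] H →L[ℝ] ℝ}
    (hsymm : ∀ u v, I u v = I v u) (hnn : ∀ u, 0 ≤ I u u)
    (hcomp : ∀ ε : ℝ, 0 < ε → ∃ (m : ℕ) (ℓ : Fin m → StrongDual ℝ H),
      ∀ u, (∀ i, ℓ i u = 0) → I u u ≤ ε * ‖u‖ ^ 2)
    (hcoer : ∃ σ₀ c : ℝ, 0 < c ∧ ∀ u, c * ‖u‖ ^ 2 ≤ B u u + σ₀ * I u u) :
    ∃ S : Set ℝ, S.Countable ∧ (∀ x : ℝ, ¬ AccPt x (𝓟 S)) ∧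
      (∀ σ ∈ S, ∃ u : H, u ≠ 0 ∧ ∀ v, B u v + σ * I u v = 0) ∧
      (∀ σ ∉ S, ∀ T : StrongDual ℝ H, ∃! u : H, ∀ v, B u v + σ * I u v = T v) := by
  obtain ⟨σ₀, c, hc, hcoer⟩ := hcoer
  have hco : IsCoercive (B + σ₀ • I) := ⟨c, hc, fun u => by
    have := hcoer u
    simp only [add_apply, smul_apply, smul_eq_mul]
    nlinarith⟩
  set A := hco.continuousLinearEquivOfBilin with hA
  have hAB : ∀ u v, ⟪A u, v⟫_ℝ = B u v + σ₀ * I u v := fun u v => by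
    rw [hA, hco.continuousLinearEquivOfBilin_apply]; rfl
  set J := InnerProductSpace.continuousLinearMapOfBilin I with hJ
  have hJI : ∀ u v, ⟪J u, v⟫_ℝ = I u v := fun u v =>
    InnerProductSpace.continuousLinearMapOfBilin_apply I u v
  set G : H →L[ℝ] H := (A.symm : H →L[ℝ] H) ∘L J with hG
  have hGc : IsCompactOperator G :=
    (isCompactOperator_of_form_small hsymm hnn hcomp).clm_comp (A.symm : H →L[ℝ] H)
  have hsolve : ∀ (σ : ℝ) (T : StrongDual ℝ H) (u : H), (∀ v, B u v + σ * I u v = T v) ↔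
      u + (σ - σ₀) • G u = A.symm ((InnerProductSpace.toDual ℝ H).symm T) := by
    intro σ T u
    rw [← A.injective.eq_iff]
    have e : A (u + (σ - σ₀) • G u) = A u + (σ - σ₀) • J u := by
      simp [hG]
    rw [e, A.apply_symm_apply]
    constructor
    · intro h
      refine ext_inner_right ℝ fun v => ?_
      rw [inner_add_left, inner_smul_left, hAB, hJI, InnerProductSpace.toDual_symm_apply, ← h v]
      simp; ring
    · intro h v
      have := congrArg (fun z => ⟪z, v⟫_ℝ) h
      simp only [inner_add_left, inner_smul_left, hAB, hJI,
        InnerProductSpace.toDual_symm_apply, conj_trivial] at this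
      rw [← this]; ring
  have heig : ∀ σ, (∃ u : H, u ≠ 0 ∧ ∀ v, B u v + σ * I u v = 0) →
      σ ≠ σ₀ ∧ Module.End.HasEigenvalue (G : Module.End ℝ H) (-(σ - σ₀)⁻¹) := by
    rintro σ ⟨u, hu0, hu⟩
    have h := (hsolve σ 0 u).1 (by simpa using hu)
    simp only [map_zero] at h
    have hne : σ ≠ σ₀ := by
      rintro rfl
      simp at h
      exact hu0 h
    refine ⟨hne, Module.End.hasEigenvalue_of_hasEigenvector (x := u) ⟨?_, hu0⟩⟩
    rw [Module.End.mem_eigenspace_iff]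
    have hs : σ - σ₀ ≠ 0 := sub_ne_zero.2 hne
    have h' : (σ - σ₀) • G u = -u := by
      rw [eq_neg_iff_add_eq_zero, add_comm]; exact h
    change G u = _
    rw [neg_smul, ← smul_neg, ← h', smul_smul, inv_mul_cancel₀ hs, one_smul]
  set S : Set ℝ := {σ | ∃ u : H, u ≠ 0 ∧ ∀ v, B u v + σ * I u v = 0} with hS
  have hfin : ∀ M : ℝ, (S ∩ Metric.closedBall σ₀ M).Finite := by
    intro M
    have h := (finite_eigenvalues_of_isCompactOperator hGc
      (r := (|M| + 1)⁻¹) (by positivity))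
    refine (h.subset ?_).of_finite_image (f := fun σ => -(σ - σ₀)⁻¹) ?_
    · rintro _ ⟨σ, ⟨hσ, hσM⟩, rfl⟩
      obtain ⟨hne, hev⟩ := heig σ hσ
      refine ⟨hev, ?_⟩
      have hs : 0 < |σ - σ₀| := abs_pos.2 (sub_ne_zero.2 hne)
      rw [abs_neg, abs_inv]
      gcongr
      rw [Metric.mem_closedBall, Real.dist_eq] at hσM
      linarith [le_abs_self M]
    · intro x _ y _ hxy
      simpa using hxy
  refine ⟨S, ?_, ?_, fun σ hσ => hσ, ?_⟩
  · have : S ⊆ ⋃ k : ℕ, S ∩ Metric.closedBall σ₀ k := by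
      intro σ hσ
      obtain ⟨k, hk⟩ := exists_nat_ge (dist σ σ₀)
      exact Set.mem_iUnion.2 ⟨k, hσ, hk⟩
    exact (Set.countable_iUnion fun k : ℕ => (hfin k).countable).mono this
  · intro x hx
    rw [accPt_iff_frequently] at hx
    set F := (S ∩ Metric.closedBall σ₀ (dist x σ₀ + 1)) \ {x} with hF
    have hFf : F.Finite := (hfin _).subset Set.sdiff_subset
    have h1 : ∀ᶠ y in 𝓝 x, y ∉ F := hFf.isClosed.isOpen_compl.mem_nhds (by simp [hF])
    have h2 : ∀ᶠ y in 𝓝 x, y ∈ Metric.ball x 1 := Metric.ball_mem_nhds x one_pos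
    obtain ⟨y, ⟨hy1, hy2⟩, hy3, hy4⟩ := (hx.and_eventually (h1.and h2)).exists
    refine hy3 ⟨⟨hy2, ?_⟩, hy1⟩
    rw [Metric.mem_closedBall]
    rw [Metric.mem_ball] at hy4
    linarith [dist_triangle y x σ₀]
  · intro σ hσ T
    suffices hbij : Function.Bijective (fun u => u + (σ - σ₀) • G u) by
      obtain ⟨u, hu, huniq⟩ :=
        hbij.existsUnique (A.symm ((InnerProductSpace.toDual ℝ H).symm T))
      exact ⟨u, (hsolve σ T u).2 hu, fun v hv => huniq v ((hsolve σ T v).1 hv)⟩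
    rcases eq_or_ne σ σ₀ with rfl | hne
    · simp only [sub_self, zero_smul, add_zero]
      exact Function.bijective_id
    have hs : σ - σ₀ ≠ 0 := sub_ne_zero.2 hne
    rcases hGc.hasEigenvalue_or_mem_resolventSet (μ := -(σ - σ₀)⁻¹)
      (by simpa using hs) with h | h
    · refine absurd ?_ hσ
      obtain ⟨u, hu⟩ := h.exists_hasEigenvector
      refine ⟨u, hu.2, fun v => ?_⟩
      refine (hsolve σ 0 u).2 ?_ v
      have e : G u = (-(σ - σ₀)⁻¹) • u := hu.apply_eq_smul
      rw [e, smul_smul]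
      field_simp
      simp
    · rw [spectrum.mem_resolventSet_iff, ContinuousLinearMap.isUnit_iff_bijective] at h
      have e : (fun u => u + (σ - σ₀) • G u) = (fun u => (-(σ - σ₀)) • u) ∘
          (algebraMap ℝ (H →L[ℝ] H) (-(σ - σ₀)⁻¹) - G) := by
        funext u
        have e1 : (algebraMap ℝ (H →L[ℝ] H) (-(σ - σ₀)⁻¹) - G) u = -(σ - σ₀)⁻¹ • u - G u := rfl
        rw [Function.comp, e1, smul_sub, smul_smul, neg_mul_neg, mul_inv_cancel₀ hs, one_smul,
          neg_smul, sub_neg_eq_add]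
      rw [e]
      exact (MulAction.bijective (Units.mk0 (-(σ - σ₀)) (neg_ne_zero.2 hs))).comp h

end Abstract

/-! ### Gaussian kernels and their Fourier transforms -/

section Gaussian

open FourierTransform Real

variable {n : ℕ}

/-- The Gaussian `(πt)^{-n/2} exp(-|x|²/t)` of unit mass; with this scaling of the time `t` its
Fourier transform is `exp(-π² t |ξ|²)`. -/
def heat (n : ℕ) (t : ℝ) (x : Euc n) : ℝ := (π * t) ^ (-(n : ℝ) / 2) * Real.exp (-t⁻¹ * ‖x‖ ^ 2)

/-- The first moment `x_j p_t(x) / t` of the Gaussian `p_t`, which is `-∂_j p_t / 2`. -/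
def heatMoment (t : ℝ) (j : Fin n) (x : Euc n) : ℝ := t⁻¹ * x j * heat n t x

lemma heat_nonneg {t : ℝ} (ht : 0 < t) (x : Euc n) : 0 ≤ heat n t x := by
  unfold heat; positivity

lemma heat_le {t : ℝ} (ht : 0 < t) (x : Euc n) : heat n t x ≤ (π * t) ^ (-(n : ℝ) / 2) := by
  unfold heat
  refine mul_le_of_le_one_right (by positivity) (Real.exp_le_one_iff.2 ?_)
  have : 0 ≤ t⁻¹ * ‖x‖ ^ 2 := by positivity
  linarith

@[fun_prop]
lemma continuous_heat (t : ℝ) : Continuous (heat n t) := by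
  unfold heat; fun_prop

lemma integrable_heat {t : ℝ} (ht : 0 < t) : Integrable (heat n t) := by
  have h := (GaussianFourier.integrable_cexp_neg_mul_sq_norm_add (V := Euc n) (b := (t⁻¹ : ℝ))
    (by simpa using ht) 0 0).norm
  refine (h.const_mul ((π * t) ^ (-(n : ℝ) / 2))).congr (Eventually.of_forall fun x => ?_)
  simp [heat, Complex.norm_exp, ← Complex.ofReal_pow]

lemma fourier_const_mul (c : ℂ) (f : Euc n → ℂ) (ξ : Euc n) :
    𝓕 (fun x => c * f x) ξ = c * 𝓕 f ξ := by
  rw [Real.fourier_eq, Real.fourier_eq, ← integral_const_mul]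
  congr 1; funext v
  rw [← smul_eq_mul, smul_comm, smul_eq_mul]

lemma fourier_heat {t : ℝ} (ht : 0 < t) (ξ : Euc n) :
    𝓕 (fun x : Euc n => (heat n t x : ℂ)) ξ = Real.exp (-π ^ 2 * t * ‖ξ‖ ^ 2) := by
  have h := fourier_gaussian_innerProductSpace (V := Euc n) (b := (t⁻¹ : ℝ))
    (by simpa using ht) ξ
  have e : (fun x : Euc n => (heat n t x : ℂ)) =
      fun v : Euc n => (((π * t) ^ (-(n : ℝ) / 2) : ℝ) : ℂ) *
        Complex.exp (-((t⁻¹ : ℝ) : ℂ) * (‖v‖ : ℂ) ^ 2) := by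
    funext x
    simp [heat]
  rw [e, fourier_const_mul, h]
  have e2 : ((π : ℂ) / ((t⁻¹ : ℝ) : ℂ)) ^ ((Module.finrank ℝ (Euc n) : ℂ) / 2) =
      (((π * t) ^ ((n : ℝ) / 2) : ℝ) : ℂ) := by
    rw [Complex.ofReal_cpow (by positivity)]
    simp
  rw [e2, ← mul_assoc, ← Complex.ofReal_mul, ← Real.rpow_add (by positivity)]
  have e3 : -(n : ℝ) / 2 + (n : ℝ) / 2 = 0 := by ring
  rw [e3, Real.rpow_zero]
  push_cast
  rw [one_mul]
  congr 1
  field_simp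

lemma integrable_norm_mul_heat {t : ℝ} (ht : 0 < t) :
    Integrable (fun x : Euc n => ‖x‖ * heat n t x) := by
  have h2 : (0 : ℝ) < t⁻¹ / 2 := by positivity
  have h := (GaussianFourier.integrable_cexp_neg_mul_sq_norm_add (V := Euc n)
    (b := ((t⁻¹ / 2 : ℝ) : ℂ)) (by rw [Complex.ofReal_re]; exact h2) 0 0).norm
  refine ((h.const_mul ((π * t) ^ (-(n : ℝ) / 2) * (1 + 2 * t)))).mono'
    (by fun_prop) (Eventually.of_forall fun x => ?_)
  have e1 : ‖Complex.exp (-((t⁻¹ / 2 : ℝ) : ℂ) * (‖x‖ : ℂ) ^ 2 + 0 * (inner ℝ (0 : Euc n) x : ℂ))‖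
      = Real.exp (-(t⁻¹ / 2) * ‖x‖ ^ 2) := by
    simp only [zero_mul, add_zero]
    rw [← Complex.ofReal_pow, ← Complex.ofReal_neg, ← Complex.ofReal_mul, ← Complex.ofReal_exp,
      Complex.norm_real, Real.norm_of_nonneg (Real.exp_nonneg _)]
  rw [e1, Real.norm_of_nonneg (mul_nonneg (norm_nonneg _) (heat_nonneg ht x)), heat]
  have e2 : Real.exp (-t⁻¹ * ‖x‖ ^ 2) =
      Real.exp (-(t⁻¹ / 2) * ‖x‖ ^ 2) * Real.exp (-(t⁻¹ / 2) * ‖x‖ ^ 2) := by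
    rw [← Real.exp_add]; congr 1; ring
  have e3 : ‖x‖ * Real.exp (-(t⁻¹ / 2) * ‖x‖ ^ 2) ≤ 1 + 2 * t := by
    have h5 : 1 + (t⁻¹ / 2) * ‖x‖ ^ 2 ≤ Real.exp ((t⁻¹ / 2) * ‖x‖ ^ 2) := by
      have := Real.add_one_le_exp ((t⁻¹ / 2) * ‖x‖ ^ 2)
      linarith
    rw [neg_mul, Real.exp_neg, ← div_eq_mul_inv, div_le_iff₀ (Real.exp_pos _)]
    refine le_trans ?_ (mul_le_mul_of_nonneg_left h5 (by positivity))
    have h6 : (1 + 2 * t) * (1 + t⁻¹ / 2 * ‖x‖ ^ 2) =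
        1 + 2 * t + t⁻¹ / 2 * ‖x‖ ^ 2 + ‖x‖ ^ 2 := by field_simp; ring
    rw [h6]
    have : 0 ≤ t⁻¹ / 2 * ‖x‖ ^ 2 := by positivity
    nlinarith [sq_nonneg (‖x‖ - 1), sq_nonneg ‖x‖]
  rw [e2]
  have e4 : 0 ≤ (π * t) ^ (-(n : ℝ) / 2) := by positivity
  calc ‖x‖ * ((π * t) ^ (-(n : ℝ) / 2) *
        (Real.exp (-(t⁻¹ / 2) * ‖x‖ ^ 2) * Real.exp (-(t⁻¹ / 2) * ‖x‖ ^ 2)))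
      = (π * t) ^ (-(n : ℝ) / 2) * (‖x‖ * Real.exp (-(t⁻¹ / 2) * ‖x‖ ^ 2)) *
          Real.exp (-(t⁻¹ / 2) * ‖x‖ ^ 2) := by ring
    _ ≤ _ := by gcongr

lemma integral_norm_mul_heat {t : ℝ} (ht : 0 < t) :
    ∫ x : Euc n, ‖x‖ * heat n t x = t ^ (1 / 2 : ℝ) * ∫ x : Euc n, ‖x‖ * heat n 1 x := by
  have hs : 0 < √t := Real.sqrt_pos.2 ht
  have h := Measure.integral_comp_smul_of_nonneg (volume : Measure (Euc n))
    (fun x : Euc n => ‖x‖ * heat n t x) (√t) (hR := hs.le)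
  have e : ∀ x : Euc n, ‖√t • x‖ * heat n t (√t • x) =
      (√t * t ^ (-(n : ℝ) / 2)) * (‖x‖ * heat n 1 x) := by
    intro x
    rw [heat, heat, norm_smul, Real.norm_of_nonneg hs.le, mul_pow, Real.sq_sqrt ht.le,
      Real.mul_rpow Real.pi_pos.le ht.le, mul_one, inv_one]
    have : -t⁻¹ * (t * ‖x‖ ^ 2) = -1 * ‖x‖ ^ 2 := by field_simp
    rw [this]; ring
  simp only [e] at h
  rw [integral_const_mul, finrank_euclideanSpace_fin, smul_eq_mul] at h
  have e2 : ((√t) ^ n)⁻¹ = t ^ (-(n : ℝ) / 2) := by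
    rw [Real.sqrt_eq_rpow, ← Real.rpow_natCast, ← Real.rpow_mul ht.le, ← Real.rpow_neg ht.le]
    congr 1; ring
  rw [e2] at h
  have hp : 0 < t ^ (-(n : ℝ) / 2) := by positivity
  rw [← Real.sqrt_eq_rpow]
  apply mul_left_cancel₀ hp.ne'
  rw [← h]; ring

lemma abs_heatMoment_le {t : ℝ} (ht : 0 < t) (j : Fin n) (x : Euc n) :
    |heatMoment t j x| ≤ t⁻¹ * (‖x‖ * heat n t x) := by
  unfold heatMoment
  rw [abs_mul, abs_mul, abs_of_nonneg (heat_nonneg ht x), abs_of_pos (inv_pos.2 ht), mul_assoc]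
  have : |x j| ≤ ‖x‖ := by simpa using PiLp.norm_apply_le x j
  gcongr
  exact heat_nonneg ht x

lemma integrable_heatMoment {t : ℝ} (ht : 0 < t) (j : Fin n) : Integrable (heatMoment t j) :=
  ((integrable_norm_mul_heat ht).const_mul t⁻¹).mono'
    (by unfold heatMoment; fun_prop)
    (Eventually.of_forall fun x => abs_heatMoment_le ht j x)

lemma integral_abs_heatMoment_le {t : ℝ} (ht : 0 < t) (j : Fin n) :
    ∫ x, |heatMoment t j x| ≤ t ^ (-(1 / 2) : ℝ) * ∫ x : Euc n, ‖x‖ * heat n 1 x := by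
  calc ∫ x, |heatMoment t j x| ≤ ∫ x : Euc n, t⁻¹ * (‖x‖ * heat n t x) :=
        integral_mono (integrable_heatMoment ht j).abs
          ((integrable_norm_mul_heat ht).const_mul t⁻¹) (fun x => abs_heatMoment_le ht j x)
    _ = _ := by
        rw [integral_const_mul, integral_norm_mul_heat ht, ← mul_assoc, ← Real.rpow_neg_one,
          ← Real.rpow_add ht]
        norm_num

/-- The Fourier transform turns a partial derivative into a multiplication. -/
lemma fourier_partial {f : Euc n → ℂ} (hf : Integrable f) (hd : Differentiable ℝ f)
    (hf' : Integrable (fderiv ℝ f)) (j : Fin n) (ξ : Euc n) :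
    𝓕 (fun x => fderiv ℝ f x (EuclideanSpace.single j 1)) ξ =
      2 * π * Complex.I * ξ j * 𝓕 f ξ := by
  rw [← Real.fourier_continuousLinearMap_apply hf', Real.fourier_fderiv hf hd hf',
    VectorFourier.fourierSMulRight_apply]
  have e : innerSL ℝ ξ (EuclideanSpace.single j (1 : ℝ)) = ξ j := by
    change inner ℝ ξ (EuclideanSpace.single j (1 : ℝ)) = ξ j
    simp [EuclideanSpace.inner_single_right]
  simp only [neg_apply, e, Complex.real_smul, smul_eq_mul, Complex.ofReal_neg]
  ring

lemma hasFDerivAt_heat (t : ℝ) (x : Euc n) :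
    HasFDerivAt (fun x : Euc n => (heat n t x : ℂ))
      (((-2 * t⁻¹ * heat n t x : ℝ) : ℂ) • (Complex.ofRealCLM ∘L innerSL ℝ x)) x := by
  have h1 : HasFDerivAt (fun x : Euc n => ‖x‖ ^ 2) (2 • innerSL ℝ x) x :=
    (hasStrictFDerivAt_norm_sq x).hasFDerivAt
  have h2 : HasFDerivAt (heat n t) ((-2 * t⁻¹ * heat n t x) • innerSL ℝ x) x := by
    have := ((h1.const_mul (-t⁻¹)).exp).const_mul ((π * t) ^ (-(n : ℝ) / 2))
    refine this.congr_fderiv ?_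
    ext v
    simp [heat]
    ring
  have h3 := Complex.ofRealCLM.hasFDerivAt.comp x h2
  refine h3.congr_fderiv ?_
  ext v
  simp

lemma fourier_heatMoment {t : ℝ} (ht : 0 < t) (j : Fin n) (ξ : Euc n) :
    𝓕 (fun x : Euc n => (heatMoment t j x : ℂ)) ξ =
      -(π * Complex.I * ξ j * Real.exp (-π ^ 2 * t * ‖ξ‖ ^ 2)) := by
  have hd : fderiv ℝ (fun x : Euc n => (heat n t x : ℂ)) = fun x =>
      ((-2 * t⁻¹ * heat n t x : ℝ) : ℂ) • (Complex.ofRealCLM ∘L innerSL ℝ x) :=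
    funext fun x => (hasFDerivAt_heat t x).fderiv
  have hi : Integrable (fderiv ℝ (fun x : Euc n => (heat n t x : ℂ))) := by
    rw [hd]
    refine ((integrable_norm_mul_heat ht).const_mul (2 * t⁻¹)).mono' ?_
      (Eventually.of_forall fun x => ?_)
    · have : Continuous fun x : Euc n => Complex.ofRealCLM ∘L innerSL ℝ x := by fun_prop
      have h2 : Continuous fun x : Euc n => ((-2 * t⁻¹ * heat n t x : ℝ) : ℂ) := by fun_prop
      exact (h2.smul this).aestronglyMeasurable
    · rw [norm_smul, Complex.norm_real, norm_mul, norm_mul, Real.norm_of_nonneg (heat_nonneg ht x),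
        Real.norm_of_nonneg (inv_pos.2 ht).le]
      have h3 : ‖Complex.ofRealCLM ∘L innerSL ℝ x‖ ≤ ‖x‖ := by
        refine (ContinuousLinearMap.opNorm_comp_le _ _).trans ?_
        rw [Complex.ofRealCLM_norm, one_mul, innerSL_apply_norm]
      have := heat_nonneg ht x
      have h4 : ‖(-2 : ℝ)‖ = 2 := by norm_num
      rw [h4]
      calc _ ≤ 2 * t⁻¹ * heat n t x * ‖x‖ := by gcongr
        _ = _ := by ring
  have hc : Integrable (fun x : Euc n => (heat n t x : ℂ)) := (integrable_heat ht).ofReal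
  have h := fourier_partial hc
    (fun x => (hasFDerivAt_heat t x).differentiableAt) hi j ξ
  have e : (fun x : Euc n => fderiv ℝ (fun x : Euc n => (heat n t x : ℂ)) x
      (EuclideanSpace.single j 1)) = fun x => (-2 : ℂ) * (heatMoment t j x : ℂ) := by
    funext x
    rw [hd]
    simp [heatMoment, EuclideanSpace.inner_single_right]
    ring
  rw [e, fourier_const_mul, fourier_heat ht] at h
  linear_combination (-1 / 2 : ℂ) * h

end Gaussian

/-! ### The kernel inverting the fractional gradient up to a Gaussian -/

section InverseKernel

open FourierTransform Real

variable {n : ℕ}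

/-- The density `τ^{-a} - (τ - ε)_+^{-a}`. Its Laplace transform is
`Γ(1 - a) q^{a - 1} (1 - e^{-ε q})`. -/
def heatWeight (a ε τ : ℝ) : ℝ := τ ^ (-a) - (Set.Ioi ε).indicator (fun τ => (τ - ε) ^ (-a)) τ

@[fun_prop]
lemma measurable_heatWeight (a ε : ℝ) : Measurable (heatWeight a ε) := by
  unfold heatWeight
  refine Measurable.sub (by fun_prop) (Measurable.indicator (by fun_prop) measurableSet_Ioi)

lemma tendsto_rpow_sub_rpow_atTop {p ε : ℝ} (hp0 : 0 < p) (hp1 : p < 1) (hε : 0 < ε) :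
    Tendsto (fun τ : ℝ => (τ - ε) ^ p - τ ^ p) atTop (𝓝 0) := by
  have h1 : Tendsto (fun τ : ℝ => -(p * ε * (τ - ε) ^ (-(1 - p)))) atTop (𝓝 0) := by
    have h := (tendsto_rpow_neg_atTop (y := 1 - p) (by linarith)).comp
      (tendsto_atTop_add_const_right atTop (-ε) tendsto_id)
    have h' := (h.const_mul (p * ε)).neg
    simpa [Function.comp_def, sub_eq_add_neg] using h'
  refine tendsto_of_tendsto_of_tendsto_of_le_of_le' h1 tendsto_const_nhds ?_ ?_
  · filter_upwards [eventually_gt_atTop ε] with τ hτ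
    have hy : 0 < τ - ε := by linarith
    have e1 : τ = (τ - ε) * (1 + ε / (τ - ε)) := by field_simp; ring
    have h2 : τ ^ p ≤ (τ - ε) ^ p * (1 + p * (ε / (τ - ε))) := by
      nth_rewrite 1 [e1]
      rw [Real.mul_rpow hy.le (by positivity)]
      gcongr
      refine rpow_one_add_le_one_add_mul_self ?_ hp0.le hp1.le
      have : 0 < ε / (τ - ε) := by positivity
      linarith
    have e2 : (τ - ε) ^ (-(1 - p)) = (τ - ε) ^ p / (τ - ε) := by
      rw [← Real.rpow_sub_one hy.ne']; congr 1; ring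
    rw [e2]
    have e3 : (τ - ε) ^ p * (1 + p * (ε / (τ - ε))) =
        (τ - ε) ^ p + p * ε * ((τ - ε) ^ p / (τ - ε)) := by ring
    linarith
  · filter_upwards [eventually_gt_atTop ε] with τ hτ
    have : (τ - ε) ^ p ≤ τ ^ p := Real.rpow_le_rpow (by linarith) (by linarith) hp0.le
    linarith

lemma integrableOn_heatWeight {a ε : ℝ} (ha0 : 0 ≤ a) (ha1 : a < 1 / 2) (hε : 0 < ε) :
    IntegrableOn (fun τ => |heatWeight a ε τ| * τ ^ (-(1 / 2) : ℝ)) (Set.Ioi 0) ∧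
      ∫ τ in Set.Ioi 0, |heatWeight a ε τ| * τ ^ (-(1 / 2) : ℝ) ≤
        2 * (ε ^ (1 / 2 - a) / (1 / 2 - a)) := by
  have hp : 0 < 1 / 2 - a := by linarith
  set F : ℝ → ℝ := fun τ => ((τ - ε) ^ (1 / 2 - a) - τ ^ (1 / 2 - a)) / (1 / 2 - a) with hF
  set F' : ℝ → ℝ := fun τ => (τ - ε) ^ (-(a + 1 / 2)) - τ ^ (-(a + 1 / 2)) with hF'
  have hder : ∀ τ ∈ Set.Ioi ε, HasDerivAt F (F' τ) τ := by
    intro τ hτ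
    have hτ1 : 0 < τ - ε := by have := Set.mem_Ioi.1 hτ; linarith
    have hτ0 : 0 < τ := by linarith
    have h1 := ((hasDerivAt_id τ).sub_const ε).rpow_const (p := 1 / 2 - a) (Or.inl hτ1.ne')
    have h2 := (hasDerivAt_id τ).rpow_const (p := 1 / 2 - a) (Or.inl hτ0.ne')
    refine ((h1.sub h2).div_const (1 / 2 - a)).congr_deriv ?_
    have e : (1 / 2 - a - 1) = -(a + 1 / 2) := by ring
    simp only [id, e, hF', one_mul]
    rw [← mul_sub, mul_div_cancel_left₀ _ hp.ne']
  have hnn : ∀ τ ∈ Set.Ioi ε, 0 ≤ F' τ := by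
    intro τ hτ
    have hτ1 : 0 < τ - ε := by have := Set.mem_Ioi.1 hτ; linarith
    exact sub_nonneg.2 (Real.rpow_le_rpow_of_nonpos hτ1 (by linarith) (by linarith))
  have hcont : ContinuousWithinAt F (Set.Ici ε) ε := by
    refine ContinuousAt.continuousWithinAt ?_
    have : ContinuousAt (fun τ : ℝ => (τ - ε) ^ (1 / 2 - a)) ε :=
      ContinuousAt.rpow_const (by fun_prop) (Or.inr hp.le)
    have h2 : ContinuousAt (fun τ : ℝ => τ ^ (1 / 2 - a)) ε :=
      ContinuousAt.rpow_const (by fun_prop) (Or.inr hp.le)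
    exact (this.sub h2).div_const _
  have hlim : Tendsto F atTop (𝓝 0) := by
    have := (tendsto_rpow_sub_rpow_atTop hp (by linarith) hε).div_const (1 / 2 - a)
    rwa [zero_div] at this
  have hi' : IntegrableOn F' (Set.Ioi ε) := integrableOn_Ioi_deriv_of_nonneg hcont hder hnn hlim
  have hv' : ∫ τ in Set.Ioi ε, F' τ = ε ^ (1 / 2 - a) / (1 / 2 - a) := by
    rw [integral_Ioi_of_hasDerivAt_of_nonneg hcont hder hnn hlim]
    simp only [hF, sub_self, Real.zero_rpow hp.ne']
    ring
  have hbd : ∀ τ ∈ Set.Ioi ε, |heatWeight a ε τ| * τ ^ (-(1 / 2) : ℝ) ≤ F' τ := by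
    intro τ hτ
    have hτ1 : 0 < τ - ε := by have := Set.mem_Ioi.1 hτ; linarith
    have hτ0 : 0 < τ := by linarith
    have h1 : τ ^ (-a) ≤ (τ - ε) ^ (-a) :=
      Real.rpow_le_rpow_of_nonpos hτ1 (by linarith) (by linarith)
    rw [heatWeight, Set.indicator_of_mem hτ, abs_sub_comm, abs_of_nonneg (by linarith), sub_mul]
    simp only [hF']
    rw [neg_add, Real.rpow_add hτ1, Real.rpow_add hτ0]
    have h2 : τ ^ (-(1 / 2) : ℝ) ≤ (τ - ε) ^ (-(1 / 2) : ℝ) :=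
      Real.rpow_le_rpow_of_nonpos hτ1 (by linarith) (by linarith)
    have h3 : 0 ≤ (τ - ε) ^ (-a) := by positivity
    gcongr
  have hm : Measurable (fun τ => |heatWeight a ε τ| * τ ^ (-(1 / 2) : ℝ)) := by fun_prop
  have hi1 : IntegrableOn (fun τ => |heatWeight a ε τ| * τ ^ (-(1 / 2) : ℝ)) (Set.Ioi ε) := by
    refine Integrable.mono' hi' hm.aestronglyMeasurable ?_
    filter_upwards [ae_restrict_mem measurableSet_Ioi] with τ hτ
    have : 0 ≤ τ := by have := Set.mem_Ioi.1 hτ; linarith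
    rw [Real.norm_of_nonneg (by positivity)]
    exact hbd τ hτ
  have heq : Set.EqOn (fun τ => |heatWeight a ε τ| * τ ^ (-(1 / 2) : ℝ))
      (fun τ => τ ^ (-(a + 1 / 2))) (Set.Ioc 0 ε) := by
    intro τ hτ
    simp only [heatWeight]
    rw [Set.indicator_of_notMem (by simpa using hτ.2), sub_zero,
      abs_of_nonneg (Real.rpow_nonneg hτ.1.le _), ← Real.rpow_add hτ.1]
    congr 1; ring
  have hi0 : IntegrableOn (fun τ : ℝ => τ ^ (-(a + 1 / 2))) (Set.Ioc 0 ε) := by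
    rw [← intervalIntegrable_iff_integrableOn_Ioc_of_le hε.le]
    exact intervalIntegral.intervalIntegrable_rpow' (by linarith)
  have hi2 := hi0.congr_fun heq.symm measurableSet_Ioc
  have hU : Set.Ioi (0 : ℝ) = Set.Ioc 0 ε ∪ Set.Ioi ε := (Set.Ioc_union_Ioi_eq_Ioi hε.le).symm
  refine ⟨hU ▸ hi2.union hi1, ?_⟩
  rw [hU, setIntegral_union (Set.Ioc_disjoint_Ioi le_rfl) measurableSet_Ioi hi2 hi1,
    setIntegral_congr_fun measurableSet_Ioc heq,
    ← intervalIntegral.integral_of_le hε.le, integral_rpow (Or.inl (by linarith))]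
  have e : -(a + 1 / 2) + 1 = 1 / 2 - a := by ring
  rw [e, Real.zero_rpow hp.ne', sub_zero, two_mul]
  refine add_le_add_right ?_ _
  rw [← hv']
  exact setIntegral_mono_on hi1 hi' measurableSet_Ioi hbd

lemma integrableOn_rpow_neg_mul_exp {a q : ℝ} (ha : a < 1) (hq : 0 < q) :
    IntegrableOn (fun τ : ℝ => τ ^ (-a) * Real.exp (-(q * τ))) (Set.Ioi 0) := by
  have := integrableOn_rpow_mul_exp_neg_mul_rpow (p := 1) (s := -a) (b := q) (by linarith)
    one_pos hq
  simpa using this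

lemma integral_rpow_neg_mul_exp {a q : ℝ} (ha : a < 1) (hq : 0 < q) :
    ∫ τ in Set.Ioi (0 : ℝ), τ ^ (-a) * Real.exp (-(q * τ)) = Real.Gamma (1 - a) * q ^ (a - 1) := by
  have := Real.integral_rpow_mul_exp_neg_mul_Ioi (a := 1 - a) (by linarith) hq
  rw [show 1 - a - 1 = -a by ring] at this
  rw [this, one_div, Real.inv_rpow hq.le, ← Real.rpow_neg hq.le, neg_sub, mul_comm]

lemma integral_heatWeight_mul_exp {a ε q : ℝ} (ha : a < 1) (hε : 0 < ε) (hq : 0 < q) :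
    ∫ τ in Set.Ioi (0 : ℝ), heatWeight a ε τ * Real.exp (-(q * τ)) =
      Real.Gamma (1 - a) * q ^ (a - 1) * (1 - Real.exp (-(q * ε))) := by
  set g : ℝ → ℝ := (Set.Ioi (0 : ℝ)).indicator fun τ => τ ^ (-a) * Real.exp (-(q * τ)) with hg
  have hgi : Integrable g :=
    (integrable_indicator_iff measurableSet_Ioi).2 (integrableOn_rpow_neg_mul_exp ha hq)
  have hgv : ∫ τ, g τ = Real.Gamma (1 - a) * q ^ (a - 1) := by
    rw [hg, integral_indicator measurableSet_Ioi, integral_rpow_neg_mul_exp ha hq]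
  rw [← integral_indicator measurableSet_Ioi]
  have e : (Set.Ioi (0 : ℝ)).indicator (fun τ => heatWeight a ε τ * Real.exp (-(q * τ))) =
      fun τ => g τ - Real.exp (-(q * ε)) * g (τ - ε) := by
    funext τ
    rcases le_or_gt τ 0 with h0 | h0
    · have h1 : ¬ (0 < τ - ε) := by linarith
      simp [hg, Set.indicator, h0.not_gt, h1]
    · rcases le_or_gt τ ε with h1 | h1
      · have h2 : ¬ (0 < τ - ε) := by linarith
        simp [hg, Set.indicator, h0, heatWeight, h1.not_gt]
      · have h2 : 0 < τ - ε := by linarith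
        have e1 : Real.exp (-(q * τ)) = Real.exp (-(q * ε)) * Real.exp (-(q * (τ - ε))) := by
          rw [← Real.exp_add]; congr 1; ring
        simp only [hg, Set.indicator, Set.mem_Ioi, h0, heatWeight, h1, if_true, h2]
        rw [sub_mul]
        nth_rewrite 2 [e1]
        ring
  rw [e, integral_sub hgi ((hgi.comp_sub_right ε).const_mul _), integral_const_mul,
    integral_sub_right_eq_self g ε, hgv]
  ring

/-- The vector kernel `∫₀^∞ (τ^{-a} - (τ - ε)_+^{-a}) x_j p_τ(x) / τ dτ`. Convolution with it
recovers, up to a constant, `φ - p_ε * φ` from the fractional gradient of order `s = 1 - 2a`. -/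
def inverseKernel (a ε : ℝ) (j : Fin n) (x : Euc n) : ℝ :=
  ∫ τ in Set.Ioi (0 : ℝ), heatWeight a ε τ * heatMoment τ j x

lemma integrable_heatWeight_mul_heatMoment {a ε : ℝ} (ha0 : 0 ≤ a) (ha1 : a < 1 / 2) (hε : 0 < ε)
    (j : Fin n) :
    Integrable (fun p : ℝ × Euc n => heatWeight a ε p.1 * heatMoment p.1 j p.2)
      ((volume.restrict (Set.Ioi 0)).prod volume) := by
  have hm : Measurable (fun p : ℝ × Euc n => heatWeight a ε p.1 * heatMoment p.1 j p.2) := by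
    unfold heatMoment heat
    fun_prop
  rw [integrable_prod_iff hm.aestronglyMeasurable]
  constructor
  · filter_upwards [ae_restrict_mem measurableSet_Ioi] with τ hτ
    exact (integrable_heatMoment hτ j).const_mul _
  · refine ((integrableOn_heatWeight ha0 ha1 hε).1.mul_const
      (∫ x : Euc n, ‖x‖ * heat n 1 x)).mono' ?_ ?_
    · exact (hm.norm.stronglyMeasurable.integral_prod_right').aestronglyMeasurable
    · filter_upwards [ae_restrict_mem measurableSet_Ioi] with τ hτ
      rw [Real.norm_of_nonneg (integral_nonneg fun x => norm_nonneg _)]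
      simp only [norm_mul, Real.norm_eq_abs]
      rw [integral_const_mul, mul_assoc]
      exact mul_le_mul_of_nonneg_left (integral_abs_heatMoment_le hτ j) (abs_nonneg _)

lemma integrable_inverseKernel {a ε : ℝ} (ha0 : 0 ≤ a) (ha1 : a < 1 / 2) (hε : 0 < ε)
    (j : Fin n) : Integrable (inverseKernel a ε j) :=
  (integrable_heatWeight_mul_heatMoment ha0 ha1 hε j).integral_prod_right

lemma integral_abs_inverseKernel_le {a ε : ℝ} (ha0 : 0 ≤ a) (ha1 : a < 1 / 2) (hε : 0 < ε)
    (j : Fin n) : ∫ x, |inverseKernel a ε j x| ≤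
      2 * (ε ^ (1 / 2 - a) / (1 / 2 - a)) * ∫ x : Euc n, ‖x‖ * heat n 1 x := by
  have hi := integrable_heatWeight_mul_heatMoment (n := n) ha0 ha1 hε j
  have hM : 0 ≤ ∫ x : Euc n, ‖x‖ * heat n 1 x :=
    integral_nonneg fun x => mul_nonneg (norm_nonneg _) (heat_nonneg one_pos x)
  calc ∫ x, |inverseKernel a ε j x|
      ≤ ∫ x : Euc n, ∫ τ in Set.Ioi (0 : ℝ), ‖heatWeight a ε τ * heatMoment τ j x‖ :=
        integral_mono (integrable_inverseKernel ha0 ha1 hε j).abs hi.norm.integral_prod_right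
          fun x => norm_integral_le_integral_norm (fun τ => heatWeight a ε τ * heatMoment τ j x)
    _ = ∫ τ in Set.Ioi (0 : ℝ), ∫ x : Euc n, ‖heatWeight a ε τ * heatMoment τ j x‖ :=
        (integral_integral_swap (f := fun τ x => ‖heatWeight a ε τ * heatMoment τ j x‖)
          hi.norm).symm
    _ ≤ ∫ τ in Set.Ioi (0 : ℝ), |heatWeight a ε τ| * τ ^ (-(1 / 2) : ℝ) *
          ∫ x : Euc n, ‖x‖ * heat n 1 x := by
        refine setIntegral_mono_on hi.norm.integral_prod_left
          ((integrableOn_heatWeight ha0 ha1 hε).1.mul_const _) measurableSet_Ioi fun τ hτ => ?_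
        simp only [norm_mul, Real.norm_eq_abs]
        rw [integral_const_mul, mul_assoc]
        exact mul_le_mul_of_nonneg_left (integral_abs_heatMoment_le hτ j) (abs_nonneg _)
    _ ≤ _ := by
        rw [integral_mul_const]
        exact mul_le_mul_of_nonneg_right (integrableOn_heatWeight ha0 ha1 hε).2 hM

lemma fourier_inverseKernel {a ε : ℝ} (ha0 : 0 ≤ a) (ha1 : a < 1 / 2) (hε : 0 < ε)
    (j : Fin n) {ξ : Euc n} (hξ : ξ ≠ 0) :
    𝓕 (fun x : Euc n => (inverseKernel a ε j x : ℂ)) ξ =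
      -(π * Complex.I * ξ j) * ((Real.Gamma (1 - a) * (π ^ 2 * ‖ξ‖ ^ 2) ^ (a - 1) *
        (1 - Real.exp (-π ^ 2 * ε * ‖ξ‖ ^ 2)) : ℝ) : ℂ) := by
  have hi : Integrable (fun p : ℝ × Euc n =>
      𝐞 (-inner ℝ p.2 ξ) • ((heatWeight a ε p.1 * heatMoment p.1 j p.2 : ℝ) : ℂ))
      ((volume.restrict (Set.Ioi 0)).prod volume) := by
    have h0 : Integrable (fun p : ℝ × Euc n =>
      ((heatWeight a ε p.1 * heatMoment p.1 j p.2 : ℝ) : ℂ)) _ :=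
        (integrable_heatWeight_mul_heatMoment (n := n) ha0 ha1 hε j).ofReal
    have hc : Continuous fun p : ℝ × Euc n => 𝐞 (-inner ℝ p.2 ξ) :=
      continuous_fourierChar.comp (by fun_prop)
    refine h0.mono (hc.aestronglyMeasurable.smul h0.1) ?_
    · exact Eventually.of_forall fun p => by simp
  rw [Real.fourier_eq]
  have e1 : ∀ x : Euc n, 𝐞 (-inner ℝ x ξ) • (inverseKernel a ε j x : ℂ) =
      ∫ τ in Set.Ioi (0 : ℝ),
        𝐞 (-inner ℝ x ξ) • ((heatWeight a ε τ * heatMoment τ j x : ℝ) : ℂ) := by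
    intro x
    rw [inverseKernel, ← integral_complex_ofReal]
    simp only [Circle.smul_def]
    rw [integral_smul]
  simp only [e1]
  rw [← integral_integral_swap (f := fun τ x =>
        𝐞 (-inner ℝ x ξ) • ((heatWeight a ε τ * heatMoment τ j x : ℝ) : ℂ)) hi]
  have e2 : ∀ τ ∈ Set.Ioi (0 : ℝ), ∫ x : Euc n,
        𝐞 (-inner ℝ x ξ) • ((heatWeight a ε τ * heatMoment τ j x : ℝ) : ℂ) =
      -(π * Complex.I * ξ j) *
        ((heatWeight a ε τ * Real.exp (-(π ^ 2 * ‖ξ‖ ^ 2 * τ)) : ℝ) : ℂ) := by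
    intro τ hτ
    have h := fourier_const_mul (heatWeight a ε τ : ℂ) (fun x : Euc n => (heatMoment τ j x : ℂ)) ξ
    rw [fourier_heatMoment hτ, Real.fourier_eq] at h
    push_cast at h ⊢
    rw [h]
    have e3 : -(π : ℂ) ^ 2 * τ * (‖ξ‖ : ℂ) ^ 2 = -((π : ℂ) ^ 2 * (‖ξ‖ : ℂ) ^ 2 * τ) := by ring
    rw [e3]; ring
  have hq : 0 < π ^ 2 * ‖ξ‖ ^ 2 := by have := norm_pos_iff.2 hξ; positivity
  rw [setIntegral_congr_fun measurableSet_Ioi e2, integral_const_mul, integral_complex_ofReal,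
    integral_heatWeight_mul_exp (by linarith) hε hq]
  congr 5
  ring

end InverseKernel

/-! ### The Fourier multiplier of the fractional gradient -/

section Multiplier

open FourierTransform Real

variable {n : ℕ}

/-- An integrable function whose Fourier transform vanishes almost everywhere is zero: pair it with
the Fourier transforms of Schwartz functions. -/
lemma ae_eq_zero_of_fourier_ae_eq_zero {f : Euc n → ℂ} (hf : Integrable f)
    (h : ∀ᵐ ξ, 𝓕 f ξ = 0) : f =ᵐ[volume] 0 := by
  refine ae_eq_zero_of_integral_contDiff_smul_eq_zero hf.locallyIntegrable fun g hg hgc => ?_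
  have hgc' : HasCompactSupport fun x => (g x : ℂ) := hgc.comp_left Complex.ofReal_zero
  have hgd : ContDiff ℝ ((⊤ : ℕ∞) : WithTop ℕ∞) fun x => (g x : ℂ) :=
    Complex.ofRealCLM.contDiff.comp hg
  set h' : SchwartzMap (Euc n) ℂ := hgc'.toSchwartzMap hgd with hh'
  have e1 : ∀ x, g x • f x = 𝓕 (𝓕⁻ h' : SchwartzMap (Euc n) ℂ) x • f x := by
    intro x
    rw [FourierTransform.fourier_fourierInv_eq]
    rfl
  simp only [e1]
  have h2 := VectorFourier.integral_fourierIntegral_smul_eq_flip (μ := volume) (ν := volume)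
    (L := innerₗ (Euc n)) (f := ((𝓕⁻ h' : SchwartzMap (Euc n) ℂ) : Euc n → ℂ)) (g := f)
    Real.continuous_fourierChar continuous_inner (𝓕⁻ h' : SchwartzMap (Euc n) ℂ).integrable hf
  rw [flip_innerₗ] at h2
  refine h2.trans (integral_eq_zero_of_ae ?_)
  filter_upwards [h] with ξ hξ
  have : VectorFourier.fourierIntegral 𝐞 volume (innerₗ (Euc n)) f ξ = 0 := hξ
  rw [this, smul_zero]; rfl

lemma integrable_min_mul_norm_rpow (hn : 0 < n) {s : ℝ} (h0 : 0 < s) (h1 : s < 1) {C M : ℝ}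
    (hC : 0 ≤ C) (hM : 0 ≤ M) :
    Integrable fun z : Euc n => min (C * ‖z‖) M * ‖z‖ ^ (-((n : ℝ) + s)) := by
  have : Nonempty (Fin n) := ⟨⟨0, hn⟩⟩
  set g : ℝ → ℝ := fun r => min (C * r) M * r ^ (-((n : ℝ) + s)) with hg
  change Integrable (fun z : Euc n => g ‖z‖)
  rw [integrable_fun_norm_addHaar, finrank_euclideanSpace_fin,
    ← Set.Ioc_union_Ioi_eq_Ioi (zero_le_one' ℝ)]
  have key : ∀ y : ℝ, 0 < y → y ^ (n - 1) * y ^ (-((n : ℝ) + s)) = y ^ (-1 - s) := by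
    intro y hy
    rw [← Real.rpow_natCast, ← Real.rpow_add hy, Nat.cast_sub hn]
    congr 1; push_cast; ring
  refine IntegrableOn.union ?_ ?_
  · have hi : IntegrableOn (fun y : ℝ => C * y ^ (-s)) (Set.Ioc 0 1) := by
      refine Integrable.const_mul ?_ _
      rw [← IntegrableOn, ← intervalIntegrable_iff_integrableOn_Ioc_of_le zero_le_one]
      exact intervalIntegral.intervalIntegrable_rpow' (by linarith)
    refine Integrable.mono' hi (by fun_prop) ?_
    filter_upwards [ae_restrict_mem measurableSet_Ioc] with y hy
    have h3 : y ^ (-s) = y * y ^ (-1 - s) := by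
      nth_rewrite 2 [← Real.rpow_one y]
      rw [← Real.rpow_add hy.1]; congr 1; ring
    have h4 : 0 ≤ y ^ (-1 - s) := Real.rpow_nonneg hy.1.le _
    have h5 : 0 ≤ min (C * y) M := le_min (mul_nonneg hC hy.1.le) hM
    rw [hg, smul_eq_mul, mul_left_comm, key y hy.1, norm_mul, Real.norm_of_nonneg h5,
      Real.norm_of_nonneg h4, h3, ← mul_assoc]
    exact mul_le_mul_of_nonneg_right (min_le_left _ _) h4
  · have hi : IntegrableOn (fun y : ℝ => M * y ^ (-1 - s)) (Set.Ioi 1) :=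
      Integrable.const_mul (integrableOn_Ioi_rpow_of_lt (by linarith) one_pos) _
    refine Integrable.mono' hi (by fun_prop) ?_
    filter_upwards [ae_restrict_mem measurableSet_Ioi] with y hy
    have hy0 : 0 < y := one_pos.trans hy
    have h4 : 0 ≤ y ^ (-1 - s) := Real.rpow_nonneg hy0.le _
    have h5 : 0 ≤ min (C * y) M := le_min (mul_nonneg hC hy0.le) hM
    rw [hg, smul_eq_mul, mul_left_comm, key y hy0, norm_mul, Real.norm_of_nonneg h5,
      Real.norm_of_nonneg h4]
    exact mul_le_mul_of_nonneg_right (min_le_right _ _) h4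

/-- Subordination of a power of the norm to the Gaussians. -/
lemma integral_rpow_mul_heatMoment {s : ℝ} (h0 : 0 < s) (j : Fin n) {z : Euc n} (hz : z ≠ 0) :
    ∫ t in Set.Ioi (0 : ℝ), t ^ (-((1 + s) / 2)) * heatMoment t j z =
      π ^ (-(n : ℝ) / 2) * Real.Gamma (((n : ℝ) + s + 1) / 2) *
        (z j * ‖z‖ ^ (-((n : ℝ) + s + 1))) := by
  set k : ℝ := ((n : ℝ) + s + 1) / 2 with hk
  have hk0 : 0 < k := by positivity
  have hz' : 0 < ‖z‖ := norm_pos_iff.2 hz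
  have h := integral_comp_rpow_Ioi (fun r : ℝ => r ^ (k - 1) * Real.exp (-(‖z‖ ^ 2 * r)))
    (p := -1) (by norm_num)
  rw [Real.integral_rpow_mul_exp_neg_mul_Ioi hk0 (by positivity)] at h
  have e : ∀ t ∈ Set.Ioi (0 : ℝ), t ^ (-((1 + s) / 2)) * heatMoment t j z =
      (π ^ (-(n : ℝ) / 2) * z j) * ((|(-1 : ℝ)| * t ^ ((-1 : ℝ) - 1)) •
        ((t ^ (-1 : ℝ)) ^ (k - 1) * Real.exp (-(‖z‖ ^ 2 * t ^ (-1 : ℝ))))) := by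
    intro t ht
    have ht : 0 < t := ht
    rw [heatMoment, heat, Real.mul_rpow Real.pi_pos.le ht.le, ← Real.rpow_mul ht.le,
      abs_neg, abs_one, one_mul, smul_eq_mul, Real.rpow_neg_one]
    have e1 : -t⁻¹ * ‖z‖ ^ 2 = -(‖z‖ ^ 2 * t⁻¹) := by ring
    have e2 : t ^ (-((1 + s) / 2)) * t⁻¹ * t ^ (-(n : ℝ) / 2) =
        t ^ ((-1 : ℝ) - 1) * t ^ (-1 * (k - 1)) := by
      rw [← Real.rpow_neg_one, ← Real.rpow_add ht, ← Real.rpow_add ht, ← Real.rpow_add ht, hk]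
      congr 1; ring
    rw [e1]
    linear_combination (z j * π ^ (-(n : ℝ) / 2) * Real.exp (-(‖z‖ ^ 2 * t⁻¹))) * e2
  rw [setIntegral_congr_fun measurableSet_Ioi e, integral_const_mul, h]
  have e3 : (1 / ‖z‖ ^ 2) ^ k = ‖z‖ ^ (-((n : ℝ) + s + 1)) := by
    rw [one_div, ← Real.rpow_natCast, ← Real.rpow_neg hz'.le, ← Real.rpow_mul hz'.le, hk]
    congr 1; push_cast; ring
  rw [e3]; ring

lemma norm_fourierChar_sub_one_le (r : ℝ) : ‖((𝐞 r : Circle) : ℂ) - 1‖ ≤ min (2 * π * |r|) 2 := by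
  refine le_min ?_ ?_
  · rw [Real.fourierChar_apply]
    have := Real.norm_exp_I_mul_ofReal_sub_one_le (x := 2 * π * r)
    rw [Real.norm_eq_abs, abs_mul, abs_of_pos (by positivity : (0 : ℝ) < 2 * π)] at this
    rwa [mul_comm Complex.I] at this
  · refine (norm_sub_le _ _).trans ?_
    rw [Circle.norm_coe, norm_one]; norm_num

lemma integrable_multiplier (hn : 0 < n) {s : ℝ} (h0 : 0 < s) (h1 : s < 1) (j : Fin n)
    (ξ : Euc n) :
    Integrable (fun p : ℝ × Euc n => (((𝐞 (inner ℝ p.2 ξ) : Circle) : ℂ) - 1) *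
      ((p.1 ^ (-((1 + s) / 2)) * heatMoment p.1 j p.2 : ℝ) : ℂ))
      ((volume.restrict (Set.Ioi 0)).prod volume) := by
  have hm1 : Measurable (fun p : ℝ × Euc n => p.1 ^ (-((1 + s) / 2)) * heatMoment p.1 j p.2) := by
    unfold heatMoment heat
    fun_prop
  have hc : Continuous fun p : ℝ × Euc n => ((𝐞 (inner ℝ p.2 ξ) : Circle) : ℂ) - 1 := by
    have : Continuous fun p : ℝ × Euc n => 𝐞 (inner ℝ p.2 ξ) :=
      continuous_fourierChar.comp (by fun_prop)
    fun_prop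
  have hm : Measurable (fun p : ℝ × Euc n => (((𝐞 (inner ℝ p.2 ξ) : Circle) : ℂ) - 1) *
      ((p.1 ^ (-((1 + s) / 2)) * heatMoment p.1 j p.2 : ℝ) : ℂ)) :=
    hc.measurable.mul (Complex.measurable_ofReal.comp hm1)
  have : Nonempty (Fin n) := ⟨j⟩
  have hne : ∀ᵐ z : Euc n, z ≠ 0 := by
    simp [ae_iff]
  set c : ℝ := π ^ (-(n : ℝ) / 2) * Real.Gamma (((n : ℝ) + s + 1) / 2) with hcdef
  have hc0 : 0 < c := mul_pos (by positivity) (Real.Gamma_pos_of_pos (by positivity))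
  -- Integrability in `t` comes from the nonzero value of the subordination integral.
  have hit : ∀ z : Euc n, z ≠ 0 →
      IntegrableOn (fun t : ℝ => t ^ (-((1 + s) / 2)) * heatMoment t j z) (Set.Ioi 0) := by
    intro z hz
    by_cases hzj : z j = 0
    · have : (fun t : ℝ => t ^ (-((1 + s) / 2)) * heatMoment t j z) = fun _ => 0 := by
        funext t; simp [heatMoment, hzj]
      rw [this]; exact integrableOn_zero
    · refine Integrable.of_integral_ne_zero ?_
      rw [integral_rpow_mul_heatMoment h0 j hz]
      have := norm_pos_iff.2 hz
      exact mul_ne_zero hc0.ne' (mul_ne_zero hzj (by positivity))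
  have hnorm : ∀ z : Euc n, z ≠ 0 →
      ∫ t in Set.Ioi (0 : ℝ), |t ^ (-((1 + s) / 2)) * heatMoment t j z| =
        c * (|z j| * ‖z‖ ^ (-((n : ℝ) + s + 1))) := by
    intro z hz
    have hz' := norm_pos_iff.2 hz
    have e1 : ∀ t ∈ Set.Ioi (0 : ℝ), |t ^ (-((1 + s) / 2)) * heatMoment t j z| =
        SignType.sign (z j) * (t ^ (-((1 + s) / 2)) * heatMoment t j z) := by
      intro t ht
      have ht : 0 < t := ht
      have h1 : 0 ≤ t ^ (-((1 + s) / 2)) * (t⁻¹ * heat n t z) := by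
        have := heat_nonneg ht z; positivity
      have e : t ^ (-((1 + s) / 2)) * heatMoment t j z =
          z j * (t ^ (-((1 + s) / 2)) * (t⁻¹ * heat n t z)) := by
        rw [heatMoment]; ring
      rw [e, abs_mul, abs_of_nonneg h1, ← sign_mul_self (z j)]
      ring
    rw [setIntegral_congr_fun measurableSet_Ioi e1, integral_const_mul,
      integral_rpow_mul_heatMoment h0 j hz, ← sign_mul_self (z j)]
    ring
  rw [integrable_prod_iff' hm.aestronglyMeasurable]
  constructor
  · filter_upwards [hne] with z hz
    exact ((hit z hz).ofReal).const_mul _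
  · refine ((integrable_min_mul_norm_rpow (n := n) hn h0 h1
      (C := 2 * π * ‖ξ‖) (M := 2) (by positivity) (by norm_num)).const_mul c).mono' ?_ ?_
    · exact (hm.norm.stronglyMeasurable.integral_prod_left').aestronglyMeasurable
    · filter_upwards [hne] with z hz
      have hz' := norm_pos_iff.2 hz
      rw [Real.norm_of_nonneg (integral_nonneg fun x => norm_nonneg _)]
      simp only [norm_mul, Complex.norm_real]
      rw [integral_const_mul]
      have e := hnorm z hz
      simp only [abs_mul] at e
      simp only [Real.norm_eq_abs]
      rw [e]
      have e2 : ‖z‖ ^ (-((n : ℝ) + s)) = ‖z‖ * ‖z‖ ^ (-((n : ℝ) + s + 1)) := by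
        rw [mul_comm, ← Real.rpow_add_one hz'.ne']; congr 1; ring
      have h3 : |z j| ≤ ‖z‖ := by simpa using PiLp.norm_apply_le z j
      have h4 : ‖((𝐞 (inner ℝ z ξ) : Circle) : ℂ) - 1‖ ≤ min (2 * π * ‖ξ‖ * ‖z‖) 2 := by
        refine (norm_fourierChar_sub_one_le _).trans (min_le_min_right _ ?_)
        have := abs_real_inner_le_norm z ξ
        calc 2 * π * |inner ℝ z ξ| ≤ 2 * π * (‖z‖ * ‖ξ‖) := by gcongr
          _ = _ := by ring
      rw [e2]
      have h5 : 0 ≤ min (2 * π * ‖ξ‖ * ‖z‖) 2 := (norm_nonneg _).trans h4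
      calc _ ≤ min (2 * π * ‖ξ‖ * ‖z‖) 2 * (c * (‖z‖ * ‖z‖ ^ (-((n : ℝ) + s + 1)))) := by
            gcongr
        _ = _ := by ring

/-- The Fourier multiplier of the kernel `c_{s,n} z / |z|^{n+s+1}` of the fractional gradient. -/
lemma integral_multiplier (hn : 0 < n) {s : ℝ} (h0 : 0 < s) (h1 : s < 1) (j : Fin n)
    {ξ : Euc n} (hξ : ξ ≠ 0) :
    (fracConst n s : ℂ) * ∫ z : Euc n, (((𝐞 (inner ℝ z ξ) : Circle) : ℂ) - 1) *
        ((z j * ‖z‖ ^ (-((n : ℝ) + s + 1)) : ℝ) : ℂ) =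
      π * Complex.I * ξ j * ((2 ^ s * (π ^ 2 * ‖ξ‖ ^ 2) ^ ((s - 1) / 2) : ℝ) : ℂ) := by
  have : Nonempty (Fin n) := ⟨j⟩
  have hne : ∀ᵐ z : Euc n, z ≠ 0 := by simp [ae_iff]
  set c : ℝ := π ^ (-(n : ℝ) / 2) * Real.Gamma (((n : ℝ) + s + 1) / 2) with hcdef
  have hc0 : 0 < c := mul_pos (by positivity) (Real.Gamma_pos_of_pos (by positivity))
  have hG : 0 < Real.Gamma ((1 - s) / 2) := Real.Gamma_pos_of_pos (by linarith)
  have hi := integrable_multiplier hn h0 h1 j ξ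
  have e1 : ∫ z : Euc n, (((𝐞 (inner ℝ z ξ) : Circle) : ℂ) - 1) *
        ((c * (z j * ‖z‖ ^ (-((n : ℝ) + s + 1))) : ℝ) : ℂ) =
      ∫ z : Euc n, ∫ t in Set.Ioi (0 : ℝ), (((𝐞 (inner ℝ z ξ) : Circle) : ℂ) - 1) *
        ((t ^ (-((1 + s) / 2)) * heatMoment t j z : ℝ) : ℂ) := by
    refine integral_congr_ae ?_
    filter_upwards [hne] with z hz
    rw [integral_const_mul, integral_complex_ofReal, integral_rpow_mul_heatMoment h0 j hz]
  rw [← integral_integral_swap (f := fun t z => (((𝐞 (inner ℝ z ξ) : Circle) : ℂ) - 1) *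
        ((t ^ (-((1 + s) / 2)) * heatMoment t j z : ℝ) : ℂ)) hi] at e1
  have e2 : ∀ t ∈ Set.Ioi (0 : ℝ), ∫ z : Euc n, (((𝐞 (inner ℝ z ξ) : Circle) : ℂ) - 1) *
        ((t ^ (-((1 + s) / 2)) * heatMoment t j z : ℝ) : ℂ) =
      π * Complex.I * ξ j *
        ((t ^ (-((1 + s) / 2)) * Real.exp (-(π ^ 2 * ‖ξ‖ ^ 2 * t)) : ℝ) : ℂ) := by
    intro t ht
    have hI : Integrable (fun z : Euc n => (heatMoment t j z : ℂ)) :=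
      (integrable_heatMoment ht j).ofReal
    have hF := fourier_heatMoment ht j (-ξ)
    have hF0 := fourier_heatMoment ht j (0 : Euc n)
    rw [Real.fourier_eq] at hF hF0
    have hI1 := (Real.fourierIntegral_convergent_iff (-ξ)).2 hI
    simp only [inner_neg_right, neg_neg, Circle.smul_def, smul_eq_mul] at hF hI1
    simp only [inner_zero_right, neg_zero, AddChar.map_zero_eq_one, one_smul] at hF0
    have e3 : (fun z : Euc n => (((𝐞 (inner ℝ z ξ) : Circle) : ℂ) - 1) *
        ((t ^ (-((1 + s) / 2)) * heatMoment t j z : ℝ) : ℂ)) =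
        fun z => ((t ^ (-((1 + s) / 2)) : ℝ) : ℂ) *
          (((𝐞 (inner ℝ z ξ) : Circle) : ℂ) * (heatMoment t j z : ℂ) - (heatMoment t j z : ℂ)) := by
      funext z; push_cast; ring
    rw [e3, integral_const_mul, integral_sub hI1 hI, hF, hF0]
    have e4 : -(π : ℝ) ^ 2 * t * ‖-ξ‖ ^ 2 = -(π ^ 2 * ‖ξ‖ ^ 2 * t) := by rw [norm_neg]; ring
    rw [e4]
    simp
    ring
  have hq : 0 < π ^ 2 * ‖ξ‖ ^ 2 := by have := norm_pos_iff.2 hξ; positivity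
  rw [setIntegral_congr_fun measurableSet_Ioi e2, integral_const_mul, integral_complex_ofReal,
    integral_rpow_neg_mul_exp (by linarith) hq] at e1
  have e5 : ∫ z : Euc n, (((𝐞 (inner ℝ z ξ) : Circle) : ℂ) - 1) *
        ((c * (z j * ‖z‖ ^ (-((n : ℝ) + s + 1))) : ℝ) : ℂ) =
      (c : ℂ) * ∫ z : Euc n, (((𝐞 (inner ℝ z ξ) : Circle) : ℂ) - 1) *
        ((z j * ‖z‖ ^ (-((n : ℝ) + s + 1)) : ℝ) : ℂ) := by
    rw [← integral_const_mul]
    congr 1; funext z; push_cast; ring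
  rw [e5] at e1
  have e6 : fracConst n s = 2 ^ s / Real.Gamma ((1 - s) / 2) * c := by
    rw [fracConst, hcdef]; ring
  rw [e6, Complex.ofReal_mul, mul_assoc, e1]
  have e7 : (1 : ℝ) - (1 + s) / 2 = (1 - s) / 2 := by ring
  have e8 : (1 + s) / 2 - (1 : ℝ) = (s - 1) / 2 := by ring
  rw [e7, e8]
  have hG' : (Real.Gamma ((1 - s) / 2) : ℂ) ≠ 0 := by exact_mod_cast hG.ne'
  push_cast
  field_simp

end Multiplier

/-! ### The Fourier transform of the fractional gradient -/

section FracGradFourier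

open FourierTransform Real

variable {n : ℕ} {Ω : TopologicalSpace.Opens (Euc n)}

lemma integrable_testFunction (φ : 𝓓(Ω, ℝ)) : Integrable (φ : Euc n → ℝ) :=
  φ.contDiff.continuous.integrable_of_hasCompactSupport φ.hasCompactSupport

lemma norm_le_sum_abs (v : Euc n) : ‖v‖ ≤ ∑ j, |v j| := by
  have h : v = ∑ j, v j • EuclideanSpace.single j (1 : ℝ) := by
    ext i
    simp [Finset.sum_apply, Pi.single_apply]
  conv_lhs => rw [h]
  refine (norm_sum_le _ _).trans (Finset.sum_le_sum fun j _ => ?_)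
  simp [norm_smul]

/-- The `L¹` modulus of continuity of a test function. -/
lemma exists_integral_abs_shift_sub_le (φ : 𝓓(Ω, ℝ)) :
    ∃ C M : ℝ, 0 ≤ C ∧ 0 ≤ M ∧ ∀ z : Euc n, ∫ x, |φ (x + z) - φ x| ≤ min (C * ‖z‖) M := by
  obtain ⟨Lc, hL⟩ := φ.contDiff.lipschitzWith_of_hasCompactSupport φ.hasCompactSupport (by simp)
  have hi := integrable_testFunction φ
  set M : ℝ := 2 * ∫ x, |φ x| with hM
  have hM0 : 0 ≤ M := by
    have : 0 ≤ ∫ x, |φ x| := integral_nonneg fun x => abs_nonneg _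
    positivity
  have hle : ∀ z : Euc n, ∫ x, |φ (x + z) - φ x| ≤ M := by
    intro z
    have hiz := hi.comp_add_right z
    calc ∫ x, |φ (x + z) - φ x| ≤ ∫ x, (|φ (x + z)| + |φ x|) :=
          integral_mono (hiz.sub hi).abs (hiz.abs.add hi.abs) fun x => abs_sub _ _
      _ = M := by
          rw [integral_add hiz.abs hi.abs, integral_add_right_eq_self (fun x => |φ x|) z, hM]
          ring
  set K : Set (Euc n) := Metric.cthickening 1 (tsupport φ) with hK
  have hKc : IsCompact K := φ.hasCompactSupport.isCompact.cthickening
  refine ⟨Lc * (volume K).toReal + M, M, by positivity, hM0, fun z => le_min ?_ (hle z)⟩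
  rcases le_or_gt ‖z‖ 1 with hz | hz
  · have hiz := hi.comp_add_right z
    have h1 : ∀ x, |φ (x + z) - φ x| ≤ K.indicator (fun _ => (Lc : ℝ) * ‖z‖) x := by
      intro x
      by_cases hx : x ∈ K
      · rw [Set.indicator_of_mem hx]
        have := hL.norm_sub_le (x + z) x
        simpa using this
      · rw [Set.indicator_of_notMem hx]
        have h2 : φ x = 0 := by
          by_contra h
          exact hx (Metric.self_subset_cthickening _ (subset_tsupport _ h))
        have h3 : φ (x + z) = 0 := by
          by_contra h
          refine hx (Metric.mem_cthickening_of_dist_le x (x + z) 1 _ (subset_tsupport _ h) ?_)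
          simpa [dist_eq_norm] using hz
        simp [h2, h3]
    have h2 : ∫ x, |φ (x + z) - φ x| ≤ ∫ x, K.indicator (fun _ => (Lc : ℝ) * ‖z‖) x :=
      integral_mono (hiz.sub hi).abs
        ((integrable_indicator_iff hKc.measurableSet).2
          (integrableOn_const (hs := hKc.measure_lt_top.ne))) h1
    rw [integral_indicator hKc.measurableSet, setIntegral_const, smul_eq_mul] at h2
    refine h2.trans ?_
    rw [Measure.real]
    nlinarith [norm_nonneg z]
  · refine (hle z).trans ?_
    have : 0 ≤ (Lc : ℝ) * (volume K).toReal := by positivity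
    nlinarith

lemma fracGrad_apply (φ : 𝓓(Ω, ℝ)) {s : ℝ} (h0 : 0 < s) (h1 : s < 1) (x : Euc n) (j : Fin n) :
    fracGrad s φ x j = fracConst n s *
      ∫ z : Euc n, (φ (x + z) - φ x) * (z j * ‖z‖ ^ (-((n : ℝ) + s + 1))) := by
  rw [fracGrad, if_pos h1]
  have h := ContinuousLinearMap.integral_comp_comm
    (EuclideanSpace.proj j : Euc n →L[ℝ] ℝ) (integrable_fracKernel φ h0 h1 x)
  rw [← integral_add_left_eq_self _ x] at h
  simp only [PiLp.smul_apply, smul_eq_mul]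
  change fracConst n s * (EuclideanSpace.proj j : Euc n →L[ℝ] ℝ) _ = _
  rw [← h]
  congr 2
  funext z
  change (φ (x + z) - φ x) / ‖x - (x + z)‖ ^ ((n : ℝ) + s + 1) * (x + z - x) j = _
  rw [show x - (x + z) = -z by abel, norm_neg, Real.rpow_neg (norm_nonneg z)]
  rw [add_sub_cancel_left]
  ring

lemma integrable_shift_sub_mul (φ : 𝓓(Ω, ℝ)) {s : ℝ} (h0 : 0 < s) (h1 : s < 1) (j : Fin n) :
    Integrable (fun p : Euc n × Euc n =>
      (φ (p.1 + p.2) - φ p.1) * (p.2 j * ‖p.2‖ ^ (-((n : ℝ) + s + 1))))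
      ((volume : Measure (Euc n)).prod volume) := by
  have hn : 0 < n := j.pos
  have hφ : Measurable (φ : Euc n → ℝ) := φ.contDiff.continuous.measurable
  have hi := integrable_testFunction φ
  have hm : Measurable (fun p : Euc n × Euc n =>
      (φ (p.1 + p.2) - φ p.1) * (p.2 j * ‖p.2‖ ^ (-((n : ℝ) + s + 1)))) := by fun_prop
  obtain ⟨C, M, hC, hM, hb⟩ := exists_integral_abs_shift_sub_le φ
  rw [integrable_prod_iff' hm.aestronglyMeasurable]
  refine ⟨Eventually.of_forall fun z => ?_, ?_⟩
  · exact Integrable.mul_const (f := fun x => φ (x + z) - φ x) ((hi.comp_add_right z).sub hi)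
      (z j * ‖z‖ ^ (-((n : ℝ) + s + 1)))
  refine (integrable_min_mul_norm_rpow hn h0 h1 hC hM).mono' ?_ ?_
  · exact (hm.norm.stronglyMeasurable.integral_prod_left').aestronglyMeasurable
  · refine Eventually.of_forall fun z => ?_
    rw [Real.norm_of_nonneg (integral_nonneg fun x => norm_nonneg _)]
    simp only [norm_mul, Real.norm_eq_abs]
    rw [integral_mul_const]
    rcases eq_or_ne z 0 with rfl | hz
    · simp [min_eq_left hM]
    have hz' := norm_pos_iff.2 hz
    have e2 : ‖z‖ ^ (-((n : ℝ) + s)) = ‖z‖ * ‖z‖ ^ (-((n : ℝ) + s + 1)) := by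
      rw [mul_comm, ← Real.rpow_add_one hz'.ne']; congr 1; ring
    have h3 : |z j| ≤ ‖z‖ := by simpa using PiLp.norm_apply_le z j
    have h5 : 0 ≤ min (C * ‖z‖) M := le_min (by positivity) hM
    rw [e2, abs_of_nonneg (Real.rpow_nonneg hz'.le _)]
    gcongr
    exact hb z

lemma fracGrad_one_apply (φ : 𝓓(Ω, ℝ)) (x : Euc n) (j : Fin n) :
    fracGrad 1 φ x j = fderiv ℝ φ x (EuclideanSpace.single j 1) := by
  rw [fracGrad, if_neg (lt_irrefl _)]
  have h : inner ℝ (gradient (φ : Euc n → ℝ) x) (EuclideanSpace.single j (1 : ℝ)) =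
      fderiv ℝ φ x (EuclideanSpace.single j 1) := by
    rw [gradient, InnerProductSpace.toDual_symm_apply]
  rw [← h, EuclideanSpace.inner_single_right]
  simp

lemma continuous_fderiv_testFunction (φ : 𝓓(Ω, ℝ)) : Continuous (fderiv ℝ (φ : Euc n → ℝ)) :=
  φ.contDiff.continuous_fderiv (by simp)

lemma integrable_fracGrad_apply (φ : 𝓓(Ω, ℝ)) {s : ℝ} (h0 : 0 < s) (h1 : s ≤ 1) (j : Fin n) :
    Integrable (fun x => fracGrad s φ x j) := by
  rcases h1.lt_or_eq with h1 | rfl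
  · simp only [fracGrad_apply φ h0 h1]
    exact (integrable_shift_sub_mul φ h0 h1 j).integral_prod_left.const_mul _
  · simp only [fracGrad_one_apply φ]
    have hc : Continuous fun x => fderiv ℝ φ x (EuclideanSpace.single j (1 : ℝ)) :=
      (continuous_fderiv_testFunction φ).clm_apply continuous_const
    refine hc.integrable_of_hasCompactSupport ?_
    exact (φ.hasCompactSupport.fderiv (𝕜 := ℝ)).comp_left
      (g := fun A : Euc n →L[ℝ] ℝ => A (EuclideanSpace.single j (1 : ℝ))) (by simp)

lemma integrable_fracGrad (φ : 𝓓(Ω, ℝ)) {s : ℝ} (h0 : 0 < s) (h1 : s ≤ 1) :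
    Integrable (fracGrad s φ) := by
  have hj := fun j => integrable_fracGrad_apply φ h0 h1 j
  refine (integrable_finsetSum Finset.univ fun j _ => (hj j).abs).mono' ?_
    (Eventually.of_forall fun x => norm_le_sum_abs _)
  have h2 : (fracGrad s φ) = fun x => ∑ j, fracGrad s φ x j • EuclideanSpace.single j (1 : ℝ) := by
    funext x
    ext i
    simp [Finset.sum_apply, Pi.single_apply]
  rw [h2]
  exact Finset.aestronglyMeasurable_fun_sum _ fun j _ => (hj j).1.smul_const _

/-- The fractional gradient of order `s` has the Fourier multiplier `i (2π)^s ξ |ξ|^{s-1}`. -/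
lemma fourier_fracGrad (φ : 𝓓(Ω, ℝ)) {s : ℝ} (h0 : 0 < s) (h1 : s ≤ 1) (j : Fin n)
    {ξ : Euc n} (hξ : ξ ≠ 0) :
    𝓕 (fun x => (fracGrad s φ x j : ℂ)) ξ =
      π * Complex.I * ξ j * ((2 ^ s * (π ^ 2 * ‖ξ‖ ^ 2) ^ ((s - 1) / 2) : ℝ) : ℂ) *
        𝓕 (fun x => (φ x : ℂ)) ξ := by
  have hφi : Integrable (fun x => (φ x : ℂ)) := (integrable_testFunction φ).ofReal
  rcases h1.lt_or_eq with h1 | rfl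
  · rw [← integral_multiplier j.pos h0 h1 j hξ, Real.fourier_eq]
    have hi : Integrable (fun p : Euc n × Euc n => 𝐞 (-inner ℝ p.1 ξ) •
        (((φ (p.1 + p.2) - φ p.1) * (p.2 j * ‖p.2‖ ^ (-((n : ℝ) + s + 1))) : ℝ) : ℂ))
        ((volume : Measure (Euc n)).prod volume) := by
      have h0 : Integrable (fun p : Euc n × Euc n =>
        (((φ (p.1 + p.2) - φ p.1) * (p.2 j * ‖p.2‖ ^ (-((n : ℝ) + s + 1))) : ℝ) : ℂ)) _ :=
          (integrable_shift_sub_mul φ h0 h1 j).ofReal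
      have hc : Continuous fun p : Euc n × Euc n => 𝐞 (-inner ℝ p.1 ξ) :=
        continuous_fourierChar.comp (by fun_prop)
      refine h0.mono (hc.aestronglyMeasurable.smul h0.1) ?_
      exact Eventually.of_forall fun p => by simp
    have e1 : ∀ x, 𝐞 (-inner ℝ x ξ) • (fracGrad s φ x j : ℂ) = (fracConst n s : ℂ) * ∫ z : Euc n,
        𝐞 (-inner ℝ x ξ) •
          (((φ (x + z) - φ x) * (z j * ‖z‖ ^ (-((n : ℝ) + s + 1))) : ℝ) : ℂ) := by
      intro x
      rw [fracGrad_apply φ h0 h1]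
      simp only [Circle.smul_def]
      rw [integral_smul, integral_complex_ofReal]
      push_cast
      simp only [smul_eq_mul]
      ring
    simp only [e1]
    rw [integral_const_mul, integral_integral_swap (f := fun x z => 𝐞 (-inner ℝ x ξ) •
          (((φ (x + z) - φ x) * (z j * ‖z‖ ^ (-((n : ℝ) + s + 1))) : ℝ) : ℂ)) hi, mul_assoc,
      ← integral_mul_const]
    congr 2
    funext z
    have hFi := (Real.fourierIntegral_convergent_iff ξ).2 hφi
    have hFz := (Real.fourierIntegral_convergent_iff ξ).2 (hφi.comp_add_right z)
    -- The Fourier transform of a translate.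
    have e2 : ∫ x, 𝐞 (-inner ℝ x ξ) • (φ (x + z) : ℂ) =
        ((𝐞 (inner ℝ z ξ) : Circle) : ℂ) * 𝓕 (fun x => (φ x : ℂ)) ξ := by
      rw [Real.fourier_eq, 
        ← integral_add_right_eq_self (fun x => 𝐞 (-inner ℝ x ξ) • (φ x : ℂ)) z,
        ← integral_const_mul]
      congr 1; funext x
      rw [Circle.smul_def, Circle.smul_def, smul_eq_mul, smul_eq_mul, ← mul_assoc,
        ← Circle.coe_mul, ← AddChar.map_add_eq_mul]
      congr 4
      rw [inner_add_left]; ring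
    have e3 : ∀ x, 𝐞 (-inner ℝ x ξ) •
          (((φ (x + z) - φ x) * (z j * ‖z‖ ^ (-((n : ℝ) + s + 1))) : ℝ) : ℂ) =
        (𝐞 (-inner ℝ x ξ) • (φ (x + z) : ℂ) - 𝐞 (-inner ℝ x ξ) • (φ x : ℂ)) *
          ((z j * ‖z‖ ^ (-((n : ℝ) + s + 1)) : ℝ) : ℂ) := by
      intro x
      simp only [Circle.smul_def, smul_eq_mul]
      push_cast; ring
    simp only [e3]
    rw [integral_mul_const, integral_sub hFz hFi, e2, ← Real.fourier_eq]
    ring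
  · have hd : Differentiable ℝ (fun x => (φ x : ℂ)) := fun x =>
      (Complex.ofRealCLM.differentiable _).comp x (φ.contDiff.differentiable (by simp) x)
    have hfd : fderiv ℝ (fun x => (φ x : ℂ)) = fun x => Complex.ofRealCLM ∘L fderiv ℝ φ x := by
      funext x
      exact (Complex.ofRealCLM.hasFDerivAt.comp x
        (φ.contDiff.differentiable (by simp) x).hasFDerivAt).fderiv
    have hi : Integrable (fderiv ℝ (fun x => (φ x : ℂ))) := by
      rw [hfd]
      refine Continuous.integrable_of_hasCompactSupport ?_ ?_
      · exact continuous_const.clm_comp (continuous_fderiv_testFunction φ)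
      · exact (φ.hasCompactSupport.fderiv (𝕜 := ℝ)).comp_left
          (g := fun A : Euc n →L[ℝ] ℝ => Complex.ofRealCLM ∘L A) (by simp)
    have h := fourier_partial hφi hd hi j ξ
    simp only [hfd] at h
    simp only [fracGrad_one_apply]
    refine Eq.trans h ?_
    have e : (π ^ 2 * ‖ξ‖ ^ 2) ^ (((1 : ℝ) - 1) / 2) = 1 := by simp
    rw [e]
    push_cast [Real.rpow_one]
    ring

end FracGradFourier

/-! ### Gaussian means and the fractional gradient -/

section Mollification

open FourierTransform Real Convolution

variable {n : ℕ} {Ω : TopologicalSpace.Opens (Euc n)}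

/-- The Gaussian mean `p_ε * u`. -/
def heatConv (ε : ℝ) (u : Euc n → ℝ) (x : Euc n) : ℝ := ∫ y, u y * heat n ε (x - y)

lemma integral_norm_convolution_le {f g : Euc n → ℂ} (hf : Integrable f) (hg : Integrable g) :
    ∫ x, ‖(f ⋆[ContinuousLinearMap.mul ℂ ℂ] g) x‖ ≤ (∫ x, ‖f x‖) * ∫ x, ‖g x‖ := by
  have hi := hf.integrable_convolution (ContinuousLinearMap.mul ℂ ℂ) hg
  have hi' := hf.norm.integrable_convolution (ContinuousLinearMap.mul ℝ ℝ) hg.norm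
  have h := integral_convolution (ContinuousLinearMap.mul ℝ ℝ) hf.norm hg.norm
    (μ := volume) (ν := volume)
  rw [ContinuousLinearMap.mul_apply'] at h
  rw [← h]
  refine integral_mono hi.norm hi' fun x => ?_
  refine (norm_integral_le_integral_norm _).trans (le_of_eq ?_)
  simp [convolution_def]

lemma integrable_heatConv {u : Euc n → ℝ} (hu : Integrable u) {ε : ℝ} (hε : 0 < ε) :
    Integrable (heatConv ε u) :=
  hu.integrable_convolution (ContinuousLinearMap.mul ℝ ℝ) (integrable_heat hε)

/-- A test function is recovered, up to a Gaussian mean, from its fractional gradient. -/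
lemma sub_heatConv_ae_eq (φ : 𝓓(Ω, ℝ)) {s ε : ℝ} (hn : 0 < n) (h0 : 0 < s) (h1 : s ≤ 1)
    (hε : 0 < ε) :
    (fun x => ((φ x - heatConv ε φ x : ℝ) : ℂ)) =ᵐ[volume] fun x =>
      ((2 ^ s * Real.Gamma ((1 + s) / 2) : ℝ) : ℂ)⁻¹ * ∑ j,
        ((fun x => (inverseKernel ((1 - s) / 2) ε j x : ℂ)) ⋆[ContinuousLinearMap.mul ℂ ℂ]
          (fun x => (fracGrad s φ x j : ℂ))) x := by
  have ha0 : 0 ≤ (1 - s) / 2 := by linarith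
  have ha1 : (1 - s) / 2 < 1 / 2 := by linarith
  have hG : 0 < Real.Gamma ((1 + s) / 2) := Real.Gamma_pos_of_pos (by linarith)
  set κ : ℝ := 2 ^ s * Real.Gamma ((1 + s) / 2) with hκ
  have hκ0 : (κ : ℂ) ≠ 0 := by
    have : 0 < κ := by positivity
    exact_mod_cast this.ne'
  set W : Fin n → Euc n → ℂ := fun j x => (inverseKernel ((1 - s) / 2) ε j x : ℂ) with hW
  set D : Fin n → Euc n → ℂ := fun j x => (fracGrad s φ x j : ℂ) with hD
  have hWi : ∀ j, Integrable (W j) := fun j => (integrable_inverseKernel ha0 ha1 hε j).ofReal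
  have hDi : ∀ j, Integrable (D j) := fun j => (integrable_fracGrad_apply φ h0 h1 j).ofReal
  have hφi : Integrable (fun x => (φ x : ℂ)) := (integrable_testFunction φ).ofReal
  have hpi : Integrable (fun x : Euc n => (heat n ε x : ℂ)) := (integrable_heat hε).ofReal
  have hCi : ∀ j, Integrable (W j ⋆[ContinuousLinearMap.mul ℂ ℂ] D j) := fun j =>
    (hWi j).integrable_convolution _ (hDi j)
  have hPi := hφi.integrable_convolution (ContinuousLinearMap.mul ℂ ℂ) hpi
  have hP : (fun x => ((heatConv ε φ x : ℝ) : ℂ)) =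
      (fun x => (φ x : ℂ)) ⋆[ContinuousLinearMap.mul ℂ ℂ] (fun x : Euc n => (heat n ε x : ℂ)) := by
    funext x
    rw [heatConv, convolution_def, ← integral_complex_ofReal]
    simp
  have hSi : Integrable (fun x => (κ : ℂ)⁻¹ *
      ∑ j, (W j ⋆[ContinuousLinearMap.mul ℂ ℂ] D j) x) :=
    (integrable_finsetSum Finset.univ fun j _ => hCi j).const_mul _
  have hLi : Integrable (fun x => ((φ x - heatConv ε φ x : ℝ) : ℂ)) :=
    ((integrable_testFunction φ).sub (integrable_heatConv (integrable_testFunction φ) hε)).ofReal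
  have hz := ae_eq_zero_of_fourier_ae_eq_zero (hLi.sub hSi) ?_
  · filter_upwards [hz] with x hx
    exact sub_eq_zero.1 hx
  have : Nonempty (Fin n) := ⟨⟨0, hn⟩⟩
  have hne : ∀ᵐ ξ : Euc n, ξ ≠ 0 := by simp [ae_iff]
  filter_upwards [hne] with ξ hξ
  have hPF : 𝓕 (fun x => ((heatConv ε φ x : ℝ) : ℂ)) ξ =
      𝓕 (fun x => (φ x : ℂ)) ξ * Real.exp (-π ^ 2 * ε * ‖ξ‖ ^ 2) := by
    rw [hP, Real.fourier_mul_convolution_eq hφi hpi, fourier_heat hε]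
  have hCF : ∀ j, 𝓕 (W j ⋆[ContinuousLinearMap.mul ℂ ℂ] D j) ξ = 𝓕 (W j) ξ * 𝓕 (D j) ξ :=
    fun j => Real.fourier_mul_convolution_eq (hWi j) (hDi j) ξ
  have hPi' : Integrable (fun x => ((heatConv ε φ x : ℝ) : ℂ)) := hP ▸ hPi
  have c1 := (Real.fourierIntegral_convergent_iff ξ).2 hφi
  have c2 := (Real.fourierIntegral_convergent_iff ξ).2 hPi'
  have c3 := fun j => (Real.fourierIntegral_convergent_iff ξ).2 (hCi j)
  have c12 : Integrable (fun v => 𝐞 (-inner ℝ v ξ) • (φ v : ℂ) -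
      𝐞 (-inner ℝ v ξ) • (heatConv ε φ v : ℂ)) := c1.sub c2
  have e1 : 𝓕 ((fun x => ((φ x - heatConv ε φ x : ℝ) : ℂ)) - fun x => (κ : ℂ)⁻¹ *
      ∑ j, (W j ⋆[ContinuousLinearMap.mul ℂ ℂ] D j) x) ξ =
      𝓕 (fun x => (φ x : ℂ)) ξ - 𝓕 (fun x => ((heatConv ε φ x : ℝ) : ℂ)) ξ - (κ : ℂ)⁻¹ *
        ∑ j, 𝓕 (W j ⋆[ContinuousLinearMap.mul ℂ ℂ] D j) ξ := by
    simp only [Real.fourier_eq]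
    rw [← integral_finsetSum _ fun j _ => c3 j, ← integral_const_mul, ← integral_sub c1 c2,
      ← integral_sub c12 ((integrable_finsetSum Finset.univ fun j _ => c3 j).const_mul _)]
    congr 1; funext x
    simp only [Pi.sub_apply, Circle.smul_def, smul_eq_mul]
    rw [← Finset.mul_sum]
    push_cast
    ring
  rw [e1, hPF]
  simp only [hCF]
  have hξn : 0 < ‖ξ‖ := norm_pos_iff.2 hξ
  set Q : ℝ := π ^ 2 * ‖ξ‖ ^ 2 with hQ
  have hQ0 : 0 < Q := by positivity
  have hpow : Q ^ ((1 - s) / 2 - 1) * Q ^ ((s - 1) / 2) * Q = 1 := by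
    rw [← Real.rpow_add hQ0, ← Real.rpow_add_one hQ0.ne']
    have : (1 - s) / 2 - 1 + (s - 1) / 2 + 1 = 0 := by ring
    rw [this, Real.rpow_zero]
  have hsum : ∑ j, ξ j * ξ j = ‖ξ‖ ^ 2 := by
    rw [EuclideanSpace.norm_sq_eq]
    refine Finset.sum_congr rfl fun j _ => ?_
    rw [Real.norm_eq_abs, sq_abs]; ring
  have e2 : ∀ j, 𝓕 (W j) ξ * 𝓕 (D j) ξ = ((π ^ 2 * (ξ j * ξ j) * κ *
      (Q ^ ((1 - s) / 2 - 1) * Q ^ ((s - 1) / 2)) *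
      (1 - Real.exp (-π ^ 2 * ε * ‖ξ‖ ^ 2)) : ℝ) : ℂ) * 𝓕 (fun x => (φ x : ℂ)) ξ := by
    intro j
    rw [fourier_inverseKernel ha0 ha1 hε j hξ, fourier_fracGrad φ h0 h1 j hξ, ← hQ, hκ]
    have e3 : (1 : ℝ) - (1 - s) / 2 = (1 + s) / 2 := by ring
    rw [e3]
    push_cast
    linear_combination (-(π : ℂ) ^ 2 * (ξ j : ℂ) ^ 2 * (2 ^ s : ℝ) *
      (Real.Gamma ((1 + s) / 2) : ℂ) * ((Q ^ ((1 - s) / 2 - 1) : ℝ) : ℂ) *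
      ((Q ^ ((s - 1) / 2) : ℝ) : ℂ) * (1 - Complex.exp (-π ^ 2 * ε * ‖ξ‖ ^ 2)) *
      𝓕 (fun x => (φ x : ℂ)) ξ) * Complex.I_sq
  simp only [e2]
  rw [← Finset.sum_mul, ← Complex.ofReal_sum, ← Finset.sum_mul, ← Finset.sum_mul,
    ← Finset.sum_mul, ← Finset.mul_sum, hsum, ← hQ]
  have e4 : Q * κ * (Q ^ ((1 - s) / 2 - 1) * Q ^ ((s - 1) / 2)) = κ := by
    linear_combination κ * hpow
  rw [e4]
  push_cast
  field_simp
  ring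

/-- A test function differs from its Gaussian mean at scale `ε` by at most a multiple of
`ε^{s/2} ‖D^s φ‖_{L¹}`, uniformly for orders `s` away from zero. -/
lemma exists_integral_abs_sub_heatConv_le (hn : 0 < n) {s₀ : ℝ} (hs₀ : 0 < s₀) :
    ∃ C : ℝ, 0 ≤ C ∧ ∀ s : ℝ, s₀ ≤ s → s ≤ 1 → ∀ (Ω : TopologicalSpace.Opens (Euc n))
      (φ : 𝓓(Ω, ℝ)) (ε : ℝ), 0 < ε →
      ∫ x, |φ x - heatConv ε φ x| ≤ C * ε ^ (s / 2) * ∫ x, ‖fracGrad s φ x‖ := by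
  have hcont : ContinuousOn (fun s : ℝ => Real.Gamma ((1 + s) / 2)) (Set.Icc 0 1) := by
    intro s hs
    refine ContinuousAt.continuousWithinAt (ContinuousAt.comp (g := Real.Gamma) ?_ (by fun_prop))
    refine (Real.differentiableAt_Gamma fun m => ?_).continuousAt
    have : 0 < (1 + s) / 2 := by linarith [hs.1]
    have hm : (0 : ℝ) ≤ m := Nat.cast_nonneg m
    linarith
  obtain ⟨s₁, hs₁, hmin⟩ := isCompact_Icc.exists_isMinOn
    (Set.nonempty_Icc.2 (zero_le_one' ℝ)) hcont
  set γ := Real.Gamma ((1 + s₁) / 2) with hγ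
  have hγ0 : 0 < γ := Real.Gamma_pos_of_pos (by linarith [hs₁.1])
  set m := ∫ x : Euc n, ‖x‖ * heat n 1 x with hm
  have hm0 : 0 ≤ m := integral_nonneg fun x => mul_nonneg (norm_nonneg _) (heat_nonneg one_pos x)
  refine ⟨γ⁻¹ * (n * (4 / s₀ * m)), by positivity, fun s hs h1 Ω φ ε hε => ?_⟩
  have h0 : 0 < s := hs₀.trans_le hs
  have ha0 : 0 ≤ (1 - s) / 2 := by linarith
  have ha1 : (1 - s) / 2 < 1 / 2 := by linarith
  have hDi := integrable_fracGrad φ h0 h1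
  have hDn : 0 ≤ ∫ x, ‖fracGrad s φ x‖ := integral_nonneg fun x => norm_nonneg _
  have hκ : (2 ^ s * Real.Gamma ((1 + s) / 2))⁻¹ ≤ γ⁻¹ := by
    have h2 : γ ≤ Real.Gamma ((1 + s) / 2) := hmin ⟨h0.le, h1⟩
    have h3 : (1 : ℝ) ≤ 2 ^ s := Real.one_le_rpow (by norm_num) h0.le
    gcongr
    nlinarith
  have hκ0 : 0 < 2 ^ s * Real.Gamma ((1 + s) / 2) :=
    mul_pos (by positivity) (Real.Gamma_pos_of_pos (by linarith))
  have hWi := fun j => integrable_inverseKernel (n := n) ha0 ha1 hε j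
  have hWi' : ∀ j : Fin n, Integrable (fun x => (inverseKernel ((1 - s) / 2) ε j x : ℂ)) :=
    fun j => (hWi j).ofReal
  have hDi' : ∀ j : Fin n, Integrable (fun x => (fracGrad s φ x j : ℂ)) :=
    fun j => (integrable_fracGrad_apply φ h0 h1 j).ofReal
  have hCi := fun j => (hWi' j).integrable_convolution (ContinuousLinearMap.mul ℂ ℂ) (hDi' j)
  have hj : ∀ j : Fin n, ∫ x, ‖((fun x => (inverseKernel ((1 - s) / 2) ε j x : ℂ))
      ⋆[ContinuousLinearMap.mul ℂ ℂ] (fun x => (fracGrad s φ x j : ℂ))) x‖ ≤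
      4 / s₀ * m * ε ^ (s / 2) * ∫ x, ‖fracGrad s φ x‖ := by
    intro j
    refine (integral_norm_convolution_le (hWi' j) (hDi' j)).trans ?_
    simp only [Complex.norm_real, Real.norm_eq_abs]
    have h4 := integral_abs_inverseKernel_le (n := n) ha0 ha1 hε j
    have e : (1 : ℝ) / 2 - (1 - s) / 2 = s / 2 := by ring
    rw [e] at h4
    have h5 : 2 * (ε ^ (s / 2) / (s / 2)) * m ≤ 4 / s₀ * m * ε ^ (s / 2) := by
      have : 2 * (ε ^ (s / 2) / (s / 2)) * m = 4 / s * m * ε ^ (s / 2) := by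
        field_simp; ring
      rw [this]
      gcongr
    have h6 : ∫ x, |fracGrad s φ x j| ≤ ∫ x, ‖fracGrad s φ x‖ :=
      integral_mono (integrable_fracGrad_apply φ h0 h1 j).abs hDi.norm
        fun x => by simpa using PiLp.norm_apply_le (fracGrad s φ x) j
    exact mul_le_mul (h4.trans h5) h6 (integral_nonneg fun x => abs_nonneg _) (by positivity)
  calc ∫ x, |φ x - heatConv ε φ x|
      = ∫ x, ‖((φ x - heatConv ε φ x : ℝ) : ℂ)‖ := by
        simp only [Complex.norm_real, Real.norm_eq_abs]
    _ = ∫ x, ‖((2 ^ s * Real.Gamma ((1 + s) / 2) : ℝ) : ℂ)⁻¹ * ∑ j,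
        ((fun x => (inverseKernel ((1 - s) / 2) ε j x : ℂ)) ⋆[ContinuousLinearMap.mul ℂ ℂ]
          (fun x => (fracGrad s φ x j : ℂ))) x‖ := by
        refine integral_congr_ae ?_
        filter_upwards [sub_heatConv_ae_eq φ hn h0 h1 hε] with x hx
        rw [hx]
    _ ≤ ∫ x, γ⁻¹ * ∑ j, ‖((fun x => (inverseKernel ((1 - s) / 2) ε j x : ℂ))
          ⋆[ContinuousLinearMap.mul ℂ ℂ] (fun x => (fracGrad s φ x j : ℂ))) x‖ := by
        refine integral_mono ((integrable_finsetSum Finset.univ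
          fun j _ => hCi j).const_mul _).norm
          ((integrable_finsetSum Finset.univ fun j _ => (hCi j).norm).const_mul _) fun x => ?_
        simp only [norm_mul]
        rw [norm_inv, Complex.norm_real, Real.norm_of_nonneg hκ0.le]
        gcongr
        exact norm_sum_le _ _
    _ = γ⁻¹ * ∑ j, ∫ x, ‖((fun x => (inverseKernel ((1 - s) / 2) ε j x : ℂ))
          ⋆[ContinuousLinearMap.mul ℂ ℂ] (fun x => (fracGrad s φ x j : ℂ))) x‖ := by
        rw [integral_const_mul, integral_finsetSum _ fun j _ => (hCi j).norm]
    _ ≤ γ⁻¹ * ∑ _j : Fin n, 4 / s₀ * m * ε ^ (s / 2) * ∫ x, ‖fracGrad s φ x‖ := by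
        gcongr with j
        exact hj j
    _ = _ := by
        rw [Finset.sum_const, Finset.card_univ, Fintype.card_fin, nsmul_eq_mul]
        ring

end Mollification

/-! ### Poincaré inequality and compactness for test functions -/

section TestFunctions

open Real

variable {n : ℕ}

/-- The normalizing constant stays bounded as `s → 1`, where `1 / Γ((1 - s) / 2)` tends to `0`. -/
lemma exists_fracConst_le (n : ℕ) : ∃ C : ℝ, 0 < C ∧ ∀ s : ℝ, 0 ≤ s → s < 1 →
    |fracConst n s| ≤ C := by
  set g : ℝ → ℝ := fun s => 2 ^ s * π ^ (-(n : ℝ) / 2) * Real.Gamma (((n : ℝ) + s + 1) / 2) *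
    ((1 - s) / 2) / Real.Gamma ((1 - s) / 2 + 1) with hg
  have hG : ∀ x : ℝ, 0 < x → ContinuousAt Real.Gamma x := fun x hx =>
    (Real.differentiableAt_Gamma fun m => by
      have hm : (0 : ℝ) ≤ m := Nat.cast_nonneg m
      linarith).continuousAt
  have hcont : ContinuousOn g (Set.Icc 0 1) := by
    intro s hs
    refine ContinuousAt.continuousWithinAt ?_
    have hn : (0 : ℝ) ≤ n := Nat.cast_nonneg n
    have h1 : ContinuousAt (fun s : ℝ => Real.Gamma (((n : ℝ) + s + 1) / 2)) s :=
      ContinuousAt.comp (g := Real.Gamma) (hG _ (by linarith [hs.1])) (by fun_prop)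
    have h2 : ContinuousAt (fun s : ℝ => Real.Gamma ((1 - s) / 2 + 1)) s :=
      ContinuousAt.comp (g := Real.Gamma) (hG _ (by linarith [hs.2])) (by fun_prop)
    have h3 : ContinuousAt (fun s : ℝ => (2 : ℝ) ^ s) s :=
      (Real.continuous_const_rpow (by norm_num)).continuousAt
    refine ContinuousAt.div ?_ h2 (Real.Gamma_pos_of_pos (by linarith [hs.2])).ne'
    exact ((h3.mul continuousAt_const).mul h1).mul (by fun_prop)
  obtain ⟨C, hC⟩ := isCompact_Icc.exists_bound_of_continuousOn hcont
  refine ⟨max C 1, by positivity, fun s h0 h1 => ?_⟩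
  have h2 : (1 - s) / 2 ≠ 0 := by linarith
  have e : fracConst n s = g s := by
    simp only [hg, fracConst]
    rw [Real.Gamma_add_one h2, mul_comm _ ((1 - s) / 2), mul_div_mul_left _ _ h2]
  rw [e]
  exact (hC s ⟨h0, h1.le⟩).trans (le_max_left _ _)

variable {Ω : TopologicalSpace.Opens (Euc n)}

lemma notMem_tsupport_of_le_norm {ρ : ℝ} (hΩ : (Ω : Set (Euc n)) ⊆ Metric.ball 0 ρ) (φ : 𝓓(Ω, ℝ))
    {x : Euc n} (hx : ρ ≤ ‖x‖) : x ∉ tsupport φ := fun h => by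
  have := hΩ (φ.tsupport_subset h)
  rw [mem_ball_zero_iff] at this
  linarith

/-- Away from the support, the fractional gradient decays at least like `|x|^{-n-s₀}`. -/
lemma exists_norm_fracGrad_le (n : ℕ) (s₀ : ℝ) (ρ : ℝ) (hs₀ : 0 < s₀) :
    ∃ C : ℝ, 0 ≤ C ∧ ∀ s : ℝ, s₀ ≤ s → s ≤ 1 → ∀ Ω : TopologicalSpace.Opens (Euc n),
      (Ω : Set (Euc n)) ⊆ Metric.ball 0 ρ → ∀ φ : 𝓓(Ω, ℝ), ∀ x : Euc n, 2 * ρ ≤ ‖x‖ → 2 ≤ ‖x‖ →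
      ‖fracGrad s φ x‖ ≤ C * (1 + ‖x‖) ^ (-((n : ℝ) + s₀)) * ∫ y, |φ y| := by
  obtain ⟨Cc, hCc, hc⟩ := exists_fracConst_le n
  refine ⟨Cc * 4 ^ ((n : ℝ) + s₀), by positivity, fun s hs h1 Ω hΩ φ x hx hx2 => ?_⟩
  have h0 : 0 < s := hs₀.trans_le hs
  have hxρ : ρ ≤ ‖x‖ := by
    rcases le_or_gt 0 ρ with h | h <;> linarith
  have hx0 : x ∉ tsupport φ := notMem_tsupport_of_le_norm hΩ φ hxρ
  have hI : 0 ≤ ∫ y, |φ y| := integral_nonneg fun y => abs_nonneg _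
  rcases h1.lt_or_eq with h1 | rfl
  · rw [fracGrad, if_pos h1, norm_smul, Real.norm_eq_abs]
    have hk : ∀ y, ‖fracKernel s φ x y‖ ≤
        (4 ^ ((n : ℝ) + s₀) * (1 + ‖x‖) ^ (-((n : ℝ) + s₀))) * |φ y| := by
      intro y
      by_cases hy : y ∈ tsupport φ
      · have hyρ : ‖y‖ < ρ := by
          have := hΩ (φ.tsupport_subset hy)
          rwa [mem_ball_zero_iff] at this
        have hd : ‖x‖ / 2 ≤ ‖x - y‖ := by linarith [norm_sub_norm_le x y]
        have hp : 0 < ‖x - y‖ := by linarith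
        have e1 : ‖x - y‖ ^ ((n : ℝ) + s + 1) = ‖x - y‖ ^ ((n : ℝ) + s) * ‖x - y‖ :=
          Real.rpow_add_one hp.ne' _
        have e2 : ‖fracKernel s φ x y‖ = |φ y| * ‖x - y‖ ^ (-((n : ℝ) + s)) := by
          rw [fracKernel, norm_smul, norm_div, Real.norm_of_nonneg (Real.rpow_nonneg hp.le _), e1,
            norm_sub_rev y x, Real.rpow_neg hp.le, image_eq_zero_of_notMem_tsupport hx0, sub_zero,
            Real.norm_eq_abs]
          field_simp
        have hn0 : (0 : ℝ) ≤ n := Nat.cast_nonneg n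
        have h3 : ‖x - y‖ ^ (-((n : ℝ) + s)) ≤
            4 ^ ((n : ℝ) + s₀) * (1 + ‖x‖) ^ (-((n : ℝ) + s₀)) := by
          calc ‖x - y‖ ^ (-((n : ℝ) + s)) ≤ (‖x‖ / 2) ^ (-((n : ℝ) + s)) :=
                Real.rpow_le_rpow_of_nonpos (by linarith) hd (by linarith)
            _ ≤ (‖x‖ / 2) ^ (-((n : ℝ) + s₀)) :=
                Real.rpow_le_rpow_of_exponent_le (by linarith) (by linarith)
            _ ≤ ((1 + ‖x‖) / 4) ^ (-((n : ℝ) + s₀)) :=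
                Real.rpow_le_rpow_of_nonpos (by linarith) (by linarith) (by linarith)
            _ = _ := by
                rw [Real.div_rpow (by linarith) (by norm_num), Real.rpow_neg (by norm_num : (0:ℝ) ≤ 4)]
                field_simp
        rw [e2, mul_comm]
        gcongr
      · rw [fracKernel, image_eq_zero_of_notMem_tsupport hx0, image_eq_zero_of_notMem_tsupport hy]
        simp
    have h4 : ‖∫ y, fracKernel s φ x y‖ ≤
        (4 ^ ((n : ℝ) + s₀) * (1 + ‖x‖) ^ (-((n : ℝ) + s₀))) * ∫ y, |φ y| := by
      rw [← integral_const_mul]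
      exact (norm_integral_le_integral_norm _).trans
        (integral_mono (integrable_fracKernel φ h0 h1 x).norm
          ((integrable_testFunction φ).abs.const_mul _) hk)
    calc |fracConst n s| * ‖∫ y, fracKernel s φ x y‖
        ≤ Cc * ((4 ^ ((n : ℝ) + s₀) * (1 + ‖x‖) ^ (-((n : ℝ) + s₀))) * ∫ y, |φ y|) := by
          gcongr
          exact hc s h0.le h1
      _ = _ := by ring
  · have : fracGrad 1 φ x = 0 := by
      rw [fracGrad, if_neg (lt_irrefl _), gradient, fderiv_of_notMem_tsupport ℝ hx0, map_zero]
    rw [this, norm_zero]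
    positivity

/-- Only a small part of the `L¹` norm of the fractional gradient is carried by the complement of
a large ball. -/
lemma exists_setIntegral_compl_ball_le {s₀ : ℝ} (hs₀ : 0 < s₀) (ρ : ℝ) {θ : ℝ} (hθ : 0 < θ) :
    ∃ R₀ : ℝ, 0 < R₀ ∧ ∀ R : ℝ, R₀ ≤ R → ∀ s : ℝ, s₀ ≤ s → s ≤ 1 →
      ∀ Ω : TopologicalSpace.Opens (Euc n), (Ω : Set (Euc n)) ⊆ Metric.ball 0 ρ → ∀ φ : 𝓓(Ω, ℝ),
      ∫ x in (Metric.ball 0 R)ᶜ, ‖fracGrad s φ x‖ ≤ θ * ∫ x, |φ x| := by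
  obtain ⟨C, hC, hb⟩ := exists_norm_fracGrad_le n s₀ ρ hs₀
  set h : Euc n → ℝ := fun x => (1 + ‖x‖) ^ (-((n : ℝ) + s₀)) with hh
  have hi : Integrable h := integrable_one_add_norm (by simpa using hs₀)
  have hlim : Tendsto (fun k : ℕ => ∫ x in (Metric.ball (0 : Euc n) k)ᶜ, h x) atTop (𝓝 0) := by
    have := tendsto_setIntegral_of_antitone (μ := volume) (f := h)
      (s := fun k : ℕ => (Metric.ball (0 : Euc n) k)ᶜ)
      (fun k => Metric.isOpen_ball.measurableSet.compl)
      (fun k l hkl => Set.compl_subset_compl.2 (Metric.ball_subset_ball (by exact_mod_cast hkl)))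
      ⟨0, hi.integrableOn⟩
    have he : (⋂ k : ℕ, (Metric.ball (0 : Euc n) k)ᶜ) = ∅ := by
      rw [← Set.compl_iUnion, Metric.iUnion_ball_nat, Set.compl_univ]
    rwa [he, Measure.restrict_empty, integral_zero_measure] at this
  obtain ⟨k, hk, hkR⟩ := ((hlim.eventually_lt_const (show 0 < θ / (C + 1) by positivity)).and
    (eventually_ge_atTop (⌈max (2 * ρ) 2⌉₊))).exists
  have hk2 : max (2 * ρ) 2 ≤ k := (Nat.le_ceil _).trans (by exact_mod_cast hkR)
  have hk0 : (0 : ℝ) < k := lt_of_lt_of_le (by norm_num) ((le_max_right _ _).trans hk2)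
  refine ⟨k, hk0, fun R hR s hs h1 Ω hΩ φ => ?_⟩
  have hI : 0 ≤ ∫ y, |φ y| := integral_nonneg fun y => abs_nonneg _
  have hsub : (Metric.ball (0 : Euc n) R)ᶜ ⊆ (Metric.ball (0 : Euc n) k)ᶜ :=
    Set.compl_subset_compl.2 (Metric.ball_subset_ball hR)
  have hDi := (integrable_fracGrad φ (hs₀.trans_le hs) h1).norm
  calc ∫ x in (Metric.ball 0 R)ᶜ, ‖fracGrad s φ x‖
      ≤ ∫ x in (Metric.ball 0 R)ᶜ, C * h x * ∫ y, |φ y| := by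
        refine setIntegral_mono_on hDi.integrableOn
          ((hi.const_mul C).mul_const _).integrableOn Metric.isOpen_ball.measurableSet.compl
          fun x hx => ?_
        have hx' : (k : ℝ) ≤ ‖x‖ := by simpa using hsub hx
        exact hb s hs h1 Ω hΩ φ x ((le_max_left _ _).trans (hk2.trans hx'))
          ((le_max_right _ _).trans (hk2.trans hx'))
    _ = C * (∫ x in (Metric.ball 0 R)ᶜ, h x) * ∫ y, |φ y| := by
        rw [integral_mul_const, integral_const_mul]
    _ ≤ C * (θ / (C + 1)) * ∫ y, |φ y| := by
        have h2 : ∫ x in (Metric.ball 0 R)ᶜ, h x ≤ ∫ x in (Metric.ball (0 : Euc n) k)ᶜ, h x :=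
          setIntegral_mono_set hi.integrableOn
            (Eventually.of_forall fun x => by simp only [hh]; positivity)
            (LE.le.eventuallyLE hsub)
        gcongr
        exact h2.trans hk.le
    _ ≤ θ * ∫ y, |φ y| := by
        gcongr
        rw [mul_div_assoc', div_le_iff₀ (by positivity)]
        nlinarith

lemma abs_heatConv_le {u : Euc n → ℝ} (hu : Integrable u) {ε : ℝ} (hε : 0 < ε) (x : Euc n) :
    |heatConv ε u x| ≤ (π * ε) ^ (-(n : ℝ) / 2) * ∫ y, |u y| := by
  rw [heatConv, ← integral_const_mul]
  rw [← Real.norm_eq_abs]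
  refine norm_integral_le_of_norm_le (hu.abs.const_mul _) (Eventually.of_forall fun y => ?_)
  simp only [norm_mul, Real.norm_eq_abs]
  rw [abs_of_nonneg (heat_nonneg hε _), mul_comm]
  gcongr
  exact heat_le hε _

/-- On a ball, Gaussian means are controlled, up to a small multiple of the `L¹` norm, by finitely
many local averages: the Gaussian is nearly constant on small pieces of the ball. -/
lemma exists_abs_heatConv_le_sum {ε : ℝ} (hε : 0 < ε) (ρ : ℝ) {η : ℝ} (hη : 0 < η) :
    ∃ (m : ℕ) (Q : Fin m → Set (Euc n)), (∀ i, MeasurableSet (Q i)) ∧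
      ∀ u : Euc n → ℝ, Integrable u → (∀ y, y ∉ Metric.closedBall (0 : Euc n) ρ → u y = 0) →
        ∀ x ∈ Metric.closedBall (0 : Euc n) ρ, |heatConv ε u x| ≤
          η * (∫ y, |u y|) + (π * ε) ^ (-(n : ℝ) / 2) * ∑ i, |∫ y in Q i, u y| := by
  set K := Metric.closedBall (0 : Euc n) (2 * ρ) with hK
  have huc := (isCompact_closedBall (0 : Euc n) (2 * ρ)).uniformContinuousOn_of_continuous
    (continuous_heat (n := n) ε).continuousOn
  rw [Metric.uniformContinuousOn_iff] at huc
  obtain ⟨δ, hδ, hδ'⟩ := huc η hη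
  obtain ⟨t, htK, htf, htc⟩ := finite_cover_balls_of_compact
    (isCompact_closedBall (0 : Euc n) ρ) hδ
  obtain ⟨m, c, hcr⟩ : ∃ (m : ℕ) (c : Fin m → Euc n), Set.range c = t := by
    have := htf.fintype
    refine ⟨Fintype.card t, fun i => ((Fintype.equivFin t).symm i : Euc n), ?_⟩
    ext y
    constructor
    · rintro ⟨i, rfl⟩; exact Subtype.coe_prop _
    · intro hy; exact ⟨Fintype.equivFin t ⟨y, hy⟩, by simp⟩
  set B : Fin m → Set (Euc n) := fun i => Metric.ball (c i) δ ∩ Metric.closedBall 0 ρ with hB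
  have hBm : ∀ i, MeasurableSet (B i) := fun i =>
    Metric.isOpen_ball.measurableSet.inter Metric.isClosed_closedBall.measurableSet
  set Q : Fin m → Set (Euc n) := fun i => B i \ ⋃ k < i, B k with hQ
  have hQm : ∀ i, MeasurableSet (Q i) := fun i =>
    (hBm i).diff (MeasurableSet.biUnion (Set.to_countable _) fun k _ => hBm k)
  have hQd : Pairwise (Function.onFun Disjoint Q) := by
    have key : ∀ i k, i < k → Disjoint (Q i) (Q k) := by
      intro i k hik
      refine Set.disjoint_left.2 fun y hy hy' => hy'.2 ?_
      exact Set.mem_iUnion₂.2 ⟨i, hik, hy.1⟩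
    intro i k hik
    rcases lt_or_gt_of_ne hik with h | h
    · exact key i k h
    · exact (key k i h).symm
  have hQU : (⋃ i, Q i) = Metric.closedBall (0 : Euc n) ρ := by
    ext y
    constructor
    · intro hy
      obtain ⟨i, hi⟩ := Set.mem_iUnion.1 hy
      exact hi.1.2
    · intro hy
      have hex : ∃ i, y ∈ B i := by
        obtain ⟨z, hz, hyz⟩ := Set.mem_iUnion₂.1 (htc hy)
        rw [← hcr] at hz
        obtain ⟨i, rfl⟩ := hz
        exact ⟨i, hyz, hy⟩
      classical
      obtain ⟨i, hi, hmin⟩ := (Finset.univ.filter fun i => y ∈ B i).exists_minimal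
        (by obtain ⟨i, hi⟩ := hex; exact ⟨i, by simpa using hi⟩)
      refine Set.mem_iUnion.2 ⟨i, (Finset.mem_filter.1 hi).2, fun hk => ?_⟩
      obtain ⟨k, hki, hk⟩ := Set.mem_iUnion₂.1 hk
      exact hki.not_ge (hmin (Finset.mem_filter.2 ⟨Finset.mem_univ _, hk⟩) hki.le)
  refine ⟨m, Q, hQm, fun u hu hu0 x hx => ?_⟩
  have hprod : Integrable fun y => u y * heat n ε (x - y) := by
    refine hu.mul_bdd (c := (π * ε) ^ (-(n : ℝ) / 2)) ?_ (Eventually.of_forall fun y => ?_)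
    · exact Continuous.aestronglyMeasurable (by fun_prop)
    · rw [Real.norm_of_nonneg (heat_nonneg hε _)]; exact heat_le hε _
  have hsplit : ∀ g : Euc n → ℝ, Integrable g → (∀ y, y ∉ Metric.closedBall (0 : Euc n) ρ →
      g y = 0) → ∫ y, g y = ∑ i, ∫ y in Q i, g y := by
    intro g hg hg0
    rw [← setIntegral_eq_integral_of_forall_compl_eq_zero (s := Metric.closedBall (0 : Euc n) ρ)
      (fun y hy => hg0 y hy), ← hQU, integral_iUnion_fintype hQm hQd fun i => hg.integrableOn]
  have h1 : heatConv ε u x = ∑ i, ∫ y in Q i, u y * heat n ε (x - y) :=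
    hsplit _ hprod fun y hy => by rw [hu0 y hy, zero_mul]
  have h2 : ∫ y, |u y| = ∑ i, ∫ y in Q i, |u y| :=
    hsplit _ hu.abs fun y hy => by rw [hu0 y hy, abs_zero]
  rw [h1, h2, Finset.mul_sum, Finset.mul_sum, ← Finset.sum_add_distrib]
  refine (Finset.abs_sum_le_sum_abs _ _).trans (Finset.sum_le_sum fun i _ => ?_)
  have hcK : c i ∈ Metric.closedBall (0 : Euc n) ρ := htK (hcr ▸ Set.mem_range_self i)
  have hsubK : ∀ y ∈ Metric.closedBall (0 : Euc n) ρ, x - y ∈ Metric.closedBall (0 : Euc n) (2 * ρ) := by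
    intro y hy
    rw [mem_closedBall_zero_iff] at hx hy ⊢
    linarith [norm_sub_le x y]
  have e : ∫ y in Q i, u y * heat n ε (x - y) =
      (∫ y in Q i, u y * (heat n ε (x - y) - heat n ε (x - c i))) +
        (∫ y in Q i, u y) * heat n ε (x - c i) := by
    rw [← integral_mul_const, ← integral_add]
    · congr 1; funext y; ring
    · have := (hprod.sub (hu.mul_const (heat n ε (x - c i)))).integrableOn (s := Q i)
      refine this.congr_fun (fun y _ => ?_) (hQm i)
      simp only [Pi.sub_apply]; ring
    · exact (hu.mul_const _).integrableOn
  rw [e]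
  refine (abs_add_le _ _).trans (add_le_add ?_ ?_)
  · rw [← integral_const_mul, ← Real.norm_eq_abs]
    refine norm_integral_le_of_norm_le (hu.abs.const_mul _).integrableOn ?_
    filter_upwards [ae_restrict_mem (hQm i)] with y hy
    simp only [norm_mul, Real.norm_eq_abs]
    rw [mul_comm]
    gcongr
    have := hδ' (x - y) (hsubK y hy.1.2) (x - c i) (hsubK _ hcK) (by
      rw [dist_sub_left, ← Metric.mem_ball]; exact hy.1.1)
    exact this.le
  · rw [abs_mul, abs_of_nonneg (heat_nonneg hε _), mul_comm]
    gcongr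
    exact heat_le hε _

/-- The `L¹` norm of a test function is that of its deviation from the Gaussian mean, plus a bound
for the Gaussian mean on a ball containing the support. -/
lemma integral_abs_le_add {ρ : ℝ} {Ω : TopologicalSpace.Opens (Euc n)}
    (hΩ : (Ω : Set (Euc n)) ⊆ Metric.ball 0 ρ) (φ : 𝓓(Ω, ℝ)) {ε : ℝ} (hε : 0 < ε) {b : ℝ}
    (hb : ∀ x ∈ Metric.closedBall (0 : Euc n) ρ, |heatConv ε φ x| ≤ b) :
    ∫ x, |φ x| ≤ (∫ x, |φ x - heatConv ε φ x|) +
      (volume (Metric.closedBall (0 : Euc n) ρ)).toReal * b := by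
  have hi := integrable_testFunction φ
  have hd : Integrable (fun x => φ x - heatConv ε φ x) := hi.sub (integrable_heatConv hi hε)
  have h0 : ∀ y, y ∉ Metric.closedBall (0 : Euc n) ρ → |φ y| = 0 := fun y hy => by
    rw [image_eq_zero_of_notMem_tsupport (notMem_tsupport_of_le_norm hΩ φ
      (by simpa using (lt_of_not_ge (by simpa using hy)).le)), abs_zero]
  rw [← setIntegral_eq_integral_of_forall_compl_eq_zero h0]
  have hfin : volume (Metric.closedBall (0 : Euc n) ρ) ≠ ∞ := measure_closedBall_lt_top.ne
  calc ∫ x in Metric.closedBall 0 ρ, |φ x|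
      ≤ ∫ x in Metric.closedBall 0 ρ, (|φ x - heatConv ε φ x| + b) := by
        refine setIntegral_mono_on hi.abs.integrableOn
          (hd.abs.integrableOn.add (integrableOn_const (hs := hfin)))
          Metric.isClosed_closedBall.measurableSet fun x hx => ?_
        have h1 := hb x hx
        have h2 := abs_sub_abs_le_abs_sub (φ x) (heatConv ε φ x)
        linarith
    _ = (∫ x in Metric.closedBall 0 ρ, |φ x - heatConv ε φ x|) +
          (volume (Metric.closedBall (0 : Euc n) ρ)).toReal * b := by
        rw [integral_add hd.abs.integrableOn (integrableOn_const (hs := hfin)),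
          setIntegral_const, smul_eq_mul]
        rfl
    _ ≤ _ := by
        gcongr ?_ + _
        exact setIntegral_le_integral hd.abs (Eventually.of_forall fun x => abs_nonneg _)

/-- The Poincaré inequality and the compactness of the `L¹` norm with respect to the fractional
gradient on a large ball, for test functions supported in a fixed ball and uniformly for orders
`s` away from zero. Compactness is expressed by finitely many averages `∫_{Q_i} φ`. -/
theorem exists_poincare_and_compactness (hn : 0 < n) {s₀ : ℝ} (hs₀ : 0 < s₀) (ρ : ℝ) :
    ∃ R : ℝ, (∃ C : ℝ, 0 ≤ C ∧ ∀ s : ℝ, s₀ ≤ s → s ≤ 1 →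
        ∀ Ω : TopologicalSpace.Opens (Euc n), (Ω : Set (Euc n)) ⊆ Metric.ball 0 ρ →
        ∀ φ : 𝓓(Ω, ℝ), ∫ x, |φ x| ≤ C * ∫ x in Metric.ball 0 R, ‖fracGrad s φ x‖) ∧
      ∀ θ : ℝ, 0 < θ → ∃ (m : ℕ) (Q : Fin m → Set (Euc n)) (C : ℝ), (∀ i, MeasurableSet (Q i)) ∧
        0 ≤ C ∧ ∀ s : ℝ, s₀ ≤ s → s ≤ 1 →
        ∀ Ω : TopologicalSpace.Opens (Euc n), (Ω : Set (Euc n)) ⊆ Metric.ball 0 ρ →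
        ∀ φ : 𝓓(Ω, ℝ), ∫ x, |φ x| ≤ θ * (∫ x in Metric.ball 0 R, ‖fracGrad s φ x‖) +
          C * ∑ i, |∫ x in Q i, φ x| := by
  obtain ⟨C₁, hC₁, hM⟩ := exists_integral_abs_sub_heatConv_le hn hs₀
  set V := (volume (Metric.closedBall (0 : Euc n) ρ)).toReal with hV
  have hV0 : 0 ≤ V := ENNReal.toReal_nonneg
  -- A time at which Gaussian means are small on the ball.
  obtain ⟨ε, hε1, hεV⟩ : ∃ ε : ℝ, 1 ≤ ε ∧ V * (π * ε) ^ (-(n : ℝ) / 2) ≤ 1 / 4 := by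
    have h1 : Tendsto (fun ε : ℝ => V * (π * ε) ^ (-((n : ℝ) / 2))) atTop (𝓝 (V * 0)) := by
      refine Tendsto.const_mul _ ((tendsto_rpow_neg_atTop (by positivity)).comp ?_)
      exact tendsto_id.const_mul_atTop Real.pi_pos
    rw [mul_zero] at h1
    obtain ⟨ε, h2, h3⟩ := ((h1.eventually_lt_const (show (0 : ℝ) < 1 / 4 by norm_num)).and
      (eventually_ge_atTop 1)).exists
    exact ⟨ε, h3, by rw [neg_div]; exact h2.le⟩
  have hε0 : 0 < ε := by linarith
  set C₂ := C₁ * ε ^ (1 / 2 : ℝ) with hC₂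
  have hC₂0 : 0 ≤ C₂ := by positivity
  obtain ⟨R₁, hR₁, hT₁⟩ := exists_setIntegral_compl_ball_le (n := n) hs₀ ρ
    (θ := 1 / (4 * (C₂ + 1))) (by positivity)
  obtain ⟨R₂, hR₂, hT₂⟩ := exists_setIntegral_compl_ball_le (n := n) hs₀ ρ
    (θ := 1) one_pos
  set R := max R₁ R₂ with hR
  have hsplit : ∀ s : ℝ, s₀ ≤ s → s ≤ 1 → ∀ (Ω : TopologicalSpace.Opens (Euc n)) (φ : 𝓓(Ω, ℝ)),
      ∫ x, ‖fracGrad s φ x‖ = (∫ x in Metric.ball 0 R, ‖fracGrad s φ x‖) +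
        ∫ x in (Metric.ball 0 R)ᶜ, ‖fracGrad s φ x‖ := fun s hs h1 Ω φ =>
    (integral_add_compl Metric.isOpen_ball.measurableSet
      (integrable_fracGrad φ (hs₀.trans_le hs) h1).norm).symm
  have hP : ∀ s : ℝ, s₀ ≤ s → s ≤ 1 →
      ∀ Ω : TopologicalSpace.Opens (Euc n), (Ω : Set (Euc n)) ⊆ Metric.ball 0 ρ →
      ∀ φ : 𝓓(Ω, ℝ), ∫ x, |φ x| ≤ (2 * C₂) * ∫ x in Metric.ball 0 R, ‖fracGrad s φ x‖ := by
    intro s hs h1 Ω hΩ φ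
    have h2 := integral_abs_le_add hΩ φ hε0
      fun x _ => abs_heatConv_le (integrable_testFunction φ) hε0 x
    have h3 := hM s hs h1 Ω φ ε hε0
    have h4 := hT₁ R (le_max_left _ _) s hs h1 Ω hΩ φ
    have hI : 0 ≤ ∫ y, |φ y| := integral_nonneg fun y => abs_nonneg _
    have hD : 0 ≤ ∫ x, ‖fracGrad s φ x‖ := integral_nonneg fun y => norm_nonneg _
    have h5 : C₁ * ε ^ (s / 2) * ∫ x, ‖fracGrad s φ x‖ ≤ C₂ * ∫ x, ‖fracGrad s φ x‖ := by
      rw [hC₂]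
      gcongr
    rw [hsplit s hs h1 Ω φ, mul_add] at h5
    have h6 : C₂ * ∫ x in (Metric.ball 0 R)ᶜ, ‖fracGrad s φ x‖ ≤ 1 / 4 * ∫ y, |φ y| := by
      calc C₂ * ∫ x in (Metric.ball 0 R)ᶜ, ‖fracGrad s φ x‖
          ≤ C₂ * (1 / (4 * (C₂ + 1)) * ∫ y, |φ y|) := by gcongr
        _ = C₂ / (C₂ + 1) * (1 / 4 * ∫ y, |φ y|) := by field_simp
        _ ≤ 1 * (1 / 4 * ∫ y, |φ y|) := by
            gcongr
            rw [div_le_one (by positivity)]; linarith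
        _ = _ := one_mul _
    have h7 : V * ((π * ε) ^ (-(n : ℝ) / 2) * ∫ y, |φ y|) ≤ 1 / 4 * ∫ y, |φ y| := by
      rw [← mul_assoc]; gcongr
    rw [hsplit s hs h1 Ω φ] at h3
    linarith
  refine ⟨R, ⟨2 * C₂, by positivity, hP⟩, fun θ hθ => ?_⟩
  -- A time at which test functions are close to their Gaussian means.
  set κ := C₁ * (1 + 2 * C₂) with hκ
  have hκ0 : 0 ≤ κ := by positivity
  obtain ⟨τ, hτ0, hτ1, hτ⟩ : ∃ τ : ℝ, 0 < τ ∧ τ ≤ 1 ∧ κ * τ ^ (s₀ / 2) ≤ θ / 2 := by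
    have h1 : Tendsto (fun τ : ℝ => κ * τ ^ (s₀ / 2)) (𝓝[>] 0) (𝓝 (κ * 0 ^ (s₀ / 2))) :=
      ((Real.continuousAt_rpow_const 0 (s₀ / 2) (Or.inr (by positivity))).const_mul
        κ).continuousWithinAt
    rw [Real.zero_rpow (by positivity), mul_zero] at h1
    obtain ⟨τ, h2, h3, h4⟩ := ((h1.eventually_lt_const (show 0 < θ / 2 by positivity)).and
      ((eventually_mem_nhdsWithin).and (nhdsWithin_le_nhds (Iic_mem_nhds one_pos)))).exists
    exact ⟨τ, h3, h4, h2.le⟩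
  obtain ⟨m, Q, hQm, hQ⟩ := exists_abs_heatConv_le_sum (n := n) hτ0 ρ
    (η := θ / (2 * (V + 1) * (2 * C₂ + 1))) (by positivity)
  refine ⟨m, Q, V * (π * τ) ^ (-(n : ℝ) / 2), hQm, by positivity, fun s hs h1 Ω hΩ φ => ?_⟩
  have hI : 0 ≤ ∫ y, |φ y| := integral_nonneg fun y => abs_nonneg _
  have hi := integrable_testFunction φ
  have hD : 0 ≤ ∫ x in Metric.ball 0 R, ‖fracGrad s φ x‖ := integral_nonneg fun y => norm_nonneg _
  have h2 := integral_abs_le_add hΩ φ hτ0 (hQ φ hi fun y hy =>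
    image_eq_zero_of_notMem_tsupport (notMem_tsupport_of_le_norm hΩ φ
      (by simpa using (lt_of_not_ge (by simpa using hy)).le)))
  have h3 := hM s hs h1 Ω φ τ hτ0
  have h4 := hT₂ R (le_max_right _ _) s hs h1 Ω hΩ φ
  have h5 := hP s hs h1 Ω hΩ φ
  rw [hsplit s hs h1 Ω φ] at h3
  have h6 : C₁ * τ ^ (s / 2) * ((∫ x in Metric.ball 0 R, ‖fracGrad s φ x‖) +
      ∫ x in (Metric.ball 0 R)ᶜ, ‖fracGrad s φ x‖) ≤
      θ / 2 * ∫ x in Metric.ball 0 R, ‖fracGrad s φ x‖ := by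
    have h7 : τ ^ (s / 2) ≤ τ ^ (s₀ / 2) :=
      Real.rpow_le_rpow_of_exponent_ge hτ0 hτ1 (by linarith)
    calc _ ≤ C₁ * τ ^ (s₀ / 2) * ((∫ x in Metric.ball 0 R, ‖fracGrad s φ x‖) +
          2 * C₂ * ∫ x in Metric.ball 0 R, ‖fracGrad s φ x‖) := by
          gcongr
          linarith
      _ = κ * τ ^ (s₀ / 2) * ∫ x in Metric.ball 0 R, ‖fracGrad s φ x‖ := by rw [hκ]; ring
      _ ≤ _ := by gcongr
  have h8 : V * (θ / (2 * (V + 1) * (2 * C₂ + 1)) * ∫ y, |φ y|) ≤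
      θ / 2 * ∫ x in Metric.ball 0 R, ‖fracGrad s φ x‖ := by
    calc V * (θ / (2 * (V + 1) * (2 * C₂ + 1)) * ∫ y, |φ y|)
        ≤ V * (θ / (2 * (V + 1) * (2 * C₂ + 1)) *
            (2 * C₂ * ∫ x in Metric.ball 0 R, ‖fracGrad s φ x‖)) := by gcongr
      _ = (V / (V + 1)) * ((2 * C₂) / (2 * C₂ + 1)) *
            (θ / 2 * ∫ x in Metric.ball 0 R, ‖fracGrad s φ x‖) := by field_simp
      _ ≤ 1 * 1 * (θ / 2 * ∫ x in Metric.ball 0 R, ‖fracGrad s φ x‖) := by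
          gcongr
          · rw [div_le_one (by positivity)]; linarith
          · rw [div_le_one (by positivity)]; linarith
      _ = _ := by ring
  rw [mul_add, ← mul_assoc V ((π * τ) ^ (-(n : ℝ) / 2))] at h2
  linarith

end TestFunctions

/-! ### Energy estimates on test pairs -/

/-- The Cauchy–Schwarz inequality `(∫ g)² ≤ (∫ l⁻¹) (∫ l g²)` for a weight `l`. -/
lemma sq_lintegral_le_lintegral_inv_mul {α : Type*} [MeasurableSpace α] {m : Measure α}
    {l g : α → ℝ≥0∞} (hl : AEMeasurable l m) (hg : AEMeasurable g m)
    (hfin : ∫⁻ x, (l x)⁻¹ ∂m ≠ ∞) (htop : ∀ x, l x ≠ ∞) :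
    (∫⁻ x, g x ∂m) ^ 2 ≤ (∫⁻ x, (l x)⁻¹ ∂m) * ∫⁻ x, l x * g x ^ 2 ∂m := by
  have hne : ∀ᵐ x ∂m, l x ≠ 0 := by
    filter_upwards [ae_lt_top' hl.inv hfin] with x hx h0
    simp [h0] at hx
  have e : ∀ a : ℝ≥0∞, (a ^ (1 / 2 : ℝ)) ^ (2 : ℝ) = a := fun a => by
    rw [← ENNReal.rpow_mul]; norm_num
  have e' : ∀ a : ℝ≥0∞, (a ^ (1 / 2 : ℝ)) ^ 2 = a := fun a => by
    rw [← ENNReal.rpow_natCast, ← ENNReal.rpow_mul]; norm_num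
  have h := ENNReal.lintegral_mul_le_Lp_mul_Lq m Real.HolderConjugate.two_two
    (hl.inv.pow_const (1 / 2 : ℝ)) ((hl.pow_const (1 / 2 : ℝ)).mul hg)
  have h1 : ∫⁻ x, g x ∂m = ∫⁻ x, ((fun x => (l x)⁻¹ ^ (1 / 2 : ℝ)) *
      ((fun x => l x ^ (1 / 2 : ℝ)) * g)) x ∂m := by
    refine lintegral_congr_ae ?_
    filter_upwards [hne] with x hx
    simp only [Pi.mul_apply]
    rw [← mul_assoc, ← ENNReal.mul_rpow_of_nonneg _ _ (by norm_num),
      ENNReal.inv_mul_cancel hx (htop x), ENNReal.one_rpow, one_mul]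
  have h2 : ∀ x, ((fun x => (l x)⁻¹ ^ (1 / 2 : ℝ)) x) ^ (2 : ℝ) = (l x)⁻¹ := fun x => e _
  have h3 : ∀ x, (((fun x => l x ^ (1 / 2 : ℝ)) * g) x) ^ (2 : ℝ) = l x * g x ^ 2 := fun x => by
    rw [Pi.mul_apply, ENNReal.mul_rpow_of_nonneg _ _ (by norm_num), e]
    norm_cast
  have h' : ∫⁻ x, g x ∂m ≤ (∫⁻ x, (l x)⁻¹ ∂m) ^ (1 / 2 : ℝ) *
      (∫⁻ x, l x * g x ^ 2 ∂m) ^ (1 / 2 : ℝ) := by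
    rw [h1]
    refine h.trans (le_of_eq ?_)
    congr 2
    · exact lintegral_congr h2
    · exact lintegral_congr h3
  calc (∫⁻ x, g x ∂m) ^ 2 ≤ ((∫⁻ x, (l x)⁻¹ ∂m) ^ (1 / 2 : ℝ) *
      (∫⁻ x, l x * g x ^ 2 ∂m) ^ (1 / 2 : ℝ)) ^ 2 := by gcongr
    _ = _ := by rw [mul_pow, e', e']

namespace MixedOperator

variable {n : ℕ} (L : MixedOperator n)

lemma norm_sq_eq (w : L.EnergySpace) :
    ‖w‖ ^ 2 = ∫ q, matForm (symPart (L.A q.1 q.2)) (w.fld q) (w.fld q) ∂L.ν := by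
  rw [← real_inner_self_eq_norm_sq]; rfl

lemma ofReal_norm_sq (w : L.EnergySpace) : ENNReal.ofReal (‖w‖ ^ 2) = L.energy w.fld := by
  rw [norm_sq_eq, ofReal_integral_eq_lintegral_ofReal (EnergySpace.integrable w w)]
  · rfl
  · filter_upwards [L.ae_nonneg] with q hq using hq _

/-- The lower ellipticity bound, with the local integrability of its inverse. -/
lemma exists_lower_bound : ∃ lam : Euc n → ℝ, AEMeasurable lam ∧ (∀ x, 0 ≤ lam x) ∧
    (∀ s : unitInterval, 0 < s → ∀ x ξ, lam x * ‖ξ‖ ^ 2 ≤ matForm (symPart (L.A s x)) ξ ξ) ∧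
    ∀ R : ℝ, ∫⁻ x in Metric.ball 0 R, (ENNReal.ofReal (lam x))⁻¹ ≠ ∞ := by
  obtain ⟨lam, Lam, h0, -, h, R, C, δ, p, -, -, hδ, -, -, -, hm, hK⟩ := L.elliptic
  refine ⟨lam, hm, h0, fun s hs x ξ => ?_, fun R => ?_⟩
  · rw [matForm_symPart_self]; exact (h s hs x ξ).1
  · refine ne_top_of_le_ne_top ?_ (lintegral_mono_set Metric.ball_subset_closedBall)
    have hle : ∀ t : ℝ≥0∞, t ≤ 1 + t ^ (1 + δ) := fun t => by
      rcases le_total t 1 with ht | ht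
      · exact ht.trans le_self_add
      · calc t = t ^ (1 : ℝ) := (ENNReal.rpow_one t).symm
          _ ≤ t ^ (1 + δ) := ENNReal.rpow_le_rpow_of_exponent_le ht (by linarith)
          _ ≤ _ := le_add_self
    refine ne_top_of_le_ne_top ?_ (lintegral_mono fun x => hle _)
    rw [lintegral_add_left measurable_const]
    refine ENNReal.add_ne_top.2 ⟨?_, (hK _ (isCompact_closedBall 0 R)).ne⟩
    simp [measure_closedBall_lt_top.ne]

/-- A quantity bounded by the `L¹` norm of `D^s φ` on a ball, for all orders `s` at which `μ` lives,
is controlled by the energy of `φ`. If `μ` has infinite mass it even vanishes. -/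
lemma exists_le_norm_of_le_setIntegral {s₀ : ℝ} (hs₀ : 0 < s₀)
    (hμ : L.μ {s | (s : ℝ) < s₀} = 0) (R : ℝ) :
    ∃ κ : ℝ, 0 ≤ κ ∧ (L.μ Set.univ = ∞ → κ = 0) ∧
      ∀ (Ω : TopologicalSpace.Opens (Euc n)) (φ : 𝓓(Ω, ℝ)) (v : L.EnergySpace),
        L.IsTestPair φ v → ∀ X : ℝ, 0 ≤ X →
        (∀ s : ℝ, s₀ ≤ s → s ≤ 1 → X ≤ ∫ x in Metric.ball 0 R, ‖fracGrad s φ x‖) →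
        X ≤ κ * ‖v‖ := by
  obtain ⟨lam, hlm, hl0, hl, hfin⟩ := L.exists_lower_bound
  set Λ := ∫⁻ x in Metric.ball 0 R, (ENNReal.ofReal (lam x))⁻¹ with hΛ
  have hΛt : Λ ≠ ∞ := hfin R
  have hμ0 : L.μ Set.univ ≠ 0 := by simpa using L.μ_ne_zero
  have hκt : Λ / L.μ Set.univ ≠ ∞ := ENNReal.div_ne_top hΛt hμ0
  refine ⟨√(Λ / L.μ Set.univ).toReal, Real.sqrt_nonneg _, fun h => by simp [h],
    fun Ω φ v hv X hX0 hX => ?_⟩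
  have hae : ∀ᵐ s ∂L.μ, ∀ᵐ x, v.fld (s, x) = fracGrad (s : ℝ) φ x :=
    Measure.ae_ae_of_ae_prod hv.2
  have hs : ∀ᵐ s : unitInterval ∂L.μ, s₀ ≤ s := by
    rw [ae_iff]; simpa using hμ
  have key : ∀ᵐ s ∂L.μ, ENNReal.ofReal X ^ 2 ≤
      Λ * ∫⁻ x, ENNReal.ofReal (matForm (symPart (L.A s x)) (v.fld (s, x)) (v.fld (s, x))) := by
    filter_upwards [hae, hs] with s h1 h2
    have hpos : 0 < s := by
      have : (0 : ℝ) < s := hs₀.trans_le h2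
      exact_mod_cast this
    have hi := integrable_fracGrad φ (hs₀.trans_le h2) s.2.2
    have h3 : ENNReal.ofReal X ≤ ∫⁻ x in Metric.ball 0 R, ‖fracGrad (s : ℝ) φ x‖ₑ := by
      refine (ENNReal.ofReal_le_ofReal (hX s h2 s.2.2)).trans_eq ?_
      rw [ofReal_integral_norm_eq_lintegral_enorm hi.integrableOn]
    calc ENNReal.ofReal X ^ 2 ≤ (∫⁻ x in Metric.ball 0 R, ‖fracGrad (s : ℝ) φ x‖ₑ) ^ 2 := by
          gcongr
      _ ≤ Λ * ∫⁻ x in Metric.ball 0 R, ENNReal.ofReal (lam x) * ‖fracGrad (s : ℝ) φ x‖ₑ ^ 2 :=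
          sq_lintegral_le_lintegral_inv_mul hlm.ennreal_ofReal.restrict
            hi.aestronglyMeasurable.enorm.restrict (hfin R) fun x => ENNReal.ofReal_ne_top
      _ ≤ Λ * ∫⁻ x, ENNReal.ofReal (lam x) * ‖fracGrad (s : ℝ) φ x‖ₑ ^ 2 := by
          gcongr
          exact Measure.restrict_le_self
      _ ≤ _ := by
          refine mul_le_mul_right (lintegral_mono_ae ?_) Λ
          filter_upwards [h1] with x hx
          rw [hx, ← ofReal_norm, ← ENNReal.ofReal_pow (norm_nonneg _),
            ← ENNReal.ofReal_mul (hl0 x)]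
          exact ENNReal.ofReal_le_ofReal (hl s hpos x _)
  have h4 : ENNReal.ofReal X ^ 2 * L.μ Set.univ ≤ Λ * ENNReal.ofReal (‖v‖ ^ 2) := by
    have e : L.energy v.fld = ∫⁻ q, ENNReal.ofReal (matForm (symPart (L.A q.1 q.2)) (v.fld q)
        (v.fld q)) ∂(L.μ.prod volume) := rfl
    rw [L.ofReal_norm_sq, e, lintegral_prod _
      (L.aemeasurable_matForm v.fld v.fld).aemeasurable.ennreal_ofReal, ← lintegral_const_mul' _ _ hΛt,
      ← lintegral_const]
    exact lintegral_mono_ae key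
  have h5 : ENNReal.ofReal X ^ 2 ≤ Λ / L.μ Set.univ * ENNReal.ofReal (‖v‖ ^ 2) := by
    rw [div_eq_mul_inv, mul_right_comm, ← div_eq_mul_inv]
    exact (ENNReal.le_div_iff_mul_le (Or.inl hμ0)
      (Or.inr (ENNReal.mul_ne_top hΛt ENNReal.ofReal_ne_top))).2 h4
  have h6 : X ^ 2 ≤ (Λ / L.μ Set.univ).toReal * ‖v‖ ^ 2 := by
    rw [← ENNReal.ofReal_toReal hκt, ← ENNReal.ofReal_mul ENNReal.toReal_nonneg,
      ← ENNReal.ofReal_pow hX0] at h5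
    exact (ENNReal.ofReal_le_ofReal_iff (by positivity)).1 h5
  refine le_of_sq_le_sq ?_ (by positivity)
  rwa [mul_pow, Real.sq_sqrt ENNReal.toReal_nonneg]

lemma norm_fn_eq {Ω : TopologicalSpace.Opens (Euc n)} {φ : 𝓓(Ω, ℝ)} {v : L.EnergySpace}
    (hv : L.IsTestPair φ v) : ‖v.fn‖ = ∫ x, |φ x| := by
  rw [L1.norm_eq_integral_norm]
  exact integral_congr_ae (hv.1.mono fun x hx => by simp only [hx, Real.norm_eq_abs])

variable {Ω : TopologicalSpace.Opens (Euc n)}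

/-- The Poincaré inequality on `H⁰(𝓐, Ω)`. -/
lemma exists_norm_fn_le (hn : 0 < n) (hbdd : Bornology.IsBounded (Ω : Set (Euc n))) :
    ∃ C : ℝ, 0 ≤ C ∧ (L.μ Set.univ = ∞ → C = 0) ∧ ∀ w : L.H0 Ω, ‖w.1.fn‖ ≤ C * ‖w.1‖ := by
  obtain ⟨s₀, hs₀, hμ⟩ := L.support_away
  obtain ⟨ρ, hρ⟩ := hbdd.subset_ball 0
  obtain ⟨R, ⟨C, hC, hP⟩, -⟩ := exists_poincare_and_compactness hn hs₀ ρ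
  obtain ⟨κ, hκ, hκ0, hX⟩ := L.exists_le_norm_of_le_setIntegral hs₀ hμ R
  refine ⟨(C + 1) * κ, by positivity, fun h => by rw [hκ0 h, mul_zero], ?_⟩
  rintro ⟨w, φ, v, hv, h1, h2⟩
  have h3 : ∀ k, ‖(v k).fn‖ ≤ (C + 1) * κ * ‖v k‖ := fun k => by
    have hI : 0 ≤ ∫ x, |φ k x| := integral_nonneg fun x => abs_nonneg _
    have := hX Ω (φ k) (v k) (hv k) ((∫ x, |φ k x|) / (C + 1)) (by positivity)
      fun s hs hs1 => by
        rw [div_le_iff₀ (by positivity)]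
        have hD : 0 ≤ ∫ x in Metric.ball 0 R, ‖fracGrad s (φ k) x‖ :=
          integral_nonneg fun x => norm_nonneg _
        linarith [hP s hs hs1 Ω hρ (φ k)]
    rw [div_le_iff₀ (by positivity)] at this
    rw [L.norm_fn_eq (hv k)]
    linarith
  exact le_of_tendsto_of_tendsto' (tendsto_iff_norm_sub_tendsto_zero.2 h1).norm
    ((tendsto_iff_norm_sub_tendsto_zero.2 h2).norm.const_mul _) h3

/-- The embedding of `H⁰(𝓐, Ω)` in `L¹` is compact: the `L¹` norm is controlled by an arbitrarily
small multiple of the energy norm on the common kernel of finitely many averages. -/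
lemma exists_norm_fn_le_add_sum (hn : 0 < n) (hbdd : Bornology.IsBounded (Ω : Set (Euc n)))
    {θ : ℝ} (hθ : 0 < θ) :
    ∃ (m : ℕ) (Q : Fin m → Set (Euc n)) (C : ℝ), (∀ i, MeasurableSet (Q i)) ∧
      ∀ w : L.H0 Ω, ‖w.1.fn‖ ≤ θ * ‖w.1‖ + C * ∑ i, |∫ x in Q i, w.1.fn x| := by
  obtain ⟨s₀, hs₀, hμ⟩ := L.support_away
  obtain ⟨ρ, hρ⟩ := hbdd.subset_ball 0
  obtain ⟨R, -, hc⟩ := exists_poincare_and_compactness hn hs₀ ρ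
  obtain ⟨κ, hκ, hκ0, hX⟩ := L.exists_le_norm_of_le_setIntegral hs₀ hμ R
  obtain ⟨m, Q, C, hQ, hC, h⟩ := hc (θ / (κ + 1)) (by positivity)
  refine ⟨m, Q, C, hQ, ?_⟩
  rintro ⟨w, φ, v, hv, h1, h2⟩
  have h3 : ∀ k, ‖(v k).fn‖ ≤ θ * ‖v k‖ + C * ∑ i, |∫ x in Q i, (v k).fn x| := fun k => by
    have e : ∀ i, ∫ x in Q i, (v k).fn x = ∫ x in Q i, φ k x := fun i =>
      integral_congr_ae (ae_restrict_of_ae (hv k).1)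
    simp only [e, L.norm_fn_eq (hv k)]
    set A := C * ∑ i, |∫ x in Q i, φ k x| with hA
    rcases le_total (∫ x, |φ k x|) A with hle | hle
    · have : 0 ≤ θ * ‖v k‖ := by positivity
      linarith
    have := hX Ω (φ k) (v k) (hv k) (((∫ x, |φ k x|) - A) / (θ / (κ + 1)))
      (div_nonneg (sub_nonneg.2 hle) (by positivity)) fun s hs hs1 => by
        rw [div_le_iff₀ (by positivity), mul_comm]
        linarith [h s hs hs1 Ω hρ (φ k)]
    rw [div_le_iff₀ (by positivity)] at this
    have h4 : κ * ‖v k‖ * (θ / (κ + 1)) ≤ θ * ‖v k‖ := by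
      rw [mul_div_assoc', div_le_iff₀ (by positivity)]
      nlinarith [mul_nonneg hθ.le (norm_nonneg (v k))]
    linarith
  have hfn : Tendsto (fun k => (v k).fn) atTop (𝓝 w.fn) := tendsto_iff_norm_sub_tendsto_zero.2 h1
  refine le_of_tendsto_of_tendsto' hfn.norm
    (((tendsto_iff_norm_sub_tendsto_zero.2 h2).norm.const_mul _).add
      (Tendsto.const_mul C (tendsto_finsetSum _ fun i _ => Tendsto.abs ?_))) h3
  exact ((continuous_setIntegral (Q i)).tendsto _).comp hfn

end MixedOperator

/-! ### `H⁰(𝓐, Ω)` is a Hilbert space -/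

lemma tendsto_matForm_self {n : ℕ} (M : Matrix (Fin n) (Fin n) ℝ) {ξ : ℕ → Euc n} {η : Euc n}
    (h : Tendsto ξ atTop (𝓝 η)) :
    Tendsto (fun l => matForm M (ξ l) (ξ l)) atTop (𝓝 (matForm M η η)) := by
  have hc : Continuous fun η : Euc n => matForm M η η := by
    unfold matForm
    fun_prop
  exact (hc.tendsto η).comp h

namespace MixedOperator

variable {n : ℕ} (L : MixedOperator n) {Ω : TopologicalSpace.Opens (Euc n)}

lemma EnergySpace.ext {w w' : L.EnergySpace} (h1 : w.fn = w'.fn) (h2 : w.fld = w'.fld) : w = w' :=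
  Subtype.ext (Prod.ext h1 h2)

/-- The matrices `𝓐(s,x)` are definite, so a field of zero energy vanishes. -/
lemma fld_eq_zero_of_norm_eq_zero {w : L.EnergySpace} (hw : ‖w‖ = 0) : w.fld = 0 := by
  have h := L.norm_sq_eq w
  rw [hw, zero_pow two_ne_zero, eq_comm, integral_eq_zero_iff_of_nonneg_ae (by
    filter_upwards [L.ae_nonneg] with q hq using hq _) (EnergySpace.integrable w w)] at h
  refine AEEqFun.ext ?_
  filter_upwards [h, L.ae_pos, AEEqFun.coeFn_zero (μ := L.ν) (β := Euc n)] with q h1 h2 h3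
  rw [h3]
  by_contra hne
  rw [matForm_symPart_self] at h1
  exact (L.posDef q.1 h2 q.2 _ hne).ne' h1

lemma eq_zero_of_norm_eq_zero (hn : 0 < n) (hbdd : Bornology.IsBounded (Ω : Set (Euc n)))
    (w : L.H0 Ω) (hw : ‖w‖ = 0) : w = 0 := by
  obtain ⟨C, -, -, h⟩ := L.exists_norm_fn_le hn hbdd
  have hw' : ‖w.1‖ = 0 := hw
  have h1 := h w
  rw [hw', mul_zero] at h1
  exact Subtype.ext (EnergySpace.ext L (norm_le_zero_iff.1 h1)
    (L.fld_eq_zero_of_norm_eq_zero hw'))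

/-- If `μ` has infinite mass, no nonzero test function has finite energy. -/
lemma subsingleton_H0 (hn : 0 < n) (hbdd : Bornology.IsBounded (Ω : Set (Euc n)))
    (hμ : L.μ Set.univ = ∞) : Subsingleton (L.H0 Ω) := by
  refine subsingleton_of_forall_eq 0 fun w => L.eq_zero_of_norm_eq_zero hn hbdd w ?_
  obtain ⟨C, -, hC, h⟩ := L.exists_norm_fn_le hn hbdd
  obtain ⟨φ, v, hv, h1, h2⟩ := w.2
  have hv0 : ∀ k, ‖v k‖ = 0 := fun k => by
    have hmem : v k ∈ L.H0 Ω := ⟨fun _ => φ k, fun _ => v k, fun _ => hv k, by simp, by simp⟩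
    have h3 := h ⟨v k, hmem⟩
    rw [hC hμ, zero_mul] at h3
    have h4 : (v k).fn = 0 := norm_le_zero_iff.1 h3
    have h5 : (φ k : Euc n → ℝ) = fun _ => 0 := by
      rw [← Continuous.ae_eq_iff_eq volume (φ k).contDiff.continuous continuous_const]
      refine (hv k).1.symm.trans ?_
      rw [h4]
      exact Lp.coeFn_zero _ _ _
    have h6 : φ k = 0 := DFunLike.coe_injective h5
    have h7 : (v k).fld =ᵐ[L.ν] fun _ => 0 := by
      refine (hv k).2.trans (Eventually.of_forall fun q => ?_)
      have := fracGrad_smul (0 : ℝ) (φ k) q.1 q.2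
      rw [zero_smul, zero_smul, ← h6] at this
      exact this
    have h8 : ‖v k‖ ^ 2 = 0 := by
      rw [norm_sq_eq]
      refine integral_eq_zero_of_ae ?_
      filter_upwards [h7] with q hq
      rw [hq]
      simp [matForm]
    exact pow_eq_zero_iff two_ne_zero |>.1 h8
  have h9 := (tendsto_iff_norm_sub_tendsto_zero.2 h2).norm
  simp only [hv0] at h9
  exact (tendsto_nhds_unique h9 tendsto_const_nhds)

/-- `H⁰(𝓐, Ω)` is closed under simultaneous `L¹` and energy limits. -/
lemma mem_H0_of_tendsto {w : ℕ → L.H0 Ω} {w' : L.EnergySpace}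
    (h1 : Tendsto (fun k => ‖(w k).1.fn - w'.fn‖) atTop (𝓝 0))
    (h2 : Tendsto (fun k => ‖(w k).1 - w'‖) atTop (𝓝 0)) : w' ∈ L.H0 Ω := by
  have h : ∀ k : ℕ, ∃ (φ : 𝓓(Ω, ℝ)) (v : L.EnergySpace), L.IsTestPair φ v ∧
      ‖v.fn - (w k).1.fn‖ < 1 / ((k : ℝ) + 1) ∧ ‖v - (w k).1‖ < 1 / ((k : ℝ) + 1) := fun k => by
    obtain ⟨φ, v, hv, h3, h4⟩ := (w k).2
    have hk : (0 : ℝ) < 1 / ((k : ℝ) + 1) := by positivity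
    obtain ⟨j, h5, h6⟩ := ((h3.eventually_lt_const hk).and (h4.eventually_lt_const hk)).exists
    exact ⟨φ j, v j, hv j, h5, h6⟩
  choose φ v hv h3 h4 using h
  refine ⟨φ, v, hv, ?_, ?_⟩
  · refine squeeze_zero (fun k => norm_nonneg _) (fun k => ?_)
      (by simpa only [add_zero] using tendsto_one_div_add_atTop_nhds_zero_nat.add h1)
    rw [← sub_add_sub_cancel _ (w k).1.fn]
    exact (norm_add_le _ _).trans (by gcongr; exact (h3 k).le)
  · refine squeeze_zero (fun k => norm_nonneg _) (fun k => ?_)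
      (by simpa only [add_zero] using tendsto_one_div_add_atTop_nhds_zero_nat.add h2)
    rw [← sub_add_sub_cancel _ (w k).1]
    exact (norm_add_le _ _).trans (by gcongr; exact (h4 k).le)

/-- Fields that form a rapidly Cauchy sequence for the energy converge almost everywhere, since
the lower ellipticity bound is positive almost everywhere. -/
lemma exists_ae_tendsto_fld {u : ℕ → L.EnergySpace}
    (hu : ∀ N k l, N ≤ k → N ≤ l → ‖u k - u l‖ < (1 / 2) ^ N) :
    ∃ U : unitInterval × Euc n → Euc n, StronglyMeasurable U ∧
      ∀ᵐ q ∂L.ν, Tendsto (fun k => (u k).fld q) atTop (𝓝 (U q)) := by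
  obtain ⟨lam, hlm, hl0, hl, hfin⟩ := L.exists_lower_bound
  refine exists_stronglyMeasurable_limit_of_tendsto_ae
    (fun k => (u k).fld.aestronglyMeasurable) ?_
  have hpos : ∀ᵐ x : Euc n, 0 < lam x := by
    rw [← Measure.restrict_univ (μ := volume), ← Metric.iUnion_ball_nat (0 : Euc n),
      ae_restrict_iUnion_iff]
    intro k
    filter_upwards [ae_lt_top' hlm.ennreal_ofReal.restrict.inv (hfin k)] with x hx
    by_contra h
    simp [ENNReal.ofReal_of_nonpos (not_lt.1 h)] at hx
  have hposν : ∀ᵐ q ∂L.ν, 0 < lam q.2 := Measure.quasiMeasurePreserving_snd.ae hpos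
  have hlν : AEMeasurable (fun q : unitInterval × Euc n => lam q.2) L.ν :=
    hlm.comp_quasiMeasurePreserving Measure.quasiMeasurePreserving_snd
  have key := Lp.ae_tendsto_of_cauchy_eLpNorm (μ := L.ν) (p := 2)
    (f := fun k q => √(lam q.2) • (u k).fld q) (B := fun N => ENNReal.ofReal ((1 / 2) ^ N))
    (fun k => hlν.sqrt.aestronglyMeasurable.smul (u k).fld.aestronglyMeasurable)
    one_le_two ?_ ?_
  · filter_upwards [key, hposν] with q ⟨l, hq⟩ h0
    refine ⟨(√(lam q.2))⁻¹ • l, ?_⟩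
    have := hq.const_smul (√(lam q.2))⁻¹
    have hne : √(lam q.2) ≠ 0 := (Real.sqrt_pos.2 h0).ne'
    simpa [smul_smul, hne] using this
  · rw [← ENNReal.ofReal_tsum_of_nonneg (fun k => by positivity) summable_geometric_two]
    exact ENNReal.ofReal_ne_top
  · intro N k l hk hl'
    refine lt_of_le_of_lt ?_ ((ENNReal.ofReal_lt_ofReal_iff (by positivity)).2 (hu N k l hk hl'))
    rw [eLpNorm_eq_lintegral_rpow_enorm_toReal (by norm_num) (by norm_num)]
    simp only [ENNReal.toReal_ofNat]
    have h2 : ENNReal.ofReal ‖u k - u l‖ = (L.energy (u k - u l).fld) ^ (1 / 2 : ℝ) := by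
      rw [← L.ofReal_norm_sq, ENNReal.ofReal_rpow_of_nonneg (by positivity) (by norm_num),
        ← Real.sqrt_eq_rpow, Real.sqrt_sq (norm_nonneg _)]
    rw [h2]
    refine ENNReal.rpow_le_rpow (lintegral_mono_ae ?_) (by norm_num)
    filter_upwards [L.ae_pos, AEEqFun.coeFn_sub (u k).fld (u l).fld] with q h3 h4
    have h5 : (u k - u l).fld = (u k).fld - (u l).fld := rfl
    rw [h5, h4, Pi.sub_apply, Pi.sub_apply, ← smul_sub, enorm_smul, ← ofReal_norm, ← ofReal_norm,
      ← ENNReal.ofReal_mul (norm_nonneg _), ENNReal.ofReal_rpow_of_nonneg (by positivity)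
      (by norm_num)]
    refine ENNReal.ofReal_le_ofReal ?_
    rw [Real.rpow_two, mul_pow, Real.norm_eq_abs, sq_abs, Real.sq_sqrt (hl0 _)]
    exact hl q.1 h3 q.2 _

lemma fld_sub_coeFn (w w' : L.EnergySpace) :
    ∀ᵐ q ∂L.ν, (w - w').fld q = w.fld q - w'.fld q :=
  AEEqFun.coeFn_sub w.fld w'.fld

/-- Lower semicontinuity of the energy under almost everywhere convergence of the fields. -/
lemma energy_sub_le_of_ae_tendsto (w : L.EnergySpace) {u : ℕ → L.EnergySpace}
    {V : unitInterval × Euc n →ₘ[L.ν] Euc n}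
    (hV : ∀ᵐ q ∂L.ν, Tendsto (fun l => (u l).fld q) atTop (𝓝 (V q))) {r : ℝ}
    (hr : ∀ᶠ l in atTop, ‖w - u l‖ ≤ r) :
    L.energy (w.fld - V : unitInterval × Euc n →ₘ[L.ν] Euc n) ≤ ENNReal.ofReal (r ^ 2) := by
  calc L.energy (w.fld - V : unitInterval × Euc n →ₘ[L.ν] Euc n)
      = ∫⁻ q, liminf (fun l => ENNReal.ofReal (matForm (symPart (L.A q.1 q.2))
          ((w - u l).fld q) ((w - u l).fld q))) atTop ∂L.ν := by
        refine lintegral_congr_ae ?_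
        have h1 : ∀ᵐ q ∂L.ν, ∀ l, (w - u l).fld q = w.fld q - (u l).fld q :=
          ae_all_iff.2 fun l => L.fld_sub_coeFn w (u l)
        have h0 : ∀ᵐ q ∂L.ν, (w.fld - V) q = w.fld q - V q := AEEqFun.coeFn_sub w.fld V
        filter_upwards [h0, h1, hV] with q h2 h3 h5
        rw [h2]
        simp only [h3]
        have h6 : Tendsto (fun l => w.fld q - (u l).fld q) atTop (𝓝 (w.fld q - V q)) :=
          tendsto_const_nhds.sub h5
        exact (ENNReal.tendsto_ofReal
          (tendsto_matForm_self (symPart (L.A q.1 q.2)) h6)).liminf_eq.symm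
    _ ≤ liminf (fun l => L.energy (w - u l).fld) atTop :=
        lintegral_liminf_le' fun l =>
          (L.aemeasurable_matForm _ _).aemeasurable.ennreal_ofReal
    _ ≤ ENNReal.ofReal (r ^ 2) := by
        refine liminf_le_of_frequently_le' (Eventually.frequently ?_)
        filter_upwards [hr] with l hl
        rw [← L.ofReal_norm_sq]
        exact ENNReal.ofReal_le_ofReal (by gcongr)

/-- The limit of a rapidly Cauchy sequence has as its field the pointwise limit of the fields, and
as its function the `L¹` limit provided by the Poincaré inequality. -/
lemma completeSpace_H0 (hn : 0 < n) (hbdd : Bornology.IsBounded (Ω : Set (Euc n))) :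
    CompleteSpace (L.H0 Ω) := by
  refine Metric.complete_of_convergent_controlled_sequences (fun N => (1 / 2) ^ N)
    (fun N => by positivity) fun u hu => ?_
  have hu' : ∀ N k l, N ≤ k → N ≤ l → ‖(u k).1 - (u l).1‖ < (1 / 2 : ℝ) ^ N := fun N k l hk hl => by
    have := hu N k l hk hl
    rwa [dist_eq_norm] at this
  obtain ⟨U, hUm, hU⟩ := L.exists_ae_tendsto_fld hu'
  have hUm' : AEStronglyMeasurable U L.ν := hUm.aestronglyMeasurable
  set V : unitInterval × Euc n →ₘ[L.ν] Euc n := AEEqFun.mk U hUm' with hV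
  have hVU : ∀ᵐ q ∂L.ν, V q = U q := AEEqFun.coeFn_mk U hUm'
  -- By Fatou's lemma the pointwise limit is also the limit for the energy.
  have hE : ∀ k, L.energy ((u k).1.fld - V : unitInterval × Euc n →ₘ[L.ν] Euc n) ≤
      ENNReal.ofReal (((1 / 2) ^ k) ^ 2) := fun k => by
    refine L.energy_sub_le_of_ae_tendsto (u k).1 (u := fun l => (u l).1) ?_ ?_
    · filter_upwards [hVU, hU] with q h4 h5
      rwa [h4]
    · filter_upwards [eventually_ge_atTop k] with l hl using (hu' k k l le_rfl hl).le
  obtain ⟨C, hC, -, hfn⟩ := L.exists_norm_fn_le hn hbdd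
  have hcau : CauchySeq fun k => (u k).1.fn := by
    refine cauchySeq_of_le_tendsto_0 (fun N => C * (1 / 2) ^ N) (fun k l N hk hl => ?_) ?_
    · rw [dist_eq_norm]
      exact (hfn (u k - u l)).trans (by gcongr; exact (hu' N k l hk hl).le)
    · simpa using (tendsto_pow_atTop_nhds_zero_of_lt_one (r := (1 / 2 : ℝ)) (by norm_num)
        (by norm_num)).const_mul C
  obtain ⟨g, hg⟩ := cauchySeq_tendsto_of_complete hcau
  have hmem : ((u 0).1.fn - g, (u 0).1.fld - V) ∈ L.energySubmodule :=
    lt_of_le_of_lt (hE 0) ENNReal.ofReal_lt_top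
  set d : L.EnergySpace := ⟨((u 0).1.fn - g, (u 0).1.fld - V), hmem⟩ with hd
  set w : L.EnergySpace := (u 0).1 - d with hw
  have hwfn : w.fn = g := sub_sub_cancel _ _
  have hwfld : w.fld = V := sub_sub_cancel (u 0).1.fld V
  have hlim : Tendsto (fun k => ‖(u k).1 - w‖) atTop (𝓝 0) := by
    refine squeeze_zero (fun k => norm_nonneg _) (fun k => ?_)
      (tendsto_pow_atTop_nhds_zero_of_lt_one (r := (1 / 2 : ℝ)) (by norm_num) (by norm_num))
    have h1 := hE k
    have h2 : ((u k).1 - w).fld = (u k).1.fld - V := by rw [← hwfld]; rfl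
    rw [← h2, ← L.ofReal_norm_sq, ENNReal.ofReal_le_ofReal_iff (by positivity)] at h1
    exact le_of_sq_le_sq h1 (by positivity)
  have hmem' : w ∈ L.H0 Ω := by
    refine L.mem_H0_of_tendsto (w := u) ?_ hlim
    rw [hwfn]
    exact tendsto_iff_norm_sub_tendsto_zero.1 hg
  exact ⟨⟨w, hmem'⟩, tendsto_iff_norm_sub_tendsto_zero.2 hlim⟩

/-! ### Functions in `H⁰(𝓐, Ω)` and compact boundedness -/

/-- The approximating test functions can be chosen to converge almost everywhere. -/
lemma exists_testPair_seq (w : L.H0 Ω) : ∃ (φ : ℕ → 𝓓(Ω, ℝ)) (v : ℕ → L.EnergySpace),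
    (∀ k, L.IsTestPair (φ k) (v k)) ∧ Tendsto (fun k => ‖(v k).fn‖) atTop (𝓝 ‖w.1.fn‖) ∧
    Tendsto (fun k => ‖v k‖) atTop (𝓝 ‖w.1‖) ∧
    ∀ᵐ x, Tendsto (fun k => φ k x) atTop (𝓝 (w.1.fn x)) := by
  obtain ⟨φ, v, hv, h1, h2⟩ := w.2
  have h3 : Tendsto (fun k => (v k).fn) atTop (𝓝 w.1.fn) := tendsto_iff_norm_sub_tendsto_zero.2 h1
  obtain ⟨ns, hns, h4⟩ := (tendstoInMeasure_of_tendsto_Lp h3).exists_seq_tendsto_ae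
  refine ⟨fun k => φ (ns k), fun k => v (ns k), fun k => hv _,
    h3.norm.comp hns.tendsto_atTop,
    (tendsto_iff_norm_sub_tendsto_zero.2 h2).norm.comp hns.tendsto_atTop, ?_⟩
  have h5 : ∀ᵐ x, ∀ k, (v (ns k)).fn x = φ (ns k) x := ae_all_iff.2 fun k => (hv _).1
  filter_upwards [h4, h5] with x h6 h7
  simpa only [h7] using h6

lemma fn_ae_eq_zero (w : L.H0 Ω) : ∀ᵐ x, x ∉ Ω → w.1.fn x = 0 := by
  obtain ⟨φ, v, -, -, -, h⟩ := L.exists_testPair_seq w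
  filter_upwards [h] with x hx hxΩ
  refine tendsto_nhds_unique hx (tendsto_const_nhds.congr fun k => ?_)
  exact (image_eq_zero_of_notMem_tsupport fun h' => hxΩ ((φ k).tsupport_subset h')).symm

/-- Compact boundedness extends from test functions to `H⁰(𝓐, Ω)`. -/
lemma CompactlyBounded.lintegral_le {L : MixedOperator n} {h : Euc n → ℝ}
    (hh : L.CompactlyBounded Ω h) {ε : ℝ} (hε : 0 < ε) : ∃ K : ℝ, 0 ≤ K ∧ ∀ w : L.H0 Ω,
      ∫⁻ x in Ω, ENNReal.ofReal (h x * w.1.fn x ^ 2) ≤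
        ENNReal.ofReal (ε * ‖w.1‖ ^ 2 + K * ‖w.1.fn‖ ^ 2) := by
  obtain ⟨-, hm, hb⟩ := hh
  obtain ⟨K, hK, hb⟩ := hb ε hε
  refine ⟨K, hK, fun w => ?_⟩
  obtain ⟨φ, v, hv, h1, h2, h3⟩ := L.exists_testPair_seq w
  calc ∫⁻ x in Ω, ENNReal.ofReal (h x * w.1.fn x ^ 2)
      = ∫⁻ x in Ω, liminf (fun k => ENNReal.ofReal (h x * φ k x ^ 2)) atTop := by
        refine lintegral_congr_ae (ae_restrict_of_ae ?_)
        filter_upwards [h3] with x hx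
        exact (Tendsto.liminf_eq (ENNReal.tendsto_ofReal ((hx.pow 2).const_mul _))).symm
    _ ≤ liminf (fun k => ∫⁻ x in Ω, ENNReal.ofReal (h x * φ k x ^ 2)) atTop :=
        lintegral_liminf_le' fun k =>
          (hm.mul ((φ k).contDiff.continuous.measurable.pow_const 2).aemeasurable).ennreal_ofReal
    _ ≤ liminf (fun k => ENNReal.ofReal (ε * ‖v k‖ ^ 2 + K * ‖(v k).fn‖ ^ 2)) atTop := by
        refine liminf_le_liminf (Eventually.of_forall fun k => (hb (φ k)).trans ?_)
        rw [← L.energy_congr (hv k).2, ← L.ofReal_norm_sq, ENNReal.ofReal_add (by positivity)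
          (by positivity), ENNReal.ofReal_mul hε.le, ENNReal.ofReal_mul hK,
          ENNReal.ofReal_pow (norm_nonneg (v k).fn)]
        gcongr
        rw [L.norm_fn_eq (hv k), ofReal_integral_eq_lintegral_ofReal
          (integrable_testFunction (φ k)).abs (Eventually.of_forall fun x => abs_nonneg _)]
        exact setLIntegral_le_lintegral _ _
    _ = _ := (ENNReal.tendsto_ofReal (((h2.pow 2).const_mul _).add
        ((h1.pow 2).const_mul _))).liminf_eq

end MixedOperator

/-! ### Boundedness and coercivity of the forms -/

/-- The Cauchy–Schwarz inequality for a function with `F² ≤ c g h`. -/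
lemma integrable_and_abs_integral_le {α : Type*} [MeasurableSpace α] {m : Measure α}
    {F g h : α → ℝ} (hF : AEStronglyMeasurable F m) (hg : Integrable g m) (hh : Integrable h m)
    (hg0 : 0 ≤ᵐ[m] g) (hh0 : 0 ≤ᵐ[m] h) {c : ℝ} (hc : 0 ≤ c)
    (hle : ∀ᵐ x ∂m, F x ^ 2 ≤ c * (g x * h x)) :
    Integrable F m ∧ |∫ x, F x ∂m| ≤ √c * (√(∫ x, g x ∂m) * √(∫ x, h x ∂m)) := by
  have hm : ∀ {k : α → ℝ}, Integrable k m → 0 ≤ᵐ[m] k → MemLp (fun x => √(k x)) 2 m :=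
    fun {k} hk hk0 => by
      rw [memLp_two_iff_integrable_sq (hk.aemeasurable.sqrt.aestronglyMeasurable)]
      refine hk.congr ?_
      filter_upwards [hk0] with x hx using (Real.sq_sqrt hx).symm
  have hi : Integrable (fun x => √(g x) * √(h x)) m := (hm hg hg0).integrable_mul (hm hh hh0)
  have hb : ∀ᵐ x ∂m, ‖F x‖ ≤ √c * (√(g x) * √(h x)) := by
    filter_upwards [hle, hg0, hh0] with x h1 h2 h3
    rw [← Real.sqrt_mul h2, ← Real.sqrt_mul hc, Real.norm_eq_abs]
    exact Real.abs_le_sqrt h1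
  refine ⟨(hi.const_mul √c).mono' hF hb, ?_⟩
  refine (norm_integral_le_of_norm_le (hi.const_mul √c) hb).trans ?_
  rw [integral_const_mul]
  gcongr
  have h2 : (2 : ℝ≥0∞) = ENNReal.ofReal 2 := by simp
  refine (integral_mul_le_Lp_mul_Lq_of_nonneg Real.HolderConjugate.two_two
    (Eventually.of_forall fun x => Real.sqrt_nonneg _)
    (Eventually.of_forall fun x => Real.sqrt_nonneg _) (h2 ▸ hm hg hg0) (h2 ▸ hm hh hh0)).trans_eq ?_
  rw [← Real.sqrt_eq_rpow, ← Real.sqrt_eq_rpow]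
  congr 2
  · refine integral_congr_ae ?_
    filter_upwards [hg0] with x hx
    simp only [Real.rpow_two, Real.sq_sqrt hx]
  · refine integral_congr_ae ?_
    filter_upwards [hh0] with x hx
    simp only [Real.rpow_two, Real.sq_sqrt hx]

/-- Bounded bilinear forms given by integrals. Bilinearity of the integrand is only required almost
everywhere, since it involves representatives of classes of functions. -/
lemma exists_clm_eq_integral {E α : Type*} [SeminormedAddCommGroup E] [NormedSpace ℝ E]
    [MeasurableSpace α] {m : Measure α} {F : E → E → α → ℝ} (hint : ∀ u v, Integrable (F u v) m)
    (hadd₁ : ∀ u u' v, F (u + u') v =ᵐ[m] F u v + F u' v)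
    (hsmul₁ : ∀ (r : ℝ) u v, F (r • u) v =ᵐ[m] fun x => r * F u v x)
    (hadd₂ : ∀ u v v', F u (v + v') =ᵐ[m] F u v + F u v')
    (hsmul₂ : ∀ (r : ℝ) u v, F u (r • v) =ᵐ[m] fun x => r * F u v x)
    {C : ℝ} (hC : ∀ u v, |∫ x, F u v x ∂m| ≤ C * ‖u‖ * ‖v‖) :
    ∃ B : E →L[ℝ] E →L[ℝ] ℝ, ∀ u v, B u v = ∫ x, F u v x ∂m := by
  refine ⟨(LinearMap.mk₂ ℝ (fun u v => ∫ x, F u v x ∂m) (fun u u' v => ?_) (fun r u v => ?_)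
    (fun u v v' => ?_) (fun r u v => ?_)).mkContinuous₂ C hC, fun u v => rfl⟩
  · rw [integral_congr_ae (hadd₁ u u' v)]
    exact integral_add (hint u v) (hint u' v)
  · rw [integral_congr_ae (hsmul₁ r u v), integral_const_mul, smul_eq_mul]
  · rw [integral_congr_ae (hadd₂ u v v')]
    exact integral_add (hint u v) (hint u v')
  · rw [integral_congr_ae (hsmul₂ r u v), integral_const_mul, smul_eq_mul]

lemma matForm_add_right {n : ℕ} (M : Matrix (Fin n) (Fin n) ℝ) (ξ η ψ : Euc n) :
    matForm M ψ (ξ + η) = matForm M ψ ξ + matForm M ψ η := by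
  simp only [matForm, PiLp.add_apply, mul_add, Finset.sum_add_distrib]

lemma matForm_smul_right {n : ℕ} (M : Matrix (Fin n) (Fin n) ℝ) (r : ℝ) (ξ ψ : Euc n) :
    matForm M ψ (r • ξ) = r * matForm M ψ ξ := by
  simp only [matForm, PiLp.smul_apply, smul_eq_mul, Finset.mul_sum]
  refine Finset.sum_congr rfl fun i _ => Finset.sum_congr rfl fun j _ => ?_
  ring

lemma matForm_eq_sum_mulVec {n : ℕ} (M : Matrix (Fin n) (Fin n) ℝ) (ξ ψ : Euc n) :
    matForm M ξ ψ = ∑ i, (M *ᵥ (ψ : Fin n → ℝ)) i * ξ i := by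
  refine Finset.sum_congr rfl fun i _ => ?_
  rw [Matrix.mulVec, dotProduct, Finset.sum_mul]
  exact Finset.sum_congr rfl fun j _ => by ring

namespace MixedOperator

variable {n : ℕ} (L : MixedOperator n) {Ω : TopologicalSpace.Opens (Euc n)}

lemma bdB_nonneg (x : Euc n) (i j : Fin n) : 0 ≤ L.bdB x i j :=
  (abs_nonneg _).trans (L.abs_inv_le 1 zero_lt_one x i j)

lemma bdA_nonneg (x : Euc n) (i : Fin n) : 0 ≤ L.bdA x i :=
  (abs_nonneg _).trans (L.abs_a_le 1 zero_lt_one x i)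

lemma bdb_nonneg (x : Euc n) (i : Fin n) : 0 ≤ L.bdb x i :=
  (abs_nonneg _).trans (L.abs_b_le 1 zero_lt_one x i)

lemma sum_bdA_nonneg (x : Euc n) : 0 ≤ ∑ i, ∑ j, L.bdB x i j * (L.bdA x i * L.bdA x j) :=
  Finset.sum_nonneg fun i _ => Finset.sum_nonneg fun j _ =>
    mul_nonneg (L.bdB_nonneg x i j) (mul_nonneg (L.bdA_nonneg x i) (L.bdA_nonneg x j))

lemma sum_bdb_nonneg (x : Euc n) : 0 ≤ ∑ i, ∑ j, L.bdB x i j * (L.bdb x i * L.bdb x j) :=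
  Finset.sum_nonneg fun i _ => Finset.sum_nonneg fun j _ =>
    mul_nonneg (L.bdB_nonneg x i j) (mul_nonneg (L.bdb_nonneg x i) (L.bdb_nonneg x j))

lemma f_eq (x : Euc n) : L.f x = ∑ i, ∑ j, L.bdB x i j * (L.bdA x i * L.bdA x j) +
    ∑ i, ∑ j, L.bdB x i j * (L.bdb x i * L.bdb x j) + |L.a₀ x| := by
  simp only [f, mul_add, Finset.sum_add_distrib]

lemma f_nonneg (x : Euc n) : 0 ≤ L.f x := by
  rw [f_eq]
  linarith [L.sum_bdA_nonneg x, L.sum_bdb_nonneg x, abs_nonneg (L.a₀ x)]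

lemma abs_a₀_le (x : Euc n) : |L.a₀ x| ≤ L.f x := by
  rw [f_eq]
  linarith [L.sum_bdA_nonneg x, L.sum_bdb_nonneg x]

lemma isUnit_det {s : unitInterval} (hs : 0 < s) (x : Euc n) : IsUnit (L.A s x).det := by
  rw [isUnit_iff_ne_zero]
  intro h
  obtain ⟨v, hv, h0⟩ := Matrix.exists_mulVec_eq_zero_iff.2 h
  have h1 := L.posDef s hs x (WithLp.toLp 2 v) (by simpa using hv)
  rw [matForm_eq_sum_mulVec] at h1
  simp [h0] at h1

/-- A first order coefficient `c` acts on vectors `ξ` as `ξᵀ 𝓐 ψ` with `ψ = 𝓐⁻¹ c`; hence the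
Cauchy–Schwarz inequality for `𝓐` bounds `c · ξ`. -/
lemma sq_sum_mul_le {K : ℝ} (hK : 0 < K)
    (hCS : ∀ s : unitInterval, 0 < s → ∀ x ξ ψ,
      |matForm (L.A s x) ξ ψ| ^ 2 ≤ K * (matForm (L.A s x) ξ ξ * matForm (L.A s x) ψ ψ))
    {s : unitInterval} (hs : 0 < s) (x : Euc n) {c d : Fin n → ℝ} (hcd : ∀ i, |c i| ≤ d i)
    (ξ : Euc n) :
    (∑ i, c i * ξ i) ^ 2 ≤ K * ((∑ i, ∑ j, L.bdB x i j * (d i * d j)) *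
      matForm (symPart (L.A s x)) ξ ξ) := by
  set ψ : Euc n := WithLp.toLp 2 ((L.A s x)⁻¹ *ᵥ c) with hψ
  have hAψ : L.A s x *ᵥ (ψ : Fin n → ℝ) = c := by
    change L.A s x *ᵥ ((L.A s x)⁻¹ *ᵥ c) = c
    rw [Matrix.mulVec_mulVec, Matrix.mul_nonsing_inv _ (L.isUnit_det hs x), Matrix.one_mulVec]
  have h1 : matForm (L.A s x) ξ ψ = ∑ i, c i * ξ i := by rw [matForm_eq_sum_mulVec, hAψ]
  have h2 : matForm (L.A s x) ψ ψ ≤ ∑ i, ∑ j, L.bdB x i j * (d i * d j) := by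
    rw [matForm_eq_sum_mulVec, hAψ]
    refine Finset.sum_le_sum fun i _ => ?_
    change c i * ((L.A s x)⁻¹ *ᵥ c) i ≤ _
    rw [Matrix.mulVec, dotProduct, Finset.mul_sum]
    refine Finset.sum_le_sum fun j _ => (le_abs_self _).trans ?_
    rw [abs_mul, abs_mul, mul_left_comm]
    have hd : ∀ i, 0 ≤ d i := fun i => (abs_nonneg _).trans (hcd i)
    have := hd i
    have := L.bdB_nonneg x i j
    gcongr
    · exact L.abs_inv_le s hs x i j
    · exact hcd i
    · exact hcd j
  have h3 : 0 ≤ matForm (L.A s x) ξ ξ := by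
    rcases eq_or_ne ξ 0 with rfl | h
    · simp [matForm]
    · exact (L.posDef s hs x ξ h).le
  have h4 := hCS s hs x ξ ψ
  rw [h1, sq_abs] at h4
  rw [matForm_symPart_self]
  refine h4.trans ?_
  rw [mul_comm (matForm (L.A s x) ξ ξ)]
  gcongr

/-- `∫_Ω f u²` is finite, with the quantitative bound provided by compact boundedness. -/
lemma CompactlyBounded.integrable_and_le {L : MixedOperator n} {h : Euc n → ℝ}
    (hh : L.CompactlyBounded Ω h) {ε : ℝ} (hε : 0 < ε) : ∃ K : ℝ, 0 ≤ K ∧ ∀ w : L.H0 Ω,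
      IntegrableOn (fun x => h x * w.1.fn x ^ 2) Ω ∧
      ∫ x in Ω, h x * w.1.fn x ^ 2 ≤ ε * ‖w‖ ^ 2 + K * ‖w.1.fn‖ ^ 2 := by
  obtain ⟨K, hK, hb⟩ := hh.lintegral_le hε
  refine ⟨K, hK, fun w => ?_⟩
  have h0 : 0 ≤ᵐ[volume.restrict Ω] fun x => h x * w.1.fn x ^ 2 := by
    filter_upwards [ae_restrict_mem Ω.isOpen.measurableSet] with x hx
    exact mul_nonneg (hh.1 x hx) (sq_nonneg _)
  have hm : AEStronglyMeasurable (fun x => h x * w.1.fn x ^ 2) (volume.restrict Ω) :=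
    (hh.2.1.mul ((Lp.aestronglyMeasurable w.1.fn).aemeasurable.restrict.pow_const
      2)).aestronglyMeasurable
  have hi : IntegrableOn (fun x => h x * w.1.fn x ^ 2) Ω := by
    refine ⟨hm, ?_⟩
    rw [hasFiniteIntegral_iff_ofReal h0]
    exact (hb w).trans_lt ENNReal.ofReal_lt_top
  refine ⟨hi, ?_⟩
  have := hb w
  rw [← ofReal_integral_eq_lintegral_ofReal hi h0,
    ENNReal.ofReal_le_ofReal_iff (by positivity)] at this
  exact this

lemma exists_integral_le_norm_sq (hn : 0 < n) (hbdd : Bornology.IsBounded (Ω : Set (Euc n)))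
    {h : Euc n → ℝ} (hh : L.CompactlyBounded Ω h) : ∃ M : ℝ, 0 ≤ M ∧ ∀ w : L.H0 Ω,
      ∫ x in Ω, h x * w.1.fn x ^ 2 ≤ M * ‖w‖ ^ 2 := by
  obtain ⟨K, hK, hb⟩ := hh.integrable_and_le one_pos
  obtain ⟨C, hC, -, hP⟩ := L.exists_norm_fn_le hn hbdd
  refine ⟨1 + K * C ^ 2, by positivity, fun w => (hb w).2.trans ?_⟩
  have h1 : ‖w.1.fn‖ ^ 2 ≤ (C * ‖w‖) ^ 2 := by
    gcongr
    exact hP w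
  rw [add_mul, mul_assoc, ← mul_pow]
  gcongr

/-- A zero order form `∫_Ω c u v` with `|c| ≤ h`, where `h` is compactly bounded. -/
lemma CompactlyBounded.integrable_mul {L : MixedOperator n} {h : Euc n → ℝ}
    (hh : L.CompactlyBounded Ω h) {c : Euc n → ℝ} (hc : AEMeasurable c (volume.restrict Ω))
    (hch : ∀ x, |c x| ≤ h x) (u v : L.H0 Ω) :
    IntegrableOn (fun x => c x * u.1.fn x * v.1.fn x) Ω ∧
    |∫ x in Ω, c x * u.1.fn x * v.1.fn x| ≤
      √(∫ x in Ω, h x * u.1.fn x ^ 2) * √(∫ x in Ω, h x * v.1.fn x ^ 2) := by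
  obtain ⟨K, -, hb⟩ := hh.integrable_and_le one_pos
  have hm : ∀ w : L.H0 Ω, AEMeasurable w.1.fn (volume.restrict Ω) := fun w =>
    (Lp.aestronglyMeasurable w.1.fn).aemeasurable.restrict
  have h0 : ∀ x, 0 ≤ h x := fun x => (abs_nonneg _).trans (hch x)
  have := integrable_and_abs_integral_le (F := fun x => c x * u.1.fn x * v.1.fn x)
    ((hc.mul (hm u)).mul (hm v)).aestronglyMeasurable (hb u).1 (hb v).1
    (Eventually.of_forall fun x => mul_nonneg (h0 x) (sq_nonneg _))
    (Eventually.of_forall fun x => mul_nonneg (h0 x) (sq_nonneg _)) zero_le_one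
    (Eventually.of_forall fun x => ?_)
  · rwa [Real.sqrt_one, one_mul] at this
  · have h1 : c x ^ 2 ≤ h x ^ 2 := by
      rw [← sq_abs]
      exact pow_le_pow_left₀ (abs_nonneg _) (hch x) 2
    calc (c x * u.1.fn x * v.1.fn x) ^ 2 = c x ^ 2 * (u.1.fn x ^ 2 * v.1.fn x ^ 2) := by ring
      _ ≤ h x ^ 2 * (u.1.fn x ^ 2 * v.1.fn x ^ 2) := by gcongr
      _ = _ := by ring

lemma aemeasurable_fld_apply (w : L.EnergySpace) (i : Fin n) :
    AEMeasurable (fun q => w.fld q i) L.ν :=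
  (by fun_prop : Measurable fun ξ : Euc n => ξ i).comp_aemeasurable
    w.fld.aestronglyMeasurable.aemeasurable

lemma aemeasurable_fn_snd (w : L.EnergySpace) : AEMeasurable (fun q => w.fn q.2) L.ν :=
  (Lp.aestronglyMeasurable w.fn).aemeasurable.comp_quasiMeasurePreserving
    Measure.quasiMeasurePreserving_snd

/-- The principal part of the form is bounded. -/
lemma integrable_principal {K : ℝ} (hK : 0 < K)
    (hCS : ∀ s : unitInterval, 0 < s → ∀ x ξ ψ,
      |matForm (L.A s x) ξ ψ| ^ 2 ≤ K * (matForm (L.A s x) ξ ξ * matForm (L.A s x) ψ ψ))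
    (u v : L.EnergySpace) :
    Integrable (fun q => matForm (L.A q.1 q.2) (v.fld q) (u.fld q)) L.ν ∧
    |∫ q, matForm (L.A q.1 q.2) (v.fld q) (u.fld q) ∂L.ν| ≤ √K * (‖v‖ * ‖u‖) := by
  have hA := L.measurable_A
  have hae : ∀ w : L.EnergySpace,
      0 ≤ᵐ[L.ν] fun q => matForm (symPart (L.A q.1 q.2)) (w.fld q) (w.fld q) := fun w => by
    filter_upwards [L.ae_nonneg] with q hq using hq _
  have := integrable_and_abs_integral_le
    (F := fun q => matForm (L.A q.1 q.2) (v.fld q) (u.fld q)) ?_ (EnergySpace.integrable v v)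
    (EnergySpace.integrable u u) (hae v) (hae u) hK.le ?_
  · rwa [← L.norm_sq_eq, ← L.norm_sq_eq, Real.sqrt_sq (norm_nonneg _),
      Real.sqrt_sq (norm_nonneg _)] at this
  · refine AEMeasurable.aestronglyMeasurable ?_
    unfold matForm
    refine Finset.aemeasurable_fun_sum _ fun i _ => Finset.aemeasurable_fun_sum _ fun j _ => ?_
    exact ((hA i j).aemeasurable.mul (L.aemeasurable_fld_apply v i)).mul
      (L.aemeasurable_fld_apply u j)
  · filter_upwards [L.ae_pos] with q hq
    rw [matForm_symPart_self, matForm_symPart_self, ← sq_abs]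
    exact hCS q.1 hq q.2 _ _

/-- First order terms `∫∫ c_i u D^s_i v` are controlled by `∫_Ω f u²` and the energy of `v`. -/
lemma integrable_firstOrder {K : ℝ} (hK : 0 < K)
    (hCS : ∀ s : unitInterval, 0 < s → ∀ x ξ ψ,
      |matForm (L.A s x) ξ ψ| ^ 2 ≤ K * (matForm (L.A s x) ξ ξ * matForm (L.A s x) ψ ψ))
    [IsFiniteMeasure L.μ] (hf : L.CompactlyBounded Ω L.f)
    {c : unitInterval → Euc n → Fin n → ℝ} {d : Euc n → Fin n → ℝ}
    (hc : ∀ i, Measurable fun q : unitInterval × Euc n => c q.1 q.2 i)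
    (hcd : ∀ s : unitInterval, 0 < s → ∀ x i, |c s x i| ≤ d x i)
    (hd : ∀ x, ∑ i, ∑ j, L.bdB x i j * (d x i * d x j) ≤ L.f x) (u v : L.H0 Ω) :
    Integrable (fun q => ∑ i, c q.1 q.2 i * u.1.fn q.2 * v.1.fld q i) L.ν ∧
    |∫ q, ∑ i, c q.1 q.2 i * u.1.fn q.2 * v.1.fld q i ∂L.ν| ≤
      √K * (√(L.μ.real Set.univ * ∫ x in Ω, L.f x * u.1.fn x ^ 2) * ‖v‖) := by
  obtain ⟨K', -, hb⟩ := hf.integrable_and_le one_pos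
  set g : Euc n → ℝ := (Ω : Set (Euc n)).indicator fun x => L.f x * u.1.fn x ^ 2 with hg
  have hgi : Integrable g := (integrable_indicator_iff Ω.isOpen.measurableSet).2 (hb u).1
  have hgν : Integrable (fun q : unitInterval × Euc n => g q.2) L.ν := hgi.comp_snd L.μ
  have hgI : ∫ q, g q.2 ∂L.ν = L.μ.real Set.univ * ∫ x in Ω, L.f x * u.1.fn x ^ 2 := by
    rw [ν, integral_fun_snd, smul_eq_mul, hg, integral_indicator Ω.isOpen.measurableSet]
  have := integrable_and_abs_integral_le
    (F := fun q => ∑ i, c q.1 q.2 i * u.1.fn q.2 * v.1.fld q i) ?_ hgν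
    (EnergySpace.integrable v.1 v.1) ?_ ?_ hK.le ?_
  · rwa [← L.norm_sq_eq, hgI, Real.sqrt_sq (norm_nonneg _)] at this
  · refine AEMeasurable.aestronglyMeasurable ?_
    refine Finset.aemeasurable_fun_sum _ fun i _ => ?_
    exact ((hc i).aemeasurable.mul (L.aemeasurable_fn_snd u.1)).mul
      (L.aemeasurable_fld_apply v.1 i)
  · refine Eventually.of_forall fun q => Set.indicator_nonneg (fun x _ => ?_) _
    exact mul_nonneg (L.f_nonneg x) (sq_nonneg _)
  · filter_upwards [L.ae_nonneg] with q hq using hq _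
  · have h0 : ∀ᵐ q ∂L.ν, q.2 ∉ Ω → u.1.fn q.2 = 0 :=
      Measure.quasiMeasurePreserving_snd.ae (L.fn_ae_eq_zero u)
    filter_upwards [L.ae_pos, L.ae_nonneg, h0] with q h1 h2 h3
    have e : ∑ i, c q.1 q.2 i * u.1.fn q.2 * v.1.fld q i =
        u.1.fn q.2 * ∑ i, c q.1 q.2 i * v.1.fld q i := by
      rw [Finset.mul_sum]
      exact Finset.sum_congr rfl fun i _ => by ring
    rw [e]
    by_cases hq : q.2 ∈ Ω
    · have h4 := L.sq_sum_mul_le hK hCS h1 q.2 (hcd q.1 h1 q.2) (v.1.fld q)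
      rw [hg, Set.indicator_of_mem hq, mul_pow]
      have h5 := h2 (v.1.fld q)
      calc _ ≤ u.1.fn q.2 ^ 2 * (K * (L.f q.2 * matForm (symPart (L.A q.1 q.2)) (v.1.fld q)
            (v.1.fld q))) := by
            gcongr
            refine h4.trans ?_
            gcongr
            exact hd q.2
        _ = _ := by ring
    · have h6 : g q.2 = 0 := Set.indicator_of_notMem hq _
      simp [h3 hq, h6]

end MixedOperator

/-! ### The Fredholm alternative -/

namespace MixedOperator

variable {n : ℕ} (L : MixedOperator n) {Ω : TopologicalSpace.Opens (Euc n)}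

lemma formShift_zero_zero (σ : ℝ) : L.formShift σ (0 : L.H0 Ω) 0 = 0 := by
  have h1 : ∀ᵐ x ∂volume.restrict (Ω : Set (Euc n)), (0 : L.H0 Ω).1.fn x = 0 :=
    ae_restrict_of_ae (Lp.coeFn_zero ℝ 1 volume)
  have h2 : ∀ᵐ q ∂L.ν, (0 : L.H0 Ω).1.fn q.2 = 0 :=
    Measure.quasiMeasurePreserving_snd.ae (Lp.coeFn_zero ℝ 1 volume)
  have h3 : ∀ᵐ q ∂L.ν, (0 : L.H0 Ω).1.fld q = 0 := AEEqFun.coeFn_zero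
  rw [formShift, form, integral_eq_zero_of_ae (f := fun q => _ + _ + _) (by
      filter_upwards [h2, h3] with q e1 e2
      simp only [e1, e2, matForm, PiLp.zero_apply, mul_zero, Finset.sum_const_zero, add_zero,
        Pi.zero_apply]),
    integral_eq_zero_of_ae (f := fun x => L.a₀ x * _ * _) (by
      filter_upwards [h1] with x e
      simp only [e, mul_zero, Pi.zero_apply]),
    integral_eq_zero_of_ae (f := fun x => L.f x * _ * _) (by
      filter_upwards [h1] with x e
      simp only [e, mul_zero, Pi.zero_apply])]
  simp

/-- `∫_Ω c u v`, for `|c|` at most a compactly bounded `h`, is a bounded bilinear form. -/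
lemma CompactlyBounded.exists_clm {L : MixedOperator n} (hn : 0 < n)
    (hbdd : Bornology.IsBounded (Ω : Set (Euc n))) {h : Euc n → ℝ}
    (hh : L.CompactlyBounded Ω h) {c : Euc n → ℝ} (hc : AEMeasurable c (volume.restrict Ω))
    (hch : ∀ x, |c x| ≤ h x) : ∃ B : L.H0 Ω →L[ℝ] L.H0 Ω →L[ℝ] ℝ,
      ∀ u v, B u v = ∫ x in Ω, c x * u.1.fn x * v.1.fn x := by
  obtain ⟨M, hM, hJ⟩ := L.exists_integral_le_norm_sq hn hbdd hh
  have hadd : ∀ u v : L.H0 Ω, ∀ᵐ x ∂volume.restrict (Ω : Set (Euc n)),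
      (u + v).1.fn x = u.1.fn x + v.1.fn x := fun u v =>
    ae_restrict_of_ae (Lp.coeFn_add u.1.fn v.1.fn)
  have hsmul : ∀ (r : ℝ) (u : L.H0 Ω), ∀ᵐ x ∂volume.restrict (Ω : Set (Euc n)),
      (r • u).1.fn x = r * u.1.fn x := fun r u =>
    ae_restrict_of_ae (Lp.coeFn_smul r u.1.fn)
  refine exists_clm_eq_integral (m := volume.restrict Ω)
    (F := fun (u v : L.H0 Ω) x => c x * u.1.fn x * v.1.fn x) (C := M)
    (fun u v => (hh.integrable_mul hc hch u v).1) (fun u u' v => ?_) (fun r u v => ?_)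
    (fun u v v' => ?_) (fun r u v => ?_) (fun u v => ?_)
  · filter_upwards [hadd u u'] with x hx
    rw [hx, Pi.add_apply]; ring
  · filter_upwards [hsmul r u] with x hx
    rw [hx]; ring
  · filter_upwards [hadd v v'] with x hx
    rw [hx, Pi.add_apply]; ring
  · filter_upwards [hsmul r v] with x hx
    rw [hx]; ring
  · refine (hh.integrable_mul hc hch u v).2.trans ?_
    calc _ ≤ √(M * ‖u‖ ^ 2) * √(M * ‖v‖ ^ 2) := by gcongr <;> exact hJ _
      _ = √M * √M * ‖u‖ * ‖v‖ := by
        rw [Real.sqrt_mul hM, Real.sqrt_mul hM, Real.sqrt_sq (norm_nonneg _),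
          Real.sqrt_sq (norm_nonneg _)]
        ring
      _ = M * ‖u‖ * ‖v‖ := by rw [Real.mul_self_sqrt hM]

/-- The form of `𝓛` is a bounded bilinear form, coercive up to a multiple of `∫_Ω f u²`. -/
lemma exists_clm_form (hn : 0 < n) (hbdd : Bornology.IsBounded (Ω : Set (Euc n)))
    [IsFiniteMeasure L.μ] (hf : L.CompactlyBounded Ω L.f) :
    ∃ (B : L.H0 Ω →L[ℝ] L.H0 Ω →L[ℝ] ℝ) (σ₀ : ℝ), (∀ u v, B u v = L.form u v) ∧
      ∀ u : L.H0 Ω, 1 / 2 * ‖u‖ ^ 2 ≤ B u u + σ₀ * ∫ x in Ω, L.f x * u.1.fn x ^ 2 := by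
  obtain ⟨K, hK, hCS⟩ := L.cauchySchwarz
  obtain ⟨M, hM, hJ⟩ := L.exists_integral_le_norm_sq hn hbdd hf
  obtain ⟨Z, hZ⟩ := hf.exists_clm hn hbdd L.measurable_a₀.aemeasurable L.abs_a₀_le
  set m := L.μ.real Set.univ with hm
  have hm0 : 0 ≤ m := measureReal_nonneg
  have hda : ∀ x, ∑ i, ∑ j, L.bdB x i j * (L.bdA x i * L.bdA x j) ≤ L.f x := fun x => by
    rw [f_eq]; linarith [L.sum_bdb_nonneg x, abs_nonneg (L.a₀ x)]
  have hdb : ∀ x, ∑ i, ∑ j, L.bdB x i j * (L.bdb x i * L.bdb x j) ≤ L.f x := fun x => by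
    rw [f_eq]; linarith [L.sum_bdA_nonneg x, abs_nonneg (L.a₀ x)]
  have hP := fun u v : L.H0 Ω => L.integrable_principal hK hCS u.1 v.1
  have hA := fun u v : L.H0 Ω =>
    L.integrable_firstOrder hK hCS hf L.measurable_a L.abs_a_le hda u v
  have hB := fun u v : L.H0 Ω =>
    L.integrable_firstOrder hK hCS hf L.measurable_b L.abs_b_le hdb v u
  have hadd : ∀ u v : L.H0 Ω, ∀ᵐ q ∂L.ν, (u + v).1.fn q.2 = u.1.fn q.2 + v.1.fn q.2 ∧
      (u + v).1.fld q = u.1.fld q + v.1.fld q := fun u v =>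
    (Measure.quasiMeasurePreserving_snd.ae (Lp.coeFn_add u.1.fn v.1.fn)).and
      (AEEqFun.coeFn_add u.1.fld v.1.fld)
  have hsmul : ∀ (r : ℝ) (u : L.H0 Ω), ∀ᵐ q ∂L.ν, (r • u).1.fn q.2 = r * u.1.fn q.2 ∧
      (r • u).1.fld q = r • u.1.fld q := fun r u =>
    (Measure.quasiMeasurePreserving_snd.ae (Lp.coeFn_smul r u.1.fn)).and
      (AEEqFun.coeFn_smul r u.1.fld)
  have hsqrt : ∀ u : L.H0 Ω, √(m * ∫ x in Ω, L.f x * u.1.fn x ^ 2) ≤ √(m * M) * ‖u‖ := fun u => by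
    calc _ ≤ √(m * (M * ‖u‖ ^ 2)) := by gcongr; exact hJ u
      _ = _ := by rw [← mul_assoc, Real.sqrt_mul (by positivity), Real.sqrt_sq (norm_nonneg u)]
  have hsplit : ∀ u v : L.H0 Ω, ∫ q, (matForm (L.A q.1 q.2) (v.1.fld q) (u.1.fld q)
      + ∑ i, L.a q.1 q.2 i * u.1.fn q.2 * v.1.fld q i
      + ∑ i, L.b q.1 q.2 i * v.1.fn q.2 * u.1.fld q i) ∂L.ν =
      (∫ q, matForm (L.A q.1 q.2) (v.1.fld q) (u.1.fld q) ∂L.ν)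
      + (∫ q, ∑ i, L.a q.1 q.2 i * u.1.fn q.2 * v.1.fld q i ∂L.ν)
      + ∫ q, ∑ i, L.b q.1 q.2 i * v.1.fn q.2 * u.1.fld q i ∂L.ν := fun u v => by
    rw [← integral_add (hP u v).1 (hA u v).1]
    exact integral_add ((hP u v).1.add (hA u v).1) (hB u v).1
  obtain ⟨D, hD⟩ : ∃ D : L.H0 Ω →L[ℝ] L.H0 Ω →L[ℝ] ℝ, ∀ u v, D u v =
      ∫ q, (matForm (L.A q.1 q.2) (v.1.fld q) (u.1.fld q)
      + ∑ i, L.a q.1 q.2 i * u.1.fn q.2 * v.1.fld q i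
      + ∑ i, L.b q.1 q.2 i * v.1.fn q.2 * u.1.fld q i) ∂L.ν := by
    refine exists_clm_eq_integral (C := √K + 2 * (√K * √(m * M)))
      (fun u v => ((hP u v).1.add (hA u v).1).add (hB u v).1) (fun u u' v => ?_)
      (fun r u v => ?_) (fun u v v' => ?_) (fun r u v => ?_) (fun u v => ?_)
    · filter_upwards [hadd u u'] with q hq
      rw [Pi.add_apply, hq.1, hq.2, matForm_add_right]
      simp only [PiLp.add_apply, mul_add, add_mul, Finset.sum_add_distrib]
      ring
    · filter_upwards [hsmul r u] with q hq
      rw [hq.1, hq.2, matForm_smul_right, mul_add, mul_add, Finset.mul_sum, Finset.mul_sum]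
      simp only [PiLp.smul_apply, smul_eq_mul]
      congr 1
      · congr 1
        exact Finset.sum_congr rfl fun i _ => by ring
      · exact Finset.sum_congr rfl fun i _ => by ring
    · filter_upwards [hadd v v'] with q hq
      rw [Pi.add_apply, hq.1, hq.2, matForm_add_left]
      simp only [PiLp.add_apply, mul_add, add_mul, Finset.sum_add_distrib]
      ring
    · filter_upwards [hsmul r v] with q hq
      rw [hq.1, hq.2, matForm_smul_left, mul_add, mul_add, Finset.mul_sum, Finset.mul_sum]
      simp only [PiLp.smul_apply, smul_eq_mul]
      congr 1
      · congr 1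
        exact Finset.sum_congr rfl fun i _ => by ring
      · exact Finset.sum_congr rfl fun i _ => by ring
    · rw [hsplit]
      have h1 : _ ≤ √K * (‖v‖ * ‖u‖) := (hP u v).2
      have h2 := (hA u v).2.trans (show _ ≤ √K * ((√(m * M) * ‖u‖) * ‖v‖) by
        gcongr
        exact hsqrt u)
      have h3 := (hB u v).2.trans (show _ ≤ √K * ((√(m * M) * ‖v‖) * ‖u‖) by
        gcongr
        exact hsqrt v)
      refine (abs_add_le _ _).trans ((add_le_add ((abs_add_le _ _).trans
        (add_le_add h1 h2)) h3).trans_eq ?_)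
      ring
  refine ⟨D + Z, 2 * (K * m) + 1, fun u v => ?_, fun u => ?_⟩
  · rw [add_apply, add_apply, hD, hZ]; rfl
  · set J := ∫ x in Ω, L.f x * u.1.fn x ^ 2 with hJdef
    have hJ0 : 0 ≤ J := integral_nonneg fun x => mul_nonneg (L.f_nonneg x) (sq_nonneg _)
    have h1 : ∫ q, matForm (L.A q.1 q.2) (u.1.fld q) (u.1.fld q) ∂L.ν = ‖u‖ ^ 2 := by
      change _ = ‖u.1‖ ^ 2
      rw [L.norm_sq_eq]
      simp only [matForm_symPart_self]
    have h2 := neg_le_of_abs_le (hA u u).2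
    have h3 := neg_le_of_abs_le (hB u u).2
    have h4 := (hf.integrable_mul L.measurable_a₀.aemeasurable L.abs_a₀_le u u).2
    rw [Real.mul_self_sqrt hJ0] at h4
    have h5 := neg_le_of_abs_le h4
    rw [add_apply, add_apply, hD, hZ, hsplit, h1]
    have h6 : √K * √(m * J) * (√K * √(m * J)) = K * (m * J) := by
      rw [mul_mul_mul_comm, Real.mul_self_sqrt hK.le, Real.mul_self_sqrt (by positivity)]
    -- The mixed terms are absorbed by `2 x y ≤ x² / 2 + 2 y²` with `y² = K m J`.
    nlinarith [sq_nonneg (‖u‖ - 2 * (√K * √(m * J)))]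

/-- The form `∫_Ω f u²` is small relative to the energy on the common kernel of finitely many
bounded functionals. -/
lemma CompactlyBounded.exists_functionals {L : MixedOperator n} (hn : 0 < n)
    (hbdd : Bornology.IsBounded (Ω : Set (Euc n))) {h : Euc n → ℝ}
    (hh : L.CompactlyBounded Ω h) {ε : ℝ} (hε : 0 < ε) :
    ∃ (m : ℕ) (ℓ : Fin m → StrongDual ℝ (L.H0 Ω)), ∀ u, (∀ i, ℓ i u = 0) →
      ∫ x in Ω, h x * u.1.fn x ^ 2 ≤ ε * ‖u‖ ^ 2 := by
  obtain ⟨K, hK, hb⟩ := hh.integrable_and_le (half_pos hε)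
  obtain ⟨C, hC, -, hP⟩ := L.exists_norm_fn_le hn hbdd
  obtain ⟨m, Q, C', hQ, hc⟩ := L.exists_norm_fn_le_add_sum hn hbdd
    (θ := √(ε / (2 * (K + 1)))) (Real.sqrt_pos.2 (by positivity))
  have hi : ∀ (u : L.H0 Ω) i, IntegrableOn u.1.fn (Q i) := fun u i =>
    (L1.integrable_coeFn u.1.fn).integrableOn
  refine ⟨m, fun i => LinearMap.mkContinuous
    { toFun := fun u => ∫ x in Q i, u.1.fn x
      map_add' := fun u v => ?_
      map_smul' := fun r u => ?_ } C fun u => ?_, fun u hu => ?_⟩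
  · rw [← integral_add (hi u i) (hi v i)]
    exact integral_congr_ae (ae_restrict_of_ae (Lp.coeFn_add u.1.fn v.1.fn))
  · rw [RingHom.id_apply, smul_eq_mul, ← integral_const_mul]
    exact integral_congr_ae (ae_restrict_of_ae (Lp.coeFn_smul r u.1.fn))
  · refine le_trans ?_ (hP u)
    rw [L1.norm_eq_integral_norm]
    refine (norm_integral_le_integral_norm _).trans ?_
    exact setIntegral_le_integral (L1.integrable_coeFn u.1.fn).norm
      (Eventually.of_forall fun x => norm_nonneg _)
  · have hu' : ∀ i, ∫ x in Q i, u.1.fn x = 0 := hu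
    have h1 : ‖u.1.fn‖ ≤ √(ε / (2 * (K + 1))) * ‖u‖ := by
      refine (hc u).trans_eq ?_
      simp only [hu', abs_zero, Finset.sum_const_zero, mul_zero, add_zero]
      rfl
    have h2 : ‖u.1.fn‖ ^ 2 ≤ ε / (2 * (K + 1)) * ‖u‖ ^ 2 := by
      rw [← Real.sq_sqrt (show 0 ≤ ε / (2 * (K + 1)) by positivity), ← mul_pow]
      exact pow_le_pow_left₀ (norm_nonneg _) h1 2
    have h3 : K * (ε / (2 * (K + 1)) * ‖u‖ ^ 2) ≤ ε / 2 * ‖u‖ ^ 2 := by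
      rw [← mul_assoc]
      gcongr
      rw [mul_div_assoc', div_le_div_iff₀ (by positivity) two_pos]
      nlinarith
    calc _ ≤ ε / 2 * ‖u‖ ^ 2 + K * ‖u.1.fn‖ ^ 2 := (hb u).2
      _ ≤ ε / 2 * ‖u‖ ^ 2 + K * (ε / (2 * (K + 1)) * ‖u‖ ^ 2) := by gcongr
      _ ≤ ε / 2 * ‖u‖ ^ 2 + ε / 2 * ‖u‖ ^ 2 := by gcongr
      _ = _ := by ring

/-- The solution set of a linear problem with a nonzero homogeneous solution is an affine line or
larger, unless it is empty. -/
lemma eq_empty_or_infinite_of_bilinear {E : Type*} [AddCommGroup E] [Module ℝ E]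
    {b : E → E → ℝ} (hadd : ∀ u u' v, b (u + u') v = b u v + b u' v)
    (hsmul : ∀ (r : ℝ) u v, b (r • u) v = r * b u v) {e : E} (he : e ≠ 0)
    (he0 : ∀ v, b e v = 0) (T : E → ℝ) :
    {u | ∀ v, b u v = T v} = ∅ ∨ {u | ∀ v, b u v = T v}.Infinite := by
  rcases Set.eq_empty_or_nonempty {u | ∀ v, b u v = T v} with h | ⟨u, hu⟩
  · exact Or.inl h
  · refine Or.inr (Set.infinite_of_injective_forall_mem (f := fun r : ℝ => u + r • e)
      (fun r r' h => ?_) fun r v => ?_)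
    · exact smul_left_injective ℝ he (add_left_cancel h)
    · rw [hadd, hsmul, he0, mul_zero, add_zero]
      exact hu v

end MixedOperator

end

theorem theorem1p1 {n : ℕ} (hn : 0 < n) (L : MixedOperator n)
    (Ω : TopologicalSpace.Opens (Euc n)) (hconn : IsConnected (Ω : Set (Euc n)))
    (hbdd : Bornology.IsBounded (Ω : Set (Euc n)))
    (hf : L.CompactlyBounded Ω L.f) :
    ∃ S : Set ℝ, S.Countable ∧ (∀ x : ℝ, ¬ AccPt x (𝓟 S)) ∧
      (∀ σ ∈ S, L.IsEigenvalue Ω σ) ∧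
      (∀ σ ∉ S, ∀ T : StrongDual ℝ (L.H0 Ω), ∃! u : L.H0 Ω, L.Solves σ T u) ∧
      (∀ σ ∈ S, ∀ T : StrongDual ℝ (L.H0 Ω),
        {u : L.H0 Ω | L.Solves σ T u} = ∅ ∨ {u : L.H0 Ω | L.Solves σ T u}.Infinite) := by
  rcases eq_or_ne (L.μ Set.univ) ∞ with hμ | hμ
  · have hsub : Subsingleton (L.H0 Ω) := L.subsingleton_H0 hn hbdd hμ
    refine ⟨∅, Set.countable_empty, fun x => ?_, by simp, fun σ _ T => ?_, by simp⟩
    · simp [AccPt]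
    · refine ⟨0, fun v => ?_, fun u _ => Subsingleton.elim _ _⟩
      rw [Subsingleton.elim v 0, L.formShift_zero_zero, map_zero]
  have : IsFiniteMeasure L.μ := ⟨hμ.lt_top⟩
  obtain ⟨B, σ₀, hB, hcoer⟩ := L.exists_clm_form hn hbdd hf
  obtain ⟨I, hI⟩ := hf.exists_clm hn hbdd hf.2.1 fun x => (abs_of_nonneg (L.f_nonneg x)).le
  have hIsq : ∀ u, I u u = ∫ x in Ω, L.f x * u.1.fn x ^ 2 := fun u => by
    rw [hI]
    simp only [mul_assoc, pow_two]
  have hBI : ∀ (σ : ℝ) (u v : L.H0 Ω), L.formShift σ u v = B u v + σ * I u v := fun σ u v => by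
    rw [hB, hI]; rfl
  let _ : NormedAddCommGroup (L.H0 Ω) :=
    NormedAddCommGroup.ofSeparation (L.eq_zero_of_norm_eq_zero hn hbdd)
  have : CompleteSpace (L.H0 Ω) := L.completeSpace_H0 hn hbdd
  obtain ⟨S, hS, hacc, heig, hsol⟩ := fredholm_alternative_of_forms (H := L.H0 Ω) (B := B) (I := I)
    (fun u v => by
      rw [hI, hI]
      exact integral_congr_ae (Eventually.of_forall fun x => by ring))
    (fun u => by
      rw [hIsq]
      exact integral_nonneg fun x => mul_nonneg (L.f_nonneg x) (sq_nonneg _))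
    (fun ε hε => by
      obtain ⟨m, ℓ, h⟩ := hf.exists_functionals hn hbdd hε
      exact ⟨m, ℓ, fun u hu => by rw [hIsq]; exact h u hu⟩)
    ⟨σ₀, 1 / 2, by norm_num, fun u => by rw [hIsq]; exact hcoer u⟩
  have heig' : ∀ σ ∈ S, L.IsEigenvalue Ω σ := fun σ hσ => by
    obtain ⟨u, hu, h⟩ := heig σ hσ
    exact ⟨u, hu, fun v => by rw [hBI]; exact h v⟩
  refine ⟨S, hS, hacc, heig', fun σ hσ T => ?_, fun σ hσ T => ?_⟩
  · obtain ⟨u, hu, huniq⟩ := hsol σ hσ T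
    exact ⟨u, fun v => by rw [hBI]; exact hu v, fun w hw => huniq w fun v => by
      rw [← hBI]; exact hw v⟩
  · obtain ⟨e, he, he0⟩ := heig' σ hσ
    refine MixedOperator.eq_empty_or_infinite_of_bilinear (b := L.formShift σ) (fun u u' v => ?_)
      (fun r u v => ?_) he he0 T
    · simp only [hBI, map_add, add_apply]; ring
    · simp only [hBI, map_smul, smul_apply, smul_eq_mul]; ring
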